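/- **Setting.** Let $\dot x=[J(x)-R(x)]\nabla H(x)+G(x)u$ be a port-Hamiltonian system on $\mathbb R^n$ with $J$ skew-symmetric, $R$ symmetric positive semidefinite, both continuous, and $H$ smooth. Put $J_R=J-R$ and $f_\rho=J_R\nabla H$. Let $k_{\rm base}$ be a $C^2$ positive semidefinite kernel on $\mathbb R^n$ with RKHS $\mathcal H$, and $k_{\rm phs}(x,x')=\sigma_f^2J_R(x)\nabla_x\nabla_{x'}k_{\rm base}(x,x')J_R(x')^\top$, $\sigma_f>0$. Let $x:[0,\infty)\to\mathbb R^n$ be a $C^{p+1}$ trajectory under an input $u$, with bounded $(p+1)$-st derivative and with $\operatorname{tr}k_{\rm phs}(x(t),x(t))$ bounded in $t\ge0$. Fix $M\ge1$ and a variable-step linear multistep method $\sum_{j=0}^M a_j x(t_{k+j})=\sum_{j=0}^M b_j\dot x(t_{k+j})$ that is exact on polynomials of degree $\le p$ (order $p$); its coefficients are continuous functions of the $M$ positive steps of the window, $a_j$ being homogeneous of degree $0$ and $b_j$ of degree $1$. Stacking the windows $k=1,\dots,\ell:=K-M$ of a grid $t_1<\dots<t_K$ gives $A,B\in\mathbb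 R^{\ell\times K}$; put $A_I=A\otimes I_n$, $B_I=B\otimes I_n$. **Data.** For $K>M$, the sampling times $t_1,\dots,t_K$ are independent random variables (possibly deterministic) which almost surely satisfy $0\le t_1<\dots<t_K$, $h_k:=t_{k+1}-t_k\le h_{\max}$ and $\omega^{-1}\le h_{k+1}/h_k\le\omega$. One observes $\tilde x_k=x(t_k)+\varepsilon_k$ with $\varepsilon_k\sim\mathcal N(0,\sigma_x^2I_n)$ i.i.d. and independent of the times. Let $X=(x(t_k))_k$, $U=(u(t_k))_k$, $Y=A_I\tilde X$, $K_Y=B_Ik_{\rm phs}(X,X)B_I^\top$, $k_Y(z)=B_Ik_{\rm phs}(X,z)$. With regularization $\lambda=\lambda_0\ell^{-1/5}$, $\lambda_0>0$ fixed, the Tikhonov (Gaussian process) estimator is $$\widehat f(z)=k_Y(z)^\top\,(K_Y+\ell\lambda I)^{-1}\,\bigl(Y-B_IG(X)U\bigr).$$ **Norms.** Let $\nu$ be a measure on $\mathbb R^n$ with $\int\operatorname{tr}k_{\rm phs}(z,z)\,d\nu(z)<\infty$. Put $\|v\|_{\mathcal V}^2=\int\|v\|^2d\nu$ and $\|Bv\|_{\mathcal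 W}^2=\frac1\ell\sum_{k=1}^{\ell}\mathbb E\bigl\|\sum_iB_{ki}v(x(t_i))\bigr\|^2$, and $\mathbb E[h^{2p+2}]=\frac1\ell\sum_{k=1}^{\ell}\mathbb E[h_k^{2p+2}]$. Let $c^*$ be the largest $c\ge0$ such that $c\,\|v\|_{\mathcal V}\le\|Bv\|_{\mathcal W}$ for all $v=J_R\nabla g$, $g\in\mathcal H$ (if there is no largest one, put $c^*=0$). **Proposition.** Assume $H\in\mathcal H$. There are constants $C_{\rm fit},C_{\rm bias}\in(0,\infty)$, depending only on the system, the trajectory, the kernel, the method, $p,h_{\max},\omega,\sigma_x,\lambda_0$ (not on $K$, $\ell$, the distribution of the sampling times, $\nu$ or $\eta$), such that for all $K>M$, all sampling times as above and all $\nu$ there is a finite constant $c_{\rm obs}(h)>0$, equal to the observability constant $c^*$ whenever $c^*>0$, such that for every $0<\eta\le1$, with probability at least $1-\eta$, $$\|\widehat f-f_\rho\|_{\mathcal V}^2\le\frac{C_{\rm fit}}{c_{\rm obs}^2(h)}\log\frac4\eta\;\ell^{-1/5}+\frac{C_{\rm bias}}{c_{\rm obs}^2(h)}\,\mathbb E[h^{2p+2}].$$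 -/

import Mathlib

open MeasureTheory ProbabilityTheory
open scoped NNReal ENNReal Matrix Kronecker Gradient

noncomputable section

namespace MSPHS

/-- The state space `ℝⁿ` with its Euclidean norm. -/
abbrev State (n : ℕ) := EuclideanSpace ℝ (Fin n)

/-- A port-Hamiltonian system `ẋ = [J(x) - R(x)] ∇H(x) + G(x) u`. -/
structure PortHamiltonian (n m : ℕ) where
  J : State n → Matrix (Fin n) (Fin n) ℝ
  R : State n → Matrix (Fin n) (Fin n) ℝ
  G : State n → Matrix (Fin n) (Fin m) ℝ
  H : State n → ℝ
  J_skew : ∀ x, (J x)ᵀ = -J x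
  R_posSemidef : ∀ x, (R x).PosSemidef
  J_cont : Continuous J
  R_cont : Continuous R
  H_smooth : ContDiff ℝ ((⊤ : ℕ∞) : WithTop ℕ∞) H

namespace PortHamiltonian

variable {n m : ℕ} (S : PortHamiltonian n m)

/-- `J_R(x) = J(x) - R(x)`. -/
def JR (x : State n) : Matrix (Fin n) (Fin n) ℝ := S.J x - S.R x

/-- The vector field `x ↦ J_R(x) ∇g(x)` generated by an energy function `g`. -/
def field (g : State n → ℝ) (x : State n) : State n :=
  WithLp.toLp 2 (S.JR x *ᵥ (∇ g x).ofLp)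

/-- The true zero-input drift `f(x) = J_R(x) ∇H(x)`. -/
def drift : State n → State n := S.field S.H

/-- The input part `G(x) u`. -/
def port (x : State n) (u : Fin m → ℝ) : State n := WithLp.toLp 2 (S.G x *ᵥ u)

/-- `x` is a trajectory on `[0, ∞)` under the input signal `u`. -/
def IsTrajectory (u : ℝ → Fin m → ℝ) (x : ℝ → State n) : Prop :=
  ∀ t, 0 ≤ t → HasDerivWithinAt x (S.drift (x t) + S.port (x t) (u t)) (Set.Ici 0) t

end PortHamiltonian

/-! ### Base kernel and port-Hamiltonian kernel -/

/-- The (scalar) reproducing kernel of a Hilbert space `𝓗` of functions on `ℝⁿ`. -/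
def baseKernel {n : ℕ} (𝓗 : Type*) [NormedAddCommGroup 𝓗] [InnerProductSpace ℝ 𝓗]
    [CompleteSpace 𝓗] [RKHS ℝ 𝓗 (State n) ℝ] (x y : State n) : ℝ :=
  RKHS.kernel 𝓗 x y 1

/-- The matrix `∇ₓ ∇ₓ' k(x, x')` with entries `∂_{x_i} ∂_{x'_j} k(x, x')`. -/
def mixedHessian {n : ℕ} (k : State n → State n → ℝ) (x y : State n) :
    Matrix (Fin n) (Fin n) ℝ :=
  Matrix.of fun i j =>
    fderiv ℝ (fun x' => fderiv ℝ (fun y' => k x' y') y (EuclideanSpace.single j 1)) x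
      (EuclideanSpace.single i 1)

/-- `k_phs(x, x') = σ_f² J_R(x) ∇ₓ∇ₓ' k(x, x') J_R(x')ᵀ`. -/
def phsKernel {n m : ℕ} (S : PortHamiltonian n m) (k : State n → State n → ℝ) (σf : ℝ)
    (x y : State n) : Matrix (Fin n) (Fin n) ℝ :=
  σf ^ 2 • (S.JR x * mixedHessian k x y * (S.JR y)ᵀ)

/-! ### Variable-step linear multistep methods -/

/-- A variable-step linear multistep method on windows of `M + 1` nodes,
`∑ⱼ aⱼ x(tⱼ) = ∑ⱼ bⱼ ẋ(tⱼ)`. The coefficients are functions of the `M` step sizes in the window,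
continuous for positive steps. The `aⱼ` and `bⱼ / h` depend on the ratios of the steps only. -/
structure VLMM (M : ℕ) where
  a : (Fin M → ℝ) → Fin (M + 1) → ℝ
  b : (Fin M → ℝ) → Fin (M + 1) → ℝ
  a_scale : ∀ (s : ℝ) (h : Fin M → ℝ), 0 < s → (∀ i, 0 < h i) → a (s • h) = a h
  b_scale : ∀ (s : ℝ) (h : Fin M → ℝ), 0 < s → (∀ i, 0 < h i) → b (s • h) = s • b h
  a_cont : ContinuousOn a {h | ∀ i, 0 < h i}
  b_cont : ContinuousOn b {h | ∀ i, 0 < h i}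

/-- Position of node `j` in a window with steps `h`, the first node being at `0`. -/
def nodeOffset {M : ℕ} (h : Fin M → ℝ) (j : Fin (M + 1)) : ℝ :=
  ∑ i : Fin M, if i.castSucc < j then h i else 0

/-- Consistency of order `p`: the method is exact on polynomials of degree at most `p`. -/
def VLMM.HasOrder {M : ℕ} (meth : VLMM M) (p : ℕ) : Prop :=
  ∀ h : Fin M → ℝ, (∀ i, 0 < h i) → ∀ q : Polynomial ℝ, q.natDegree ≤ p →
    ∑ j, meth.a h j * q.eval (nodeOffset h j) =
      ∑ j, meth.b h j * q.derivative.eval (nodeOffset h j)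

section Grid

variable {K M : ℕ}

/-- Index in the grid of node `j` of window `k`. -/
def winNode (k : Fin (K - M)) (j : Fin (M + 1)) : Fin K :=
  ⟨k.1 + j.1, by have := k.2; have := j.2; omega⟩

/-- The step sizes inside window `k`. -/
def winSteps (t : Fin K → ℝ) (k : Fin (K - M)) (i : Fin M) : ℝ :=
  t (winNode k i.succ) - t (winNode k i.castSucc)

/-- `h_k = t_{k+1} - t_k`. -/
def step [NeZero M] (t : Fin K → ℝ) (k : Fin (K - M)) : ℝ := winSteps t k (0 : Fin M)

/-- Grids of non-negative, strictly increasing times with steps at most `hmax` and ratios of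
consecutive steps in `[1/ω, ω]`. -/
structure AdmissibleGrid (hmax ω : ℝ) (t : Fin K → ℝ) : Prop where
  nonneg : ∀ i, 0 ≤ t i
  step_pos : ∀ i j : Fin K, i.1 + 1 = j.1 → t i < t j
  step_le : ∀ i j : Fin K, i.1 + 1 = j.1 → t j - t i ≤ hmax
  ratio : ∀ i j l : Fin K, i.1 + 1 = j.1 → j.1 + 1 = l.1 →
    t l - t j ≤ ω * (t j - t i) ∧ t j - t i ≤ ω * (t l - t j)

/-- The coefficient matrix `A ∈ ℝ^{(K-M)×K}`. -/
def matA (meth : VLMM M) (t : Fin K → ℝ) : Matrix (Fin (K - M)) (Fin K) ℝ :=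
  Matrix.of fun k i => ∑ j, if winNode k j = i then meth.a (winSteps t k) j else 0

/-- The coefficient matrix `B ∈ ℝ^{(K-M)×K}`. -/
def matB (meth : VLMM M) (t : Fin K → ℝ) : Matrix (Fin (K - M)) (Fin K) ℝ :=
  Matrix.of fun k i => ∑ j, if winNode k j = i then meth.b (winSteps t k) j else 0

variable {n m : ℕ}

/-- `A_I = A ⊗ I_n`. -/
def matAI (n : ℕ) (meth : VLMM M) (t : Fin K → ℝ) :
    Matrix (Fin (K - M) × Fin n) (Fin K × Fin n) ℝ :=
  matA meth t ⊗ₖ (1 : Matrix (Fin n) (Fin n) ℝ)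

/-- `B_I = B ⊗ I_n`. -/
def matBI (n : ℕ) (meth : VLMM M) (t : Fin K → ℝ) :
    Matrix (Fin (K - M) × Fin n) (Fin K × Fin n) ℝ :=
  matB meth t ⊗ₖ (1 : Matrix (Fin n) (Fin n) ℝ)

/-! ### The estimator -/

/-- The labels `Y - B_I G(X)U` with `Y = A_I X̃`, `X̃ = X + ε`: `t` are the sampling times and
`ε` the measurement errors of the states. -/
def labels (S : PortHamiltonian n m) (meth : VLMM M) (u : ℝ → Fin m → ℝ) (x : ℝ → State n)
    (t : Fin K → ℝ) (ε : Fin K × Fin n → ℝ) : Fin (K - M) × Fin n → ℝ :=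
  matAI n meth t *ᵥ (fun q => x (t q.1) q.2 + ε q)
    - matBI n meth t *ᵥ (fun q => S.port (x (t q.1)) (u (t q.1)) q.2)

/-- `K_Y = B_I K_phs B_Iᵀ`. -/
def gramY (kphs : State n → State n → Matrix (Fin n) (Fin n) ℝ) (meth : VLMM M)
    (x : ℝ → State n) (t : Fin K → ℝ) :
    Matrix (Fin (K - M) × Fin n) (Fin (K - M) × Fin n) ℝ :=
  matBI n meth t *
    (Matrix.of fun q r : Fin K × Fin n => kphs (x (t q.1)) (x (t r.1)) q.2 r.2) *
    (matBI n meth t)ᵀ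

/-- `k_Y(z) = B_I k_phs(X, z)`. -/
def crossY (kphs : State n → State n → Matrix (Fin n) (Fin n) ℝ) (meth : VLMM M)
    (x : ℝ → State n) (t : Fin K → ℝ) (z : State n) :
    Matrix (Fin (K - M) × Fin n) (Fin n) ℝ :=
  matBI n meth t * (Matrix.of fun (q : Fin K × Fin n) (c : Fin n) => kphs (x (t q.1)) z q.2 c)

/-- The Tikhonov-regularized (Gaussian process posterior mean) vector field
`f̂(z) = k_Y(z)ᵀ (K_Y + ℓ reg I)⁻¹ (Y - B_I G(X)U)`, where `ℓ = K - M` and `reg > 0` is the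
regularization parameter. -/
def estimator (S : PortHamiltonian n m)
    (kphs : State n → State n → Matrix (Fin n) (Fin n) ℝ) (meth : VLMM M)
    (u : ℝ → Fin m → ℝ) (x : ℝ → State n) (reg : ℝ)
    (t : Fin K → ℝ) (ε : Fin K × Fin n → ℝ) (z : State n) : State n :=
  WithLp.toLp 2 ((crossY kphs meth x t z)ᵀ *ᵥ
    ((gramY kphs meth x t + (((K - M : ℕ) : ℝ) * reg) • 1)⁻¹ *ᵥ labels S meth u x t ε))

end Grid

/-! ### Norms, observability constant and mean step size -/

/-- `‖v‖²_𝓥`, where `𝓥 = L²(ν; ℝⁿ)`. -/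
def vNormSq {n : ℕ} (ν : Measure (State n)) (v : State n → State n) : ℝ :=
  ∫ z, ‖v z‖ ^ 2 ∂ν

section Random

variable {n m K M : ℕ} {Ω : Type*} [MeasurableSpace Ω]

/-- `‖B v‖²_𝓦`: the expected mean over the `K - M` windows of the squared norm of the multistep
combination of the values of `v` along the sampled trajectory. -/
def wNormSq (P : Measure Ω) (meth : VLMM M) (x : ℝ → State n) (t : Fin K → Ω → ℝ)
    (v : State n → State n) : ℝ :=
  (∑ k : Fin (K - M), ∫ w, ‖∑ i, matB meth (fun i => t i w) k i • v (x (t i w))‖ ^ 2 ∂P) /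
    ((K - M : ℕ) : ℝ)

/-- The observability constant `c_obs(h)` of the discretization: the largest `c` with
`c ‖v‖_𝓥 ≤ ‖B v‖_𝓦` for all fields `v = J_R ∇g`, `g` in the base RKHS `𝓗`.
(If every `c` has this property, the value is `0`.) -/
def obsConst (𝓗 : Type*) [NormedAddCommGroup 𝓗] [InnerProductSpace ℝ 𝓗]
    [RKHS ℝ 𝓗 (State n) ℝ] (S : PortHamiltonian n m) (P : Measure Ω) (meth : VLMM M)
    (x : ℝ → State n) (t : Fin K → Ω → ℝ) (ν : Measure (State n)) : ℝ :=
  sSup {c : ℝ | 0 ≤ c ∧ ∀ g : 𝓗,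
    c ^ 2 * vNormSq ν (S.field (g : State n → ℝ)) ≤
      wNormSq P meth x t (S.field (g : State n → ℝ))}

/-- `𝔼[h^q]`, the expectation being over the random grid and a uniformly chosen window. -/
def meanStepPow [NeZero M] (P : Measure Ω) (t : Fin K → Ω → ℝ) (q : ℕ) : ℝ :=
  (∑ k : Fin (K - M), ∫ w, step (fun i => t i w) k ^ q ∂P) / ((K - M : ℕ) : ℝ)

/-- The random data: sampling times forming almost surely an admissible grid, and measurement errors
`N(0, σx²)`. All times and all coordinates of all errors are independent. -/
structure IsSample (P : Measure Ω) (hmax ω : ℝ) (σx2 : ℝ≥0)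
    (t : Fin K → Ω → ℝ) (ε : Fin K × Fin n → Ω → ℝ) : Prop where
  measurable_t : ∀ i, Measurable (t i)
  admissible : ∀ᵐ w ∂P, AdmissibleGrid hmax ω (fun i => t i w)
  gaussian : ∀ q, HasLaw (ε q) (gaussianReal 0 σx2) P
  indep : iIndepFun (Sum.elim t ε) P

end Random

end MSPHS

end

/-!
Write the base kernel as `k(z, z') = ⟨Φ z, Φ z'⟩`. The estimator is then `J_R ∇g` for the solution
`g ∈ 𝓗` of a ridge regression problem whose design vectors are the representers of the observed
combinations `B_I (J_R ∇g)(X)`, so that its error is `J_R ∇d`, where `d = g - H` is the error in the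
energy. The energy identity of the regularized normal equations bounds the empirical norm of
`J_R ∇d` together with `λ ‖d‖ ^ 2` by

* the squared truncation error, which is `O(h ^ (2 * p + 2))` because the method is exact up to
  degree `p`,
* the squared norm, divided by `λ`, of the average over the windows of a noise-weighted sum of
  representers, which is a Gaussian element of `𝓗` of size `O(ℓ ^ (-1/2))`, and
* the regularization `λ ‖H‖ ^ 2`.

The empirical norm is replaced by its mean by viewing `⟨v, d⟩ ^ 2` as a linear functional of
`v ⊗ v`: the averages of these tensors concentrate in Hilbert norm at rate `O(ℓ ^ (-1/2))`, since
the windows split into `M + 1` families of disjoint, hence independent, ones. As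
`‖d‖ ^ 2 = O(λ⁻¹)`, this costs `O(ℓ ^ (-1/2) λ⁻¹)`, which for `λ = λ₀ ℓ ^ (-1/5)` is of lower order
than the regularization term. Finally `c_obs` turns the sampling norm into the norm of `L²(ν)`. When
`c* = 0`, the bound on `‖d‖ ^ 2` alone suffices, as `c_obs` may then be any positive constant that
does not depend on `η`.
-/

noncomputable section

namespace MSPHS

open Filter Asymptotics
open scoped Topology

/-! ### Differentiability of feature maps -/

section FeatureMap

variable {E F : Type*} [NormedAddCommGroup E] [NormedSpace ℝ E]
  [NormedAddCommGroup F] [InnerProductSpace ℝ F]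

/-- The partial derivative in the second variable of a function of two variables. -/
def partialSnd (k : E × E → ℝ) (p : E × E) : E →L[ℝ] ℝ :=
  (fderiv ℝ k p).comp (ContinuousLinearMap.inr ℝ E E)

/-- The mixed second derivative of a function of two variables, as a bilinear form: its first
argument is the increment of the first variable. -/
def mixedPartial (k : E × E → ℝ) (p : E × E) : E →L[ℝ] E →L[ℝ] ℝ :=
  (fderiv ℝ (partialSnd k) p).comp (ContinuousLinearMap.inl ℝ E E)

lemma contDiff_partialSnd {k : E × E → ℝ} (hk : ContDiff ℝ 2 k) :
    ContDiff ℝ 1 (partialSnd k) :=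
  (hk.fderiv_right (m := 1) (by norm_num)).clm_comp contDiff_const

lemma hasFDerivAt_snd {k : E × E → ℝ} (hk : ContDiff ℝ 2 k) (x y : E) :
    HasFDerivAt (fun y' => k (x, y')) (partialSnd k (x, y)) y :=
  ((hk.differentiable (by norm_num) (x, y)).hasFDerivAt).comp y (hasFDerivAt_prodMk_right x y)

lemma hasFDerivAt_partialSnd {k : E × E → ℝ} (hk : ContDiff ℝ 2 k) (x y : E) :
    HasFDerivAt (fun x' => partialSnd k (x', y)) (mixedPartial k (x, y)) x :=
  HasFDerivAt.comp (f := fun e : E => (e, y)) x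
    ((contDiff_partialSnd hk).differentiable (by norm_num) (x, y)).hasFDerivAt
    (hasFDerivAt_prodMk_left (𝕜 := ℝ) x y)

lemma continuous_mixedPartial {k : E × E → ℝ} (hk : ContDiff ℝ 2 k) :
    Continuous (mixedPartial k) :=
  ((contDiff_partialSnd hk).continuous_fderiv (by norm_num)).clm_comp continuous_const

theorem isLittleO_second_difference {k : E × E → ℝ} (hk : ContDiff ℝ 2 k) (z : E) :
    (fun p : E × E => k (z + p.1, z + p.2) - k (z, z + p.2) - (k (z + p.1, z) - k (z, z))
        - mixedPartial k (z, z) p.1 p.2) =o[𝓝 0] fun p => ‖p.1‖ * ‖p.2‖ := by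
  rw [isLittleO_iff]
  intro ε hε
  obtain ⟨δ, hδ, hball⟩ := (Metric.continuousAt_iff (f := mixedPartial k) (a := (z, z))).1
    (continuous_mixedPartial hk).continuousAt ε hε
  filter_upwards [Metric.ball_mem_nhds (0 : E × E) hδ] with ⟨h, h'⟩ hp
  obtain ⟨hh, hh'⟩ : ‖h‖ < δ ∧ ‖h'‖ < δ := by simpa [Prod.norm_def] using hp
  have hz : z ∈ Metric.ball z δ := Metric.mem_ball_self hδ
  have fst_increment : ∀ y ∈ Metric.ball z δ,
      ‖partialSnd k (z + h, y) - partialSnd k (z, y) - mixedPartial k (z, z) h‖ ≤ ε * ‖h‖ := by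
    intro y hy
    have := (convex_ball z δ).norm_image_sub_le_of_norm_hasFDerivWithin_le'
      (φ := mixedPartial k (z, z))
      (fun x' _ => (hasFDerivAt_partialSnd hk x' y).hasFDerivWithinAt)
      (fun x' hx' => (dist_eq_norm _ _).symm.trans_le
        (hball (x := (x', y)) (max_lt hx' hy)).le)
      hz <| add_mem_ball_iff_norm.2 hh
    simpa only [add_sub_cancel_left] using this
  have := (convex_ball z δ).norm_image_sub_le_of_norm_hasFDerivWithin_le'
    (f := fun y => k (z + h, y) - k (z, y)) (φ := mixedPartial k (z, z) h)
    (fun y _ => ((hasFDerivAt_snd hk _ y).sub (hasFDerivAt_snd hk _ y)).hasFDerivWithinAt)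
    fst_increment hz <| add_mem_ball_iff_norm.2 hh'
  simpa only [add_sub_cancel_left, norm_mul, norm_norm, mul_assoc] using this

/-- The map `f` behaves near `0` like a linear isometry into `F` for the bilinear form `m`: inner
products of its values are given by `m` up to a relative error. -/
def HasInnerGerm (f : E → F) (m : E →L[ℝ] E →L[ℝ] ℝ) : Prop :=
  (fun p : E × E => inner ℝ (f p.1) (f p.2) - m p.1 p.2) =o[𝓝 0] fun p => ‖p.1‖ * ‖p.2‖

lemma exists_tendsto_of_tendsto_inner [CompleteSpace F] {ι : Type*} {l : Filter ι} [l.NeBot]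
    {q : ι → F} {c : ℝ}
    (h : Tendsto (fun p : ι × ι => inner ℝ (q p.1) (q p.2)) (l ×ˢ l) (𝓝 c)) :
    ∃ d, Tendsto q l (𝓝 d) := by
  refine cauchy_map_iff_exists_tendsto.1 (cauchy_map_iff.2 ⟨inferInstance, ?_⟩)
  have hfst := h.comp (tendsto_fst.prodMk (tendsto_fst (f := l) (g := l)))
  have hsnd := h.comp (tendsto_snd.prodMk (tendsto_snd (f := l) (g := l)))
  have hsq : Tendsto (fun p : ι × ι => ‖q p.1 - q p.2‖ ^ 2) (l ×ˢ l) (𝓝 0) := by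
    convert (hfst.sub (h.const_mul 2)).add hsnd using 2 with p
    · simp only [norm_sub_sq_real, Function.comp_apply, real_inner_self_eq_norm_sq]
    · ring
  rw [tendsto_uniformity_iff_dist_tendsto_zero]
  simpa only [dist_eq_norm, Real.sqrt_sq (norm_nonneg _), Real.sqrt_zero] using hsq.sqrt

lemma norm_le_sqrt_opNorm_mul_norm {V : Type*} [SeminormedAddCommGroup V]
    {b : E →L[ℝ] E →L[ℝ] ℝ} {y : V} {v : E}
    (h : ‖y‖ ^ 2 = b v v) : ‖y‖ ≤ √‖b‖ * ‖v‖ := by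
  refine le_of_sq_le_sq ?_ (by positivity)
  calc ‖y‖ ^ 2 ≤ ‖b‖ * ‖v‖ * ‖v‖ := h.trans_le ((le_abs_self _).trans (b.le_opNorm₂ v v))
    _ = (√‖b‖ * ‖v‖) ^ 2 := by rw [mul_pow, Real.sq_sqrt (norm_nonneg b)]; ring

lemma exists_clm_of_inner_eq {m : E →L[ℝ] E →L[ℝ] ℝ} {D : E → F}
    (hD : ∀ v w, inner ℝ (D v) (D w) = m v w) : ∃ L : E →L[ℝ] F, ∀ v, L v = D v := by
  let L : E →ₗ[ℝ] F :=
    { toFun := D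
      map_add' := fun v w => by
        rw [← sub_eq_zero, ← inner_self_eq_zero (𝕜 := ℝ)]
        simp only [inner_sub_left, inner_sub_right, inner_add_left, inner_add_right, hD, map_add,
          add_apply]
        ring
      map_smul' := fun r v => by
        rw [← sub_eq_zero, ← inner_self_eq_zero (𝕜 := ℝ)]
        simp only [inner_sub_left, inner_sub_right, real_inner_smul_left, real_inner_smul_right,
          hD, map_smul, smul_apply, smul_eq_mul, RingHom.id_apply]
        ring }
  exact ⟨L.mkContinuous (√‖m‖) fun v => norm_le_sqrt_opNorm_mul_norm
    (by rw [← real_inner_self_eq_norm_sq]; exact hD v v), fun v => rfl⟩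

namespace HasInnerGerm

variable {f : E → F} {m : E →L[ℝ] E →L[ℝ] ℝ}

lemma tendsto_inner_slope (hf : HasInnerGerm f m) (v w : E) :
    Tendsto (fun p : ℝ × ℝ => inner ℝ (p.1⁻¹ • f (p.1 • v)) (p.2⁻¹ • f (p.2 • w)))
      (𝓝[≠] 0 ×ˢ 𝓝[≠] 0) (𝓝 (m v w)) := by
  have hscale : Tendsto (fun p : ℝ × ℝ => (p.1 • v, p.2 • w)) (𝓝[≠] 0 ×ˢ 𝓝[≠] 0) (𝓝 0) := by
    have hc : Continuous fun p : ℝ × ℝ => (p.1 • v, p.2 • w) := by fun_prop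
    refine (hc.tendsto' 0 0 (by simp)).mono_left ?_
    rw [Prod.zero_eq_mk, nhds_prod_eq]
    exact prod_mono nhdsWithin_le_nhds nhdsWithin_le_nhds
  have hsmall : (fun p : ℝ × ℝ => inner ℝ (f (p.1 • v)) (f (p.2 • w)) - p.1 * p.2 * m v w)
      =o[𝓝[≠] 0 ×ˢ 𝓝[≠] 0] fun p => p.1 * p.2 := by
    refine ((hf.comp_tendsto hscale).congr_left fun p => ?_).trans_isBigO
      (isBigO_of_le' (c := ‖v‖ * ‖w‖) _ fun p => le_of_eq ?_)
    · simp only [Function.comp_apply, map_smul, smul_apply, smul_eq_mul]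
      ring
    · simp only [Function.comp_apply, norm_smul, norm_mul, norm_norm]
      ring
  have hne : ∀ᶠ p : ℝ × ℝ in 𝓝[≠] 0 ×ˢ 𝓝[≠] 0, p.1 ≠ 0 ∧ p.2 ≠ 0 :=
    prod_mem_prod self_mem_nhdsWithin self_mem_nhdsWithin
  refine ((tendsto_add_const_iff (m v w)).2 hsmall.tendsto_div_nhds_zero).congr' ?_ |>.trans
    (by rw [zero_add])
  filter_upwards [hne] with p ⟨h₁, h₂⟩
  rw [real_inner_smul_left, real_inner_smul_right]
  field_simp
  ring

lemma abs_inner_slope_sub_le {ε : ℝ} {h : E} {t : ℝ} (ht : 0 < t)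
    (hε : ‖inner ℝ (f h) (f (t • h)) - m h (t • h)‖ ≤ ε * ‖‖h‖ * ‖t • h‖‖) :
    |inner ℝ (f h) (t⁻¹ • f (t • h)) - m h h| ≤ ε * ‖h‖ ^ 2 := by
  have hrw : inner ℝ (f h) (t⁻¹ • f (t • h)) - m h h
      = t⁻¹ * (inner ℝ (f h) (f (t • h)) - m h (t • h)) := by
    rw [real_inner_smul_right, map_smul, smul_eq_mul]
    field_simp
  rw [hrw, abs_mul, abs_of_pos (inv_pos.2 ht), inv_mul_le_iff₀ ht]
  refine hε.trans_eq ?_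
  rw [norm_mul, norm_norm, norm_norm, norm_smul, Real.norm_of_nonneg ht.le]
  ring

lemma isLittleO_inner_sub (hf : HasInnerGerm f m) {D : E → F}
    (hD : ∀ v, Tendsto (fun t : ℝ => t⁻¹ • f (t • v)) (𝓝[≠] 0) (𝓝 (D v))) :
    (fun h => inner ℝ (f h) (D h) - m h h) =o[𝓝 0] fun h => ‖h‖ ^ 2 := by
  rw [isLittleO_iff]
  intro ε hε
  obtain ⟨δ, hδ, hball⟩ := Metric.eventually_nhds_iff_ball.1 (isLittleO_iff.1 hf hε)
  filter_upwards [Metric.ball_mem_nhds (0 : E) hδ] with h hh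
  rw [mem_ball_zero_iff] at hh
  rw [Real.norm_of_nonneg (sq_nonneg ‖h‖)]
  have hlim : Tendsto (fun t : ℝ => |inner ℝ (f h) (t⁻¹ • f (t • h)) - m h h|) (𝓝[>] 0)
      (𝓝 |inner ℝ (f h) (D h) - m h h|) :=
    ((tendsto_const_nhds.inner
      ((hD h).mono_left (nhdsWithin_mono 0 fun _ => ne_of_gt))).sub_const _).abs
  refine le_of_tendsto hlim ?_
  filter_upwards [Ioo_mem_nhdsGT one_pos] with t ht
  refine abs_inner_slope_sub_le ht.1 (hball (h, t • h) ?_)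
  have hth : ‖t • h‖ ≤ ‖h‖ := by
    rw [norm_smul, Real.norm_of_nonneg ht.1.le]
    exact mul_le_of_le_one_left (norm_nonneg h) ht.2.le
  exact mem_ball_zero_iff.2 (max_lt hh (hth.trans_lt hh))

theorem exists_isLittleO_sub_clm [CompleteSpace F] (hf : HasInnerGerm f m) :
    ∃ L : E →L[ℝ] F, (fun h => f h - L h) =o[𝓝 0] fun h => h := by
  choose D hD using fun v => exists_tendsto_of_tendsto_inner
    (q := fun t : ℝ => t⁻¹ • f (t • v)) (l := 𝓝[≠] 0) (hf.tendsto_inner_slope v v)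
  have hinner : ∀ v w, inner ℝ (D v) (D w) = m v w := fun v w =>
    tendsto_nhds_unique (((hD v).comp tendsto_fst).inner ((hD w).comp tendsto_snd))
      (hf.tendsto_inner_slope v w)
  obtain ⟨L, hL⟩ := exists_clm_of_inner_eq hinner
  refine ⟨L, ?_⟩
  have hdiag : (fun h => inner ℝ (f h) (f h) - m h h) =o[𝓝 0] fun h => ‖h‖ ^ 2 := by
    simpa only [Function.comp_def, sq, id_eq] using
      hf.comp_tendsto ((continuous_id.prodMk continuous_id).tendsto' (0 : E) 0 rfl)
  have hsq : (fun h => ‖f h - L h‖ ^ 2) =o[𝓝 0] fun h => ‖h‖ ^ 2 := by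
    refine (hdiag.sub ((hf.isLittleO_inner_sub hD).const_mul_left 2)).congr_left fun h => ?_
    rw [hL, norm_sub_sq_real, ← real_inner_self_eq_norm_sq, ← real_inner_self_eq_norm_sq, hinner]
    ring
  exact isLittleO_norm_norm.1 (hsq.of_pow two_ne_zero)

end HasInnerGerm

/-- The kernel `(x, y) ↦ ⟪Φ x, Φ y⟫` of a feature map. -/
def innerKernel (Φ : E → F) (p : E × E) : ℝ := inner ℝ (Φ p.1) (Φ p.2)

lemma hasInnerGerm_of_contDiff_innerKernel {Φ : E → F} (hΦ : ContDiff ℝ 2 (innerKernel Φ))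
    (z : E) :
    HasInnerGerm (fun h => Φ (z + h) - Φ z) (mixedPartial (innerKernel Φ) (z, z)) :=
  (isLittleO_second_difference hΦ z).congr_left fun p => by
    simp only [innerKernel, inner_sub_left, inner_sub_right]

theorem differentiable_of_contDiff_innerKernel [CompleteSpace F] {Φ : E → F}
    (hΦ : ContDiff ℝ 2 (innerKernel Φ)) : Differentiable ℝ Φ := by
  intro z
  obtain ⟨L, hL⟩ := (hasInnerGerm_of_contDiff_innerKernel hΦ z).exists_isLittleO_sub_clm
  exact (hasFDerivAt_iff_isLittleO_nhds_zero.2 hL).differentiableAt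

lemma hasFDerivAt_inner_right {Φ : E → F} (a : F) {y : E} (hΦ : DifferentiableAt ℝ Φ y) :
    HasFDerivAt (fun y' => inner ℝ a (Φ y')) ((innerSL ℝ a).comp (fderiv ℝ Φ y)) y :=
  (innerSL ℝ a).hasFDerivAt.comp y hΦ.hasFDerivAt

lemma mixedPartial_innerKernel {Φ : E → F} (hk : ContDiff ℝ 2 (innerKernel Φ))
    (hΦ : Differentiable ℝ Φ) (x y v w : E) :
    mixedPartial (innerKernel Φ) (x, y) v w = inner ℝ (fderiv ℝ Φ x v) (fderiv ℝ Φ y w) := by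
  have hsnd : ∀ x', partialSnd (innerKernel Φ) (x', y) = (innerSL ℝ (Φ x')).comp (fderiv ℝ Φ y) :=
    fun x' => (hasFDerivAt_snd hk x' y).unique (hasFDerivAt_inner_right (Φ x') (hΦ y))
  have hmixed := (hasFDerivAt_partialSnd hk x y).clm_apply (hasFDerivAt_const w x)
  have hfst := (hasFDerivAt_inner_right (fderiv ℝ Φ y w) (hΦ x)).congr_of_eventuallyEq
    (f₁ := fun x' => partialSnd (innerKernel Φ) (x', y) w) (.of_forall fun x' => by
      simp only [hsnd]; exact real_inner_comm _ _)
  simpa [real_inner_comm] using DFunLike.congr_fun (hmixed.unique hfst) v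

lemma opNorm_le_sqrt_opNorm {V : Type*} [SeminormedAddCommGroup V] [NormedSpace ℝ V]
    {L : E →L[ℝ] V} {b : E →L[ℝ] E →L[ℝ] ℝ} (h : ∀ v, ‖L v‖ ^ 2 = b v v) : ‖L‖ ≤ √‖b‖ :=
  L.opNorm_le_bound (Real.sqrt_nonneg _) fun v => norm_le_sqrt_opNorm_mul_norm (h v)

lemma norm_fderiv_sub_le {Φ : E → F} (hk : ContDiff ℝ 2 (innerKernel Φ))
    (hΦ : Differentiable ℝ Φ) (y z : E) :
    ‖fderiv ℝ Φ y - fderiv ℝ Φ z‖ ≤ √‖mixedPartial (innerKernel Φ) (y, y)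
      - mixedPartial (innerKernel Φ) (y, z) - (mixedPartial (innerKernel Φ) (z, y)
      - mixedPartial (innerKernel Φ) (z, z))‖ := by
  refine opNorm_le_sqrt_opNorm fun v => ?_
  simp only [sub_apply, mixedPartial_innerKernel hk hΦ, ← real_inner_self_eq_norm_sq,
    inner_sub_left, inner_sub_right]
  ring

lemma tendsto_sqrt_norm_second_difference {X V : Type*} [TopologicalSpace X]
    [SeminormedAddCommGroup V] {m : X × X → V} (hm : Continuous m) (z : X) :
    Tendsto (fun y => √‖m (y, y) - m (y, z) - (m (z, y) - m (z, z))‖) (𝓝 z) (𝓝 0) :=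
  Continuous.tendsto' (by fun_prop) z 0 (by simp only [sub_self, norm_zero, Real.sqrt_zero])

theorem contDiff_of_contDiff_innerKernel [CompleteSpace F] {Φ : E → F}
    (hk : ContDiff ℝ 2 (innerKernel Φ)) : ContDiff ℝ 1 Φ := by
  have hΦ := differentiable_of_contDiff_innerKernel hk
  refine contDiff_one_iff_fderiv.2 ⟨hΦ, continuous_iff_continuousAt.2 fun z => ?_⟩
  have hlim := tendsto_sqrt_norm_second_difference (V := E →L[ℝ] E →L[ℝ] ℝ)
    (continuous_mixedPartial hk) z
  exact tendsto_iff_norm_sub_tendsto_zero.2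
    (squeeze_zero (fun _ => norm_nonneg _) (fun y => norm_fderiv_sub_le hk hΦ y z) hlim)

end FeatureMap

section Concentration

variable {Ω : Type*} [MeasurableSpace Ω] {P : Measure Ω} {F : Type*} [NormedAddCommGroup F]

/-- A random vector `X` is square-exponentially bounded with proxy variance `v` if adding it to any
fixed vector `y` increases the exponential moments of the squared norm at most as much as a centred
Gaussian of variance comparable to `v` would. In this form the property passes from independent
random vectors to exponential moments of the squared norm of their sum, in any dimension. -/
def HasSquareExpBound (P : Measure Ω) (v : ℝ) (X : Ω → F) : Prop :=
  ∀ r : ℝ, 2 ≤ r → ∀ y : F,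
    ∫⁻ w, ENNReal.ofReal (Real.exp (‖y + X w‖ ^ 2 / (v * r))) ∂P ≤
      ENNReal.ofReal (Real.exp (1 / r + ‖y‖ ^ 2 / (v * (r - 1))))

section Bounded

variable [InnerProductSpace ℝ F] [CompleteSpace F] [IsProbabilityMeasure P] {X : Ω → F} {b : ℝ}

lemma hasSubgaussianMGF_inner_of_norm_le (hX : AEStronglyMeasurable X P)
    (hXb : ∀ᵐ w ∂P, ‖X w‖ ≤ b) (hX0 : ∫ w, X w ∂P = 0) (y : F) :
    HasSubgaussianMGF (fun w => inner ℝ y (X w)) (‖b * ‖y‖‖₊ ^ 2) P := by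
  have hmem : ∀ᵐ w ∂P, inner ℝ y (X w) ∈ Set.Icc (-(b * ‖y‖)) (b * ‖y‖) := by
    filter_upwards [hXb] with w hw
    refine abs_le.1 ((abs_real_inner_le_norm _ _).trans ?_)
    rw [mul_comm]
    gcongr
  have hmean : ∫ w, inner ℝ y (X w) ∂P = 0 := by
    rw [integral_inner (Integrable.of_bound hX b hXb), hX0, inner_zero_right]
  convert hasSubgaussianMGF_of_mem_Icc_of_integral_eq_zero
    (hX.const_inner (c := y)).aemeasurable hmem hmean using 2
  rw [sub_neg_eq_add, ← two_mul, nnnorm_mul 2, Real.nnnorm_two,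
    mul_div_cancel_left₀ _ two_ne_zero]

lemma lintegral_exp_norm_add_sq_le_of_norm_le (hX : AEStronglyMeasurable X P)
    (hXb : ∀ᵐ w ∂P, ‖X w‖ ≤ b) (hX0 : ∫ w, X w ∂P = 0) {s : ℝ} (hs : 0 ≤ s) (y : F) :
    ∫⁻ w, ENNReal.ofReal (Real.exp (s * ‖y + X w‖ ^ 2)) ∂P ≤
      ENNReal.ofReal (Real.exp (s * b ^ 2 + s * ‖y‖ ^ 2 * (1 + 2 * s * b ^ 2))) := by
  have hsub := hasSubgaussianMGF_inner_of_norm_le hX hXb hX0 y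
  calc ∫⁻ w, ENNReal.ofReal (Real.exp (s * ‖y + X w‖ ^ 2)) ∂P
      ≤ ∫⁻ w, ENNReal.ofReal (Real.exp (s * ‖y‖ ^ 2 + s * b ^ 2)) *
          ENNReal.ofReal (Real.exp (2 * s * inner ℝ y (X w))) ∂P := by
        refine lintegral_mono_ae ?_
        filter_upwards [hXb] with w hw
        rw [← ENNReal.ofReal_mul (Real.exp_pos _).le, ← Real.exp_add, norm_add_sq_real]
        gcongr
        nlinarith [pow_le_pow_left₀ (norm_nonneg _) hw 2]
    _ = ENNReal.ofReal (Real.exp (s * ‖y‖ ^ 2 + s * b ^ 2)) *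
          ENNReal.ofReal (mgf (fun w => inner ℝ y (X w)) P (2 * s)) := by
        rw [lintegral_const_mul' _ _ ENNReal.ofReal_ne_top, mgf,
          ofReal_integral_eq_lintegral_ofReal (hsub.integrable_exp_mul _)
            (.of_forall fun _ => (Real.exp_pos _).le)]
    _ ≤ ENNReal.ofReal (Real.exp (s * ‖y‖ ^ 2 + s * b ^ 2)) *
          ENNReal.ofReal (Real.exp (b ^ 2 * ‖y‖ ^ 2 * (2 * s) ^ 2 / 2)) := by
        gcongr
        simpa [mul_pow] using hsub.mgf_le (2 * s)
    _ = _ := by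
        rw [← ENNReal.ofReal_mul (Real.exp_pos _).le, ← Real.exp_add]
        ring_nf

lemma hasSquareExpBound_of_norm_le (hX : AEStronglyMeasurable X P) (hb : 0 < b)
    (hXb : ∀ᵐ w ∂P, ‖X w‖ ≤ b) (hX0 : ∫ w, X w ∂P = 0) :
    HasSquareExpBound P (2 * b ^ 2) X := by
  intro r hr y
  have hr1 : 0 < r - 1 := by linarith
  have hexp := lintegral_exp_norm_add_sq_le_of_norm_le hX hXb hX0
    (s := (2 * b ^ 2 * r)⁻¹) (by positivity) y
  simp only [inv_mul_eq_div] at hexp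
  refine hexp.trans (ENNReal.ofReal_le_ofReal (Real.exp_le_exp.2 (add_le_add ?_ ?_)))
  · rw [div_le_div_iff₀ (by positivity) (by positivity)]
    nlinarith [mul_pos (pow_pos hb 2) (show 0 < r by linarith)]
  · have hfactor : 1 + 2 * (2 * b ^ 2 * r)⁻¹ * b ^ 2 ≤ r / (r - 1) := by
      rw [show 1 + 2 * (2 * b ^ 2 * r)⁻¹ * b ^ 2 = (r + 1) / r by field_simp,
        div_le_div_iff₀ (by positivity) hr1]
      nlinarith
    calc ‖y‖ ^ 2 / (2 * b ^ 2 * r) * (1 + 2 * (2 * b ^ 2 * r)⁻¹ * b ^ 2)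
        ≤ ‖y‖ ^ 2 / (2 * b ^ 2 * r) * (r / (r - 1)) := by gcongr
      _ = ‖y‖ ^ 2 / (2 * b ^ 2 * (r - 1)) := by field_simp

lemma hasSquareExpBound_sub_integral (hX : AEStronglyMeasurable X P) (hb : 0 < b)
    (hXb : ∀ᵐ w ∂P, ‖X w‖ ≤ b) :
    HasSquareExpBound P (8 * b ^ 2) (fun w => X w - ∫ w', X w' ∂P) := by
  have hmean : ‖∫ w', X w' ∂P‖ ≤ b := by
    simpa using norm_integral_le_of_norm_le_const hXb
  rw [show 8 * b ^ 2 = 2 * (2 * b) ^ 2 by ring]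
  refine hasSquareExpBound_of_norm_le (hX.sub aestronglyMeasurable_const) (by positivity) ?_ ?_
  · filter_upwards [hXb] with w hw
    exact (norm_sub_le _ _).trans (by linarith)
  · rw [integral_sub (Integrable.of_bound hX b hXb) (integrable_const _)]
    simp

end Bounded

section Gaussian

variable {σ2 : ℝ≥0} {a c : ℝ}

lemma gaussianPDFReal_mul_exp_quadratic (hσ : σ2 ≠ 0) {q : ℝ≥0} (hq : (q : ℝ) = 1 - 2 * c * σ2)
    (hq0 : q ≠ 0) (x : ℝ) :
    gaussianPDFReal 0 σ2 x * Real.exp (a * x + c * x ^ 2) =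
      ((Real.sqrt q)⁻¹ * Real.exp (a ^ 2 * σ2 / (2 * q))) *
        gaussianPDFReal (a * σ2 / q) (σ2 / q) x := by
  have : (0 : ℝ) < σ2 := NNReal.coe_pos.2 (pos_iff_ne_zero.2 hσ)
  have hqpos : (0 : ℝ) < q := NNReal.coe_pos.2 (pos_iff_ne_zero.2 hq0)
  have hsqrt : Real.sqrt (2 * Real.pi * (σ2 / q)) =
      Real.sqrt (2 * Real.pi * σ2) / Real.sqrt q := by
    rw [← Real.sqrt_div (by positivity), mul_div_assoc]
  have hexponent : -(x - 0) ^ 2 / (2 * (σ2 : ℝ)) + (a * x + c * x ^ 2) =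
      a ^ 2 * σ2 / (2 * q) + -(x - a * σ2 / q) ^ 2 / (2 * (σ2 / q)) := by
    rw [show c = (1 - q) / (2 * σ2) by rw [hq]; field_simp; ring]
    field_simp
    ring
  have hq' : Real.sqrt q ≠ 0 := (Real.sqrt_pos.2 hqpos).ne'
  rw [gaussianPDFReal, gaussianPDFReal, NNReal.coe_div, hsqrt, mul_assoc, ← Real.exp_add,
    hexponent, Real.exp_add]
  field_simp

lemma lintegral_gaussian_exp_quadratic (hc : 2 * c * σ2 < 1) :
    ∫⁻ e, ENNReal.ofReal (Real.exp (a * e + c * e ^ 2)) ∂(gaussianReal 0 σ2) =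
      ENNReal.ofReal ((Real.sqrt (1 - 2 * c * σ2))⁻¹ *
        Real.exp (a ^ 2 * σ2 / (2 * (1 - 2 * c * σ2)))) := by
  rcases eq_or_ne σ2 0 with rfl | hσ
  · simp
  lift 1 - 2 * c * σ2 to ℝ≥0 using by linarith with q hq
  have hq0 : q ≠ 0 := by
    rw [← NNReal.coe_ne_zero, hq]
    linarith
  rw [gaussianReal_of_var_ne_zero _ hσ, lintegral_withDensity_eq_lintegral_mul _
    (measurable_gaussianPDF _ _) (by fun_prop)]
  simp only [Pi.mul_apply, gaussianPDF, ← ENNReal.ofReal_mul (gaussianPDFReal_nonneg _ _ _),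
    gaussianPDFReal_mul_exp_quadratic hσ hq hq0]
  simp only [ENNReal.ofReal_mul
    (show 0 ≤ (Real.sqrt q)⁻¹ * Real.exp (a ^ 2 * σ2 / (2 * q)) by positivity)]
  rw [lintegral_const_mul _ (by fun_prop), lintegral_gaussianPDFReal_eq_one _ (by positivity),
    mul_one]

lemma inv_sqrt_one_sub_le_exp {x : ℝ} (h0 : 0 ≤ x) (h : x ≤ 1 / 2) :
    (Real.sqrt (1 - x))⁻¹ ≤ Real.exp x := by
  have hpos : 0 < 1 - x := by linarith
  rw [← Real.sqrt_inv]
  refine Real.sqrt_le_iff.2 ⟨(Real.exp_pos x).le, ?_⟩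
  rw [← Real.exp_nat_mul, inv_le_iff_one_le_mul₀ hpos]
  calc 1 ≤ (↑2 * x + 1) * (1 - x) := by nlinarith
    _ ≤ Real.exp (↑2 * x) * (1 - x) := by gcongr; exact Real.add_one_le_exp _

variable [InnerProductSpace ℝ F]

lemma lintegral_gaussian_exp_norm_add_smul_sq_le {s : ℝ} (hs : 0 ≤ s) {u : F}
    (hsu : 2 * (s * ‖u‖ ^ 2) * σ2 ≤ 1 / 2) (y : F) :
    ∫⁻ e, ENNReal.ofReal (Real.exp (s * ‖y + e • u‖ ^ 2)) ∂(gaussianReal 0 σ2) ≤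
      ENNReal.ofReal (Real.exp (2 * (s * ‖u‖ ^ 2) * σ2 +
        s * ‖y‖ ^ 2 / (1 - 2 * (s * ‖u‖ ^ 2) * σ2))) := by
  have hx0 : 0 ≤ 2 * (s * ‖u‖ ^ 2) * σ2 := by positivity
  have hexpand (e : ℝ) : s * ‖y + e • u‖ ^ 2 =
      s * ‖y‖ ^ 2 + (2 * s * inner ℝ y u * e + s * ‖u‖ ^ 2 * e ^ 2) := by
    rw [norm_add_sq_real, inner_smul_right, norm_smul, mul_pow, Real.norm_eq_abs, sq_abs]
    ring
  have hinner : (2 * s * inner ℝ y u) ^ 2 * σ2 / 2 ≤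
      s * ‖y‖ ^ 2 * (2 * (s * ‖u‖ ^ 2) * σ2) := by
    have hCS : inner ℝ y u ^ 2 ≤ (‖y‖ * ‖u‖) ^ 2 :=
      sq_le_sq' (neg_le_of_abs_le (abs_real_inner_le_norm y u)) (real_inner_le_norm y u)
    nlinarith [mul_le_mul_of_nonneg_left hCS (show 0 ≤ 2 * s ^ 2 * (σ2 : ℝ) by positivity)]
  simp only [hexpand, Real.exp_add, ENNReal.ofReal_mul (Real.exp_pos (s * ‖y‖ ^ 2)).le]
  simp only [← Real.exp_add]
  rw [lintegral_const_mul' _ _ ENNReal.ofReal_ne_top,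
    lintegral_gaussian_exp_quadratic (by linarith), ← ENNReal.ofReal_mul (Real.exp_pos _).le]
  generalize 2 * (s * ‖u‖ ^ 2) * (σ2 : ℝ) = x at hsu hx0 hinner ⊢
  have hpos : 0 < 1 - x := by linarith
  gcongr
  calc Real.exp (s * ‖y‖ ^ 2) * ((Real.sqrt (1 - x))⁻¹ *
        Real.exp ((2 * s * inner ℝ y u) ^ 2 * σ2 / (2 * (1 - x))))
      ≤ Real.exp (s * ‖y‖ ^ 2) * (Real.exp x * Real.exp (s * ‖y‖ ^ 2 * x / (1 - x))) := by
        rw [← div_div]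
        gcongr
        exact inv_sqrt_one_sub_le_exp hx0 hsu
    _ = Real.exp (x + s * ‖y‖ ^ 2 / (1 - x)) := by
        rw [← Real.exp_add, ← Real.exp_add]
        congr 1
        field_simp
        ring

lemma hasSquareExpBound_gaussian_smul {e : Ω → ℝ} (he : HasLaw e (gaussianReal 0 σ2) P) {u : F}
    {v : ℝ} (hv : 0 < v) (huv : 2 * σ2 * ‖u‖ ^ 2 ≤ v) :
    HasSquareExpBound P v (fun w => e w • u) := by
  intro r hr y
  have hx : 2 * ((v * r)⁻¹ * ‖u‖ ^ 2) * σ2 ≤ 1 / r := by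
    rw [show 2 * ((v * r)⁻¹ * ‖u‖ ^ 2) * (σ2 : ℝ) = (2 * σ2 * ‖u‖ ^ 2) / v * (1 / r) by field_simp]
    exact mul_le_of_le_one_left (by positivity) ((div_le_one hv).2 huv)
  have hr2 : 1 / r ≤ 1 / 2 := one_div_le_one_div_of_le two_pos hr
  have hgauss := lintegral_gaussian_exp_norm_add_smul_sq_le (by positivity) (hx.trans hr2) y
  rw [he.lintegral_comp (f := fun x => ENNReal.ofReal (Real.exp (‖y + x • u‖ ^ 2 / (v * r))))
    (ENNReal.continuous_ofReal.comp (by fun_prop)).measurable.aemeasurable]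
  simp only [inv_mul_eq_div (v * r)] at hgauss hx
  have hpos : 0 < 1 - 1 / r := by linarith
  have hr1 : 0 < r - 1 := by linarith
  refine hgauss.trans (ENNReal.ofReal_le_ofReal (Real.exp_le_exp.2 (add_le_add hx ?_)))
  calc ‖y‖ ^ 2 / (v * r) / (1 - 2 * (‖u‖ ^ 2 / (v * r)) * σ2)
      ≤ ‖y‖ ^ 2 / (v * r) / (1 - 1 / r) := by gcongr
    _ = ‖y‖ ^ 2 / (v * (r - 1)) := by rw [div_div]; congr 1; field_simp

end Gaussian

lemma lintegral_exp_norm_add_sq_le [IsProbabilityMeasure P] {α β : Type*} [MeasurableSpace α]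
    [MeasurableSpace β] {T : Ω → α} {U : Ω → β} (hT : AEMeasurable T P) (hU : AEMeasurable U P)
    (hTU : IndepFun T U P) {S : α → F} (hS : StronglyMeasurable S) {X : β → F}
    (hX : StronglyMeasurable X) {v r : ℝ} (hXv : HasSquareExpBound P v (fun w => X (U w)))
    (hr : 2 ≤ r) :
    ∫⁻ w, ENNReal.ofReal (Real.exp (‖S (T w) + X (U w)‖ ^ 2 / (v * r))) ∂P ≤
      ENNReal.ofReal (Real.exp (1 / r)) *
        ∫⁻ w, ENNReal.ofReal (Real.exp (‖S (T w)‖ ^ 2 / (v * (r - 1)))) ∂P := by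
  let G : α × β → ℝ≥0∞ := fun p => ENNReal.ofReal (Real.exp (‖S p.1 + X p.2‖ ^ 2 / (v * r)))
  have hG : Measurable G := by
    have := ((hS.comp_measurable measurable_fst).add
      (hX.comp_measurable measurable_snd) : StronglyMeasurable fun p : α × β => S p.1 + X p.2)
    have := this.norm.measurable
    fun_prop
  have hS' : Measurable fun a => ENNReal.ofReal (Real.exp (‖S a‖ ^ 2 / (v * (r - 1)))) := by
    have := hS.norm.measurable
    fun_prop
  have : IsProbabilityMeasure (P.map U) := Measure.isProbabilityMeasure_map hU
  calc ∫⁻ w, G (T w, U w) ∂P = ∫⁻ p, G p ∂(P.map fun w => (T w, U w)) :=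
        (lintegral_map' hG.aemeasurable (hT.prodMk hU)).symm
    _ = ∫⁻ a, ∫⁻ b, G (a, b) ∂(P.map U) ∂(P.map T) := by
        rw [(indepFun_iff_map_prod_eq_prod_map_map hT hU).1 hTU, lintegral_prod _ hG.aemeasurable]
    _ ≤ ∫⁻ a, ENNReal.ofReal (Real.exp (1 / r)) *
          ENNReal.ofReal (Real.exp (‖S a‖ ^ 2 / (v * (r - 1)))) ∂(P.map T) := by
        refine lintegral_mono fun a => ?_
        rw [lintegral_map' (by fun_prop) hU, ← ENNReal.ofReal_mul (Real.exp_pos _).le,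
          ← Real.exp_add]
        exact hXv r hr (S a)
    _ = _ := by
        rw [lintegral_const_mul' _ _ ENNReal.ofReal_ne_top, lintegral_map' hS'.aemeasurable hT]

section IndependentSum

variable [IsProbabilityMeasure P] {ι : Type*} {β : ι → Type*} [∀ i, MeasurableSpace (β i)]
  {Z : (i : ι) → Ω → β i} {f : (i : ι) → β i → F} {v N : ℝ} {I : Finset ι}

lemma lintegral_exp_norm_sum_sq_le_of_card (hZm : ∀ i, AEMeasurable (Z i) P) (hZ : iIndepFun Z P)
    (hf : ∀ i, StronglyMeasurable (f i)) (hN : 1 ≤ N)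
    (hv : ∀ i ∈ I, HasSquareExpBound P v (fun w => f i (Z i w))) :
    ∫⁻ w, ENNReal.ofReal (Real.exp (‖∑ i ∈ I, f i (Z i w)‖ ^ 2 / (v * (N + I.card)))) ∂P ≤
      ENNReal.ofReal (Real.exp (I.card / N)) := by
  classical
  induction I using Finset.induction_on with
  | empty => simp
  | insert i I hi ih =>
    have ih := ih fun j hj => hv j (Finset.mem_insert_of_mem hj)
    let S : ((j : I) → β j) → F := fun y => ∑ j : I, f j (y j)
    have hS : StronglyMeasurable S := Finset.stronglyMeasurable_fun_sum _ fun j _ =>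
      (hf j).comp_measurable (measurable_pi_apply j)
    have hSeq (w : Ω) : S (fun j => Z j w) = ∑ j ∈ I, f j (Z j w) :=
      Finset.sum_coe_sort I fun j => f j (Z j w)
    have hindep : IndepFun (fun w (j : I) => Z j w) (Z i) P :=
      (hZ.indepFun_finset₀ I {i} (Finset.disjoint_singleton_right.2 hi) hZm).comp
        measurable_id
        (measurable_pi_apply (X := fun j : ({i} : Finset ι) => β j)
          ⟨i, Finset.mem_singleton_self i⟩)
    have hadd := lintegral_exp_norm_add_sq_le (aemeasurable_pi_lambda _ fun j : I => hZm j)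
      (hZm i) hindep hS (hf i) (hv i (Finset.mem_insert_self _ _)) (r := N + (I.card + 1))
      (by linarith [Nat.cast_nonneg (α := ℝ) I.card])
    simp only [hSeq, show N + ((I.card : ℝ) + 1) - 1 = N + I.card by ring] at hadd
    simp only [Finset.card_insert_of_notMem hi, Nat.cast_succ, Finset.sum_insert hi,
      add_comm (f i (Z i _))]
    refine hadd.trans ((mul_le_mul_right ih _).trans ?_)
    rw [← ENNReal.ofReal_mul (Real.exp_pos _).le, ← Real.exp_add, add_div, add_comm]
    gcongr
    linarith [Nat.cast_nonneg (α := ℝ) I.card]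

lemma lintegral_exp_norm_sum_sq_le (hZm : ∀ i, AEMeasurable (Z i) P) (hZ : iIndepFun Z P)
    (hf : ∀ i, StronglyMeasurable (f i)) (hv0 : 0 < v) (hN : 1 ≤ N) (hI : (I.card : ℝ) ≤ N)
    (hv : ∀ i ∈ I, HasSquareExpBound P v (fun w => f i (Z i w))) :
    ∫⁻ w, ENNReal.ofReal (Real.exp (‖∑ i ∈ I, f i (Z i w)‖ ^ 2 / (2 * v * N))) ∂P ≤
      ENNReal.ofReal (Real.exp 1) := by
  have hN0 : 0 < N := by linarith
  calc ∫⁻ w, ENNReal.ofReal (Real.exp (‖∑ i ∈ I, f i (Z i w)‖ ^ 2 / (2 * v * N))) ∂P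
      ≤ ∫⁻ w, ENNReal.ofReal (Real.exp (‖∑ i ∈ I, f i (Z i w)‖ ^ 2 / (v * (N + I.card)))) ∂P := by
        refine lintegral_mono fun w => ENNReal.ofReal_le_ofReal (Real.exp_le_exp.2 ?_)
        refine div_le_div_of_nonneg_left (by positivity) (by positivity) ?_
        nlinarith
    _ ≤ ENNReal.ofReal (Real.exp (I.card / N)) :=
        lintegral_exp_norm_sum_sq_le_of_card hZm hZ hf hN hv
    _ ≤ ENNReal.ofReal (Real.exp 1) := by
        gcongr
        exact (div_le_one hN0).2 hI

end IndependentSum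

lemma exp_norm_sum_sq_le_sum_exp {κ : Type*} [Fintype κ] [Nonempty κ] (x : κ → F) {a : ℝ}
    (ha : 0 ≤ a) :
    Real.exp (‖∑ r, x r‖ ^ 2 / (Fintype.card κ ^ 2 * a)) ≤ ∑ r, Real.exp (‖x r‖ ^ 2 / a) := by
  obtain ⟨r, -, hmax⟩ := Finset.exists_max_image Finset.univ (fun r => ‖x r‖)
    Finset.univ_nonempty
  have hle : ‖∑ r, x r‖ ≤ Fintype.card κ * ‖x r‖ := by
    simpa using norm_sum_le_of_le Finset.univ hmax
  calc Real.exp (‖∑ r, x r‖ ^ 2 / (Fintype.card κ ^ 2 * a))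
      ≤ Real.exp ((Fintype.card κ * ‖x r‖) ^ 2 / (Fintype.card κ ^ 2 * a)) := by gcongr
    _ = Real.exp (‖x r‖ ^ 2 / a) := by
        rw [mul_pow, mul_div_mul_left _ _ (by simp)]
    _ ≤ ∑ r, Real.exp (‖x r‖ ^ 2 / a) :=
        Finset.single_le_sum (f := fun r => Real.exp (‖x r‖ ^ 2 / a))
          (fun _ _ => (Real.exp_pos _).le) (Finset.mem_univ r)

lemma iIndepFun_curry {ι κ β : Type*} [MeasurableSpace β] {Y : ι × κ → Ω → β}
    (hYm : ∀ p, Measurable (Y p)) (hY : iIndepFun Y P) :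
    iIndepFun (fun i w j => Y (i, j) w) P := by
  have := hY.isProbabilityMeasure
  have (i : ι) (j : κ) : IsProbabilityMeasure (P.map (Y (i, j))) :=
    Measure.isProbabilityMeasure_map (hYm _).aemeasurable
  have hrow (i : ι) : P.map (fun w j => Y (i, j) w) =
      Measure.infinitePi fun j => P.map (Y (i, j)) :=
    (hY.precomp (Prod.mk_right_injective i)).map_fun_eq_infinitePi_map fun j => hYm (i, j)
  rw [iIndepFun_iff_map_fun_eq_infinitePi_map (by fun_prop)]
  simp only [hrow]
  rw [← Measure.infinitePi_map_curry, ← hY.map_fun_eq_infinitePi_map hYm,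
    Measure.map_map (by fun_prop) (by fun_prop)]
  rfl

section Windows

variable {K M : ℕ} {t : Fin K → Ω → ℝ}

lemma winNode_injective_of_residue (r : ZMod (M + 1)) :
    Function.Injective fun p : {k : Fin (K - M) // (k.1 : ZMod (M + 1)) = r} × Fin (M + 1) =>
      winNode p.1.1 p.2 := by
  rintro ⟨⟨k, hk⟩, i⟩ ⟨⟨l, hl⟩, j⟩ h
  have hsum : k.1 + i.1 = l.1 + j.1 := congrArg Fin.val h
  have hij : ((i.1 : ℕ) : ZMod (M + 1)) = (j.1 : ℕ) := by
    have := congrArg (Nat.cast (R := ZMod (M + 1))) hsum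
    rwa [Nat.cast_add, Nat.cast_add, hk, hl, add_right_inj] at this
  rw [ZMod.natCast_eq_natCast_iff', Nat.mod_eq_of_lt i.2, Nat.mod_eq_of_lt j.2] at hij
  have hkl : k = l := Fin.ext (by omega)
  simp [hkl, Fin.ext hij]

lemma iIndepFun_window_of_residue (htm : ∀ i, Measurable (t i)) (ht : iIndepFun t P)
    (r : ZMod (M + 1)) :
    iIndepFun (fun (k : {k : Fin (K - M) // (k.1 : ZMod (M + 1)) = r}) w (j : Fin (M + 1)) =>
      t (winNode k.1 j) w) P :=
  iIndepFun_curry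
    (Y := fun p : {k : Fin (K - M) // (k.1 : ZMod (M + 1)) = r} × Fin (M + 1) =>
      t (winNode p.1.1 p.2)) (fun _ => htm _)
    (ht.precomp (winNode_injective_of_residue r))

lemma lintegral_exp_norm_window_sum_sq_le [InnerProductSpace ℝ F] [CompleteSpace F]
    [IsProbabilityMeasure P] (hKM : M < K) (htm : ∀ i, Measurable (t i)) (ht : iIndepFun t P)
    {G : (Fin (M + 1) → ℝ) → F} (hG : StronglyMeasurable G) {b : ℝ} (hb : 0 < b)
    (hGb : ∀ y, ‖G y‖ ≤ b) :
    ∫⁻ w, ENNReal.ofReal (Real.exp (‖∑ k : Fin (K - M), (G (fun j => t (winNode k j) w)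
        - ∫ w', G (fun j => t (winNode k j) w') ∂P)‖ ^ 2 /
        ((M + 1) ^ 2 * (2 * (8 * b ^ 2) * ((K - M : ℕ) : ℝ))))) ∂P ≤
      (M + 1) * ENNReal.ofReal (Real.exp 1) := by
  set ℓ : ℝ := ((K - M : ℕ) : ℝ) with hℓ
  have hℓ1 : 1 ≤ ℓ := Nat.one_le_cast.2 (Nat.sub_pos_of_lt hKM)
  let X (k : Fin (K - M)) (y : Fin (M + 1) → ℝ) : F :=
    G y - ∫ w', G (fun j => t (winNode k j) w') ∂P
  let W (k : Fin (K - M)) (w : Ω) (j : Fin (M + 1)) : ℝ := t (winNode k j) w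
  have hW (k : Fin (K - M)) : Measurable (W k) := measurable_pi_lambda _ fun j => htm _
  have hX (k : Fin (K - M)) : StronglyMeasurable (X k) := hG.sub stronglyMeasurable_const
  have hXv (k : Fin (K - M)) : HasSquareExpBound P (8 * b ^ 2) fun w => X k (W k w) :=
    hasSquareExpBound_sub_integral (hG.comp_measurable (hW k)).aestronglyMeasurable hb
      (.of_forall fun _ => hGb _)
  let S (r : ZMod (M + 1)) (w : Ω) : F :=
    ∑ k : {k : Fin (K - M) // (k.1 : ZMod (M + 1)) = r}, X k (W k w)
  have hS (r : ZMod (M + 1)) :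
      ∫⁻ w, ENNReal.ofReal (Real.exp (‖S r w‖ ^ 2 / (2 * (8 * b ^ 2) * ℓ))) ∂P ≤
        ENNReal.ofReal (Real.exp 1) := by
    refine lintegral_exp_norm_sum_sq_le (fun k => (hW k).aemeasurable)
      (iIndepFun_window_of_residue htm ht r) (fun k => hX k) (by positivity) hℓ1 ?_
      fun k _ => hXv k
    rw [hℓ]
    exact_mod_cast (Fintype.card_subtype_le _).trans_eq (Fintype.card_fin _)
  have hSm (r : ZMod (M + 1)) : StronglyMeasurable (S r) :=
    Finset.stronglyMeasurable_fun_sum _ fun k _ => (hX k).comp_measurable (hW k)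
  have hcard : (Fintype.card (ZMod (M + 1)) : ℝ) = M + 1 := by simp [ZMod.card]
  calc _ ≤ ∫⁻ w, ∑ r, ENNReal.ofReal (Real.exp (‖S r w‖ ^ 2 / (2 * (8 * b ^ 2) * ℓ))) ∂P := by
        refine lintegral_mono fun w => ?_
        rw [← ENNReal.ofReal_sum_of_nonneg fun _ _ => (Real.exp_pos _).le, ← hcard]
        refine ENNReal.ofReal_le_ofReal ((exp_norm_sum_sq_le_sum_exp _ (by positivity)).trans' ?_)
        rw [Fintype.sum_fiberwise (fun k : Fin (K - M) => (k.1 : ZMod (M + 1)))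
          fun k => X k (W k w)]
    _ = ∑ r, ∫⁻ w, ENNReal.ofReal (Real.exp (‖S r w‖ ^ 2 / (2 * (8 * b ^ 2) * ℓ))) ∂P :=
        lintegral_finsetSum _ fun r _ => by have := (hSm r).norm.measurable; fun_prop
    _ ≤ ∑ _r : ZMod (M + 1), ENNReal.ofReal (Real.exp 1) := Finset.sum_le_sum fun r _ => hS r
    _ = (M + 1) * ENNReal.ofReal (Real.exp 1) := by simp [ZMod.card]

end Windows

lemma measure_log_div_lt_le {Z : Ω → ℝ} (hZ : AEMeasurable Z P) {C η : ℝ} (hC : 0 < C)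
    (hη : 0 < η) (h : ∫⁻ w, ENNReal.ofReal (Real.exp (Z w)) ∂P ≤ ENNReal.ofReal C) :
    P {w | Real.log (C / η) < Z w} ≤ ENNReal.ofReal η := by
  have hsub : {w | Real.log (C / η) < Z w} ⊆
      {w | ENNReal.ofReal (C / η) ≤ ENNReal.ofReal (Real.exp (Z w))} := fun w hw =>
    ENNReal.ofReal_le_ofReal ((Real.log_le_iff_le_exp (by positivity)).1 (le_of_lt hw))
  calc P {w | Real.log (C / η) < Z w}
      ≤ (∫⁻ w, ENNReal.ofReal (Real.exp (Z w)) ∂P) / ENNReal.ofReal (C / η) :=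
        (measure_mono hsub).trans (meas_ge_le_lintegral_div (by fun_prop)
          (ENNReal.ofReal_pos.2 (by positivity)).ne' ENNReal.ofReal_ne_top)
    _ ≤ ENNReal.ofReal C / ENNReal.ofReal (C / η) := by gcongr
    _ = ENNReal.ofReal η := by
        rw [← ENNReal.ofReal_div_of_pos (by positivity), div_div_cancel₀ hC.ne']

end Concentration

section Windows

variable {M : ℕ} {hmax ω : ℝ}

/-- The set of admissible grids with `K` nodes, on which the window functionals are continuous. -/
def admissibleSet (K : ℕ) (hmax ω : ℝ) : Set (Fin K → ℝ) := {s | AdmissibleGrid hmax ω s}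

lemma measurableSet_admissibleSet (K : ℕ) (hmax ω : ℝ) :
    MeasurableSet (admissibleSet K hmax ω) := by
  have heq : admissibleSet K hmax ω = {s | (∀ i, 0 ≤ s i) ∧
      (∀ i j : Fin K, i.1 + 1 = j.1 → s i < s j) ∧
      (∀ i j : Fin K, i.1 + 1 = j.1 → s j - s i ≤ hmax) ∧
      ∀ i j l : Fin K, i.1 + 1 = j.1 → j.1 + 1 = l.1 →
        s l - s j ≤ ω * (s j - s i) ∧ s j - s i ≤ ω * (s l - s j)} :=
    Set.ext fun s => ⟨fun h => ⟨h.1, h.2, h.3, h.4⟩, fun h => ⟨h.1, h.2.1, h.2.2.1, h.2.2.2⟩⟩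
  rw [heq]
  measurability

/-- The steps between consecutive nodes of a single window. -/
def nodeSteps (s : Fin (M + 1) → ℝ) (i : Fin M) : ℝ := s i.succ - s i.castSucc

lemma continuous_nodeSteps : Continuous (nodeSteps : (Fin (M + 1) → ℝ) → Fin M → ℝ) := by
  unfold nodeSteps
  fun_prop

lemma nodeOffset_succ (h : Fin M → ℝ) (j : Fin M) :
    nodeOffset h j.succ = nodeOffset h j.castSucc + h j := by
  have hsplit : ∀ i : Fin M, (if i.castSucc < j.succ then h i else 0)
      = (if i.castSucc < j.castSucc then h i else 0) + if i = j then h i else 0 := fun i => by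
    rcases lt_trichotomy i j with hij | rfl | hij
    · simp [Fin.castSucc_lt_succ_iff, hij, hij.le, hij.ne]
    · simp
    · simp [Fin.castSucc_lt_succ_iff, hij.not_ge, hij.not_gt, hij.ne']
  simp only [nodeOffset, hsplit, Finset.sum_add_distrib, Finset.sum_ite_eq', Finset.mem_univ,
    if_true]

lemma nodeOffset_nodeSteps (s : Fin (M + 1) → ℝ) (j : Fin (M + 1)) :
    nodeOffset (nodeSteps s) j = s j - s 0 := by
  induction j using Fin.induction with
  | zero => simp [nodeOffset]
  | succ j ih =>
    rw [nodeOffset_succ, ih, nodeSteps]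
    ring

/-- The nodes of window `k` of a grid. -/
def gridWindow {K : ℕ} (t : Fin K → ℝ) (k : Fin (K - M)) (j : Fin (M + 1)) : ℝ := t (winNode k j)

lemma AdmissibleGrid.gridWindow {K : ℕ} {t : Fin K → ℝ} (ht : AdmissibleGrid hmax ω t)
    (k : Fin (K - M)) : AdmissibleGrid hmax ω (gridWindow t k) where
  nonneg _ := ht.nonneg _
  step_pos _ _ h := ht.step_pos _ _ (by simp only [winNode]; lia)
  step_le _ _ h := ht.step_le _ _ (by simp only [winNode]; lia)
  ratio _ _ _ h h' := ht.ratio _ _ _ (by simp only [winNode]; lia) (by simp only [winNode]; lia)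

variable {s : Fin (M + 1) → ℝ}

lemma AdmissibleGrid.nodeSteps_pos (hs : AdmissibleGrid hmax ω s) (i : Fin M) :
    0 < nodeSteps s i :=
  sub_pos.2 (hs.step_pos _ _ (by simp))

lemma AdmissibleGrid.nodeSteps_le (hs : AdmissibleGrid hmax ω s) (i : Fin M) :
    nodeSteps s i ≤ hmax :=
  hs.step_le _ _ (by simp)

lemma AdmissibleGrid.nodeSteps_le_mul_of_succ (hs : AdmissibleGrid hmax ω s) {i j : Fin M}
    (hij : i.1 + 1 = j.1) :
    nodeSteps s j ≤ max ω 1 * nodeSteps s i ∧ nodeSteps s i ≤ max ω 1 * nodeSteps s j := by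
  have hmid : i.succ = j.castSucc := Fin.ext (by simpa using hij)
  obtain ⟨hji, hij'⟩ := hs.ratio i.castSucc j.castSucc j.succ (by simpa using hij) (by simp)
  rw [← hmid] at hji hij'
  have hle : ∀ l : Fin M, ω * nodeSteps s l ≤ max ω 1 * nodeSteps s l := fun l =>
    mul_le_mul_of_nonneg_right (le_max_left _ _) (hs.nodeSteps_pos l).le
  refine ⟨le_trans ?_ (hle i), le_trans ?_ (hle j)⟩ <;> simpa only [nodeSteps, ← hmid]

lemma AdmissibleGrid.nodeSteps_comparable [NeZero M] (hs : AdmissibleGrid hmax ω s) (i : Fin M) :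
    nodeSteps s i ≤ max ω 1 ^ M * nodeSteps s 0 ∧ nodeSteps s 0 ≤ max ω 1 ^ M * nodeSteps s i := by
  have hW : (1 : ℝ) ≤ max ω 1 := le_max_right _ _
  have hiter : ∀ q : ℕ, ∀ hq : q < M, nodeSteps s ⟨q, hq⟩ ≤ max ω 1 ^ q * nodeSteps s 0 ∧
      nodeSteps s 0 ≤ max ω 1 ^ q * nodeSteps s ⟨q, hq⟩ := by
    intro q
    induction q with
    | zero => intro hq; simp [show (⟨0, hq⟩ : Fin M) = 0 from rfl]
    | succ q ih =>
      intro hq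
      obtain ⟨ih1, ih2⟩ := ih (by lia)
      obtain ⟨h1, h2⟩ :=
        hs.nodeSteps_le_mul_of_succ (i := ⟨q, by lia⟩) (j := ⟨q + 1, hq⟩) rfl
      rw [pow_succ]
      constructor
      · calc _ ≤ max ω 1 * (max ω 1 ^ q * nodeSteps s 0) := h1.trans (by gcongr)
          _ = _ := by ring
      · calc _ ≤ max ω 1 ^ q * (max ω 1 * nodeSteps s ⟨q + 1, hq⟩) := ih2.trans (by gcongr)
          _ = _ := by ring
  obtain ⟨h1, h2⟩ := hiter i.1 i.2
  have hpow : max ω 1 ^ i.1 ≤ max ω 1 ^ M := pow_le_pow_right₀ hW i.2.le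
  have h0 := hs.nodeSteps_pos 0
  have hi := hs.nodeSteps_pos i
  exact ⟨h1.trans (by gcongr), h2.trans (by gcongr)⟩

lemma AdmissibleGrid.inv_smul_nodeSteps_mem_Icc [NeZero M] (hs : AdmissibleGrid hmax ω s) :
    (nodeSteps s 0)⁻¹ • nodeSteps s ∈
      Set.Icc (fun _ : Fin M => (max ω 1 ^ M)⁻¹) (fun _ => max ω 1 ^ M) := by
  have h0 := hs.nodeSteps_pos 0
  have hW : 0 < max ω 1 ^ M := by positivity
  constructor <;> intro i <;> simp only [Pi.smul_apply, smul_eq_mul]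
  · rw [← div_eq_inv_mul, le_div_iff₀ h0, inv_mul_le_iff₀ hW]
    exact (hs.nodeSteps_comparable i).2
  · rw [inv_mul_le_iff₀ h0, mul_comm]
    exact (hs.nodeSteps_comparable i).1

lemma AdmissibleGrid.offset_nonneg (hs : AdmissibleGrid hmax ω s) (j : Fin (M + 1)) :
    0 ≤ s j - s 0 := by
  rw [← nodeOffset_nodeSteps, nodeOffset]
  refine Finset.sum_nonneg fun i _ => ?_
  split_ifs
  exacts [(hs.nodeSteps_pos i).le, le_rfl]

lemma AdmissibleGrid.offset_le [NeZero M] (hs : AdmissibleGrid hmax ω s) (j : Fin (M + 1)) :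
    s j - s 0 ≤ M * max ω 1 ^ M * nodeSteps s 0 := by
  rw [← nodeOffset_nodeSteps, nodeOffset]
  have h0 := hs.nodeSteps_pos 0
  calc _ ≤ ∑ _i : Fin M, max ω 1 ^ M * nodeSteps s 0 := by
        refine Finset.sum_le_sum fun i _ => ?_
        split_ifs
        exacts [(hs.nodeSteps_comparable i).1, by positivity]
    _ = _ := by rw [Finset.sum_const, Finset.card_univ, Fintype.card_fin, nsmul_eq_mul, mul_assoc]

-- By homogeneity it suffices to bound the coefficients on the compact box of normalized steps.
lemma VLMM.exists_coeff_bound [NeZero M] (meth : VLMM M) (hmax ω : ℝ) :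
    ∃ C : ℝ, 0 < C ∧ ∀ s : Fin (M + 1) → ℝ, AdmissibleGrid hmax ω s → ∀ j,
      |meth.a (nodeSteps s) j| ≤ C ∧ |meth.b (nodeSteps s) j| ≤ C * nodeSteps s 0 := by
  have hsub : Set.Icc (fun _ : Fin M => (max ω 1 ^ M)⁻¹) (fun _ => max ω 1 ^ M)
      ⊆ {h | ∀ i, 0 < h i} := fun h hh i =>
    lt_of_lt_of_le (by positivity) (hh.1 i)
  obtain ⟨Ca, hCa⟩ := isCompact_Icc.exists_bound_of_continuousOn (meth.a_cont.mono hsub)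
  obtain ⟨Cb, hCb⟩ := isCompact_Icc.exists_bound_of_continuousOn (meth.b_cont.mono hsub)
  refine ⟨max (max Ca Cb) 1, by positivity, fun s hs j => ?_⟩
  have h0 := hs.nodeSteps_pos 0
  have hg := hs.inv_smul_nodeSteps_mem_Icc
  set h := nodeSteps s 0
  set g := h⁻¹ • nodeSteps s
  have hsg : nodeSteps s = h • g := (smul_inv_smul₀ h0.ne' _).symm
  rw [hsg, meth.a_scale h g h0 (hsub hg), meth.b_scale h g h0 (hsub hg)]
  constructor
  · exact (norm_le_pi_norm (meth.a g) j).trans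
      ((hCa g hg).trans ((le_max_left _ _).trans (le_max_left _ _)))
  · rw [Pi.smul_apply, smul_eq_mul, abs_mul, abs_of_pos h0, mul_comm]
    gcongr
    exact (norm_le_pi_norm (meth.b g) j).trans
      ((hCb g hg).trans ((le_max_right _ _).trans (le_max_left _ _)))

lemma VLMM.continuousOn_a (meth : VLMM M) (j : Fin (M + 1)) :
    ContinuousOn (fun s => meth.a (nodeSteps s) j) (admissibleSet (M + 1) hmax ω) :=
  (continuous_apply j).comp_continuousOn
    (meth.a_cont.comp continuous_nodeSteps.continuousOn fun _ hs i =>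
      AdmissibleGrid.nodeSteps_pos hs i)

lemma VLMM.continuousOn_b (meth : VLMM M) (j : Fin (M + 1)) :
    ContinuousOn (fun s => meth.b (nodeSteps s) j) (admissibleSet (M + 1) hmax ω) :=
  (continuous_apply j).comp_continuousOn
    (meth.b_cont.comp continuous_nodeSteps.continuousOn fun _ hs i =>
      AdmissibleGrid.nodeSteps_pos hs i)

end Windows

section Truncation

variable {E : Type*} [NormedAddCommGroup E] [NormedSpace ℝ E]

lemma iteratedDerivWithin_Icc_eq_Ici {f : ℝ → E} {q : ℕ} (hf : ContDiffOn ℝ q f (Set.Ici 0))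
    {a b y : ℝ} (ha : 0 ≤ a) (hab : a < b) (hy : y ∈ Set.Icc a b) :
    iteratedDerivWithin q f (Set.Icc a b) y = iteratedDerivWithin q f (Set.Ici 0) y := by
  rw [iteratedDerivWithin, iteratedDerivWithin,
    iteratedFDerivWithin_subset (show Set.Icc a b ⊆ Set.Ici 0 from fun _ hz => ha.trans hz.1)
      (uniqueDiffOn_Icc hab) (uniqueDiffOn_Ici 0) hf hy]

lemma norm_sub_taylor_le {f : ℝ → E} {q : ℕ} {D : ℝ}
    (hf : ContDiffOn ℝ ((q + 1 : ℕ) : WithTop ℕ∞) f (Set.Ici 0))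
    (hD : ∀ t, 0 ≤ t → ‖iteratedDerivWithin (q + 1) f (Set.Ici 0) t‖ ≤ D) {a b : ℝ} (ha : 0 ≤ a)
    (hab : a ≤ b) :
    ‖f b - ∑ i ∈ Finset.range (q + 1),
      ((i.factorial : ℝ)⁻¹ * (b - a) ^ i) • iteratedDerivWithin i f (Set.Ici 0) a‖
      ≤ D * (b - a) ^ (q + 1) := by
  have hD0 : 0 ≤ D := (norm_nonneg _).trans (hD 0 le_rfl)
  have hlt : a < b + 1 := by linarith
  have hrestrict : ∀ i ≤ q + 1, ∀ y ∈ Set.Icc a (b + 1),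
      iteratedDerivWithin i f (Set.Icc a (b + 1)) y = iteratedDerivWithin i f (Set.Ici 0) y :=
    fun i hi y hy =>
      iteratedDerivWithin_Icc_eq_Ici (hf.of_le (by exact_mod_cast hi)) ha hlt hy
  have hrem := taylor_mean_remainder_bound (n := q) hlt.le
    (by exact_mod_cast hf.mono fun y (hy : y ∈ Set.Icc a (b + 1)) => ha.trans hy.1)
    (show b ∈ Set.Icc a (b + 1) from ⟨hab, by linarith⟩)
    (C := D) (fun y hy => by rw [hrestrict _ le_rfl y hy]; exact hD y (ha.trans hy.1))
  rw [taylor_within_apply, Finset.sum_congr rfl fun i hi => by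
    rw [hrestrict i (Finset.mem_range.1 hi).le a ⟨le_rfl, hlt.le⟩]] at hrem
  have : 0 ≤ b - a := sub_nonneg.2 hab
  exact hrem.trans (div_le_self (by positivity) (mod_cast Nat.factorial_pos q))

lemma norm_deriv_sub_taylor_le {f : ℝ → E} {p : ℕ} {D : ℝ}
    (hf : ContDiffOn ℝ ((p + 1 : ℕ) : WithTop ℕ∞) f (Set.Ici 0))
    (hD : ∀ t, 0 ≤ t → ‖iteratedDerivWithin (p + 1) f (Set.Ici 0) t‖ ≤ D) {a b : ℝ} (ha : 0 ≤ a)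
    (hab : a ≤ b) :
    ‖derivWithin f (Set.Ici 0) b - ∑ i ∈ Finset.range p,
      ((i.factorial : ℝ)⁻¹ * (b - a) ^ i) • iteratedDerivWithin (i + 1) f (Set.Ici 0) a‖
      ≤ D * (b - a) ^ p := by
  cases p with
  | zero => simpa [iteratedDerivWithin_one] using hD b (ha.trans hab)
  | succ q =>
    have hf' : ContDiffOn ℝ ((q + 1 : ℕ) : WithTop ℕ∞) (derivWithin f (Set.Ici 0)) (Set.Ici 0) :=
      hf.derivWithin (uniqueDiffOn_Ici 0) (by norm_cast)
    simpa only [← iteratedDerivWithin_succ'] using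
      norm_sub_taylor_le hf' (fun t ht => by rw [← iteratedDerivWithin_succ']; exact hD t ht) ha hab

/-- The defect of the multistep relation `∑ⱼ aⱼ f(sⱼ) = ∑ⱼ bⱼ f'(sⱼ)` on the window `s`. -/
def VLMM.truncationError {M : ℕ} (meth : VLMM M) (f f' : ℝ → E) (s : Fin (M + 1) → ℝ) : E :=
  ∑ j, meth.a (nodeSteps s) j • f (s j) - ∑ j, meth.b (nodeSteps s) j • f' (s j)

variable {M p : ℕ} {meth : VLMM M} {h : Fin M → ℝ}

lemma VLMM.HasOrder.sum_a (hp : meth.HasOrder p) (hh : ∀ i, 0 < h i) : ∑ j, meth.a h j = 0 := by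
  simpa using hp h hh 1 (by simp)

lemma VLMM.HasOrder.sum_moment (hp : meth.HasOrder p) (hh : ∀ i, 0 < h i) {i : ℕ} (hi : i < p) :
    ∑ j, meth.a h j * (((i + 1).factorial : ℝ)⁻¹ * nodeOffset h j ^ (i + 1))
      = ∑ j, meth.b h j * ((i.factorial : ℝ)⁻¹ * nodeOffset h j ^ i) := by
  have hexact := hp h hh (Polynomial.C ((i + 1).factorial : ℝ)⁻¹ * Polynomial.X ^ (i + 1))
    ((Polynomial.natDegree_C_mul_X_pow_le _ _).trans hi)
  simp only [Polynomial.eval_mul, Polynomial.eval_C, Polynomial.eval_pow, Polynomial.eval_X,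
    Polynomial.derivative_C_mul_X_pow, Nat.add_sub_cancel] at hexact
  rw [hexact]
  refine Finset.sum_congr rfl fun j _ => ?_
  have : (i.factorial : ℝ) ≠ 0 := by positivity
  rw [Nat.factorial_succ]
  push_cast
  field_simp

lemma VLMM.HasOrder.sum_taylor (hp : meth.HasOrder p) (hh : ∀ i, 0 < h i) (c : ℕ → E) :
    ∑ j, meth.a h j • ∑ i ∈ Finset.range (p + 1),
        ((i.factorial : ℝ)⁻¹ * nodeOffset h j ^ i) • c i
      = ∑ j, meth.b h j • ∑ i ∈ Finset.range p,
        ((i.factorial : ℝ)⁻¹ * nodeOffset h j ^ i) • c (i + 1) := by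
  have hswap : ∀ (q : ℕ) (α : Fin (M + 1) → ℝ) (d : ℕ → E),
      ∑ j, α j • ∑ i ∈ Finset.range q, ((i.factorial : ℝ)⁻¹ * nodeOffset h j ^ i) • d i
        = ∑ i ∈ Finset.range q,
          (∑ j, α j * ((i.factorial : ℝ)⁻¹ * nodeOffset h j ^ i)) • d i := fun q α d => by
    simp only [Finset.smul_sum, Finset.sum_smul, smul_smul]
    exact Finset.sum_comm
  rw [hswap, hswap, Finset.sum_range_succ']
  simp only [Nat.factorial_zero, Nat.cast_one, inv_one, pow_zero, mul_one, hp.sum_a hh, zero_smul,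
    add_zero]
  exact Finset.sum_congr rfl fun i hi => by rw [hp.sum_moment hh (Finset.mem_range.1 hi)]

variable {hmax ω : ℝ} {f : ℝ → E} {D : ℝ} {s : Fin (M + 1) → ℝ}

lemma VLMM.HasOrder.truncationError_eq (hp : meth.HasOrder p) (hs : ∀ i, 0 < nodeSteps s i)
    (f' : ℝ → E) (c : ℕ → E) :
    meth.truncationError f f' s
      = ∑ j, meth.a (nodeSteps s) j • (f (s j) - ∑ i ∈ Finset.range (p + 1),
          ((i.factorial : ℝ)⁻¹ * (s j - s 0) ^ i) • c i)
        - ∑ j, meth.b (nodeSteps s) j • (f' (s j) - ∑ i ∈ Finset.range p,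
          ((i.factorial : ℝ)⁻¹ * (s j - s 0) ^ i) • c (i + 1)) := by
  have htaylor := hp.sum_taylor hs c
  simp only [nodeOffset_nodeSteps] at htaylor
  simp only [truncationError, smul_sub, Finset.sum_sub_distrib, htaylor]
  abel

variable [NeZero M]

lemma AdmissibleGrid.norm_node_sub_taylor_le (hs : AdmissibleGrid hmax ω s) (j : Fin (M + 1))
    (hf : ContDiffOn ℝ ((p + 1 : ℕ) : WithTop ℕ∞) f (Set.Ici 0))
    (hD : ∀ t, 0 ≤ t → ‖iteratedDerivWithin (p + 1) f (Set.Ici 0) t‖ ≤ D) :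
    ‖f (s j) - ∑ i ∈ Finset.range (p + 1),
        ((i.factorial : ℝ)⁻¹ * (s j - s 0) ^ i) • iteratedDerivWithin i f (Set.Ici 0) (s 0)‖
      ≤ D * (M * max ω 1 ^ M * nodeSteps s 0) ^ (p + 1) := by
  have hD0 : 0 ≤ D := (norm_nonneg _).trans (hD 0 le_rfl)
  have hoff := hs.offset_nonneg j
  refine (norm_sub_taylor_le hf hD (hs.nonneg 0) (sub_nonneg.1 hoff)).trans ?_
  gcongr
  exact hs.offset_le j

lemma AdmissibleGrid.norm_deriv_node_sub_taylor_le (hs : AdmissibleGrid hmax ω s)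
    (j : Fin (M + 1)) (hf : ContDiffOn ℝ ((p + 1 : ℕ) : WithTop ℕ∞) f (Set.Ici 0))
    (hD : ∀ t, 0 ≤ t → ‖iteratedDerivWithin (p + 1) f (Set.Ici 0) t‖ ≤ D) :
    ‖derivWithin f (Set.Ici 0) (s j) - ∑ i ∈ Finset.range p,
        ((i.factorial : ℝ)⁻¹ * (s j - s 0) ^ i) • iteratedDerivWithin (i + 1) f (Set.Ici 0) (s 0)‖
      ≤ D * (M * max ω 1 ^ M * nodeSteps s 0) ^ p := by
  have hD0 : 0 ≤ D := (norm_nonneg _).trans (hD 0 le_rfl)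
  have hoff := hs.offset_nonneg j
  refine (norm_deriv_sub_taylor_le hf hD (hs.nonneg 0) (sub_nonneg.1 hoff)).trans ?_
  gcongr
  exact hs.offset_le j

lemma VLMM.exists_truncationError_le (hp : meth.HasOrder p) (hmax ω : ℝ)
    (hf : ContDiffOn ℝ ((p + 1 : ℕ) : WithTop ℕ∞) f (Set.Ici 0))
    (hD : ∀ t, 0 ≤ t → ‖iteratedDerivWithin (p + 1) f (Set.Ici 0) t‖ ≤ D) :
    ∃ C : ℝ, ∀ s : Fin (M + 1) → ℝ, AdmissibleGrid hmax ω s →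
      ‖meth.truncationError f (derivWithin f (Set.Ici 0)) s‖ ≤ C * nodeSteps s 0 ^ (p + 1) := by
  obtain ⟨C, hC, hcoeff⟩ := meth.exists_coeff_bound hmax ω
  set c : ℝ := M * max ω 1 ^ M
  refine ⟨(M + 1) * (C * (D * c ^ (p + 1))) + (M + 1) * (C * (D * c ^ p)), fun s hs => ?_⟩
  have h0 := hs.nodeSteps_pos 0
  rw [hp.truncationError_eq hs.nodeSteps_pos _ fun i => iteratedDerivWithin i f (Set.Ici 0) (s 0)]
  calc _ ≤ ∑ _j : Fin (M + 1), C * (D * (c * nodeSteps s 0) ^ (p + 1))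
        + ∑ _j : Fin (M + 1), C * nodeSteps s 0 * (D * (c * nodeSteps s 0) ^ p) := by
        refine (norm_sub_le _ _).trans (add_le_add
          (norm_sum_le_of_le _ fun j _ => ?_) (norm_sum_le_of_le _ fun j _ => ?_)) <;>
          rw [norm_smul, Real.norm_eq_abs]
        · exact mul_le_mul (hcoeff s hs j).1 (hs.norm_node_sub_taylor_le j hf hD)
            (norm_nonneg _) hC.le
        · exact mul_le_mul (hcoeff s hs j).2 (hs.norm_deriv_node_sub_taylor_le j hf hD)
            (norm_nonneg _) (by positivity)
    _ = _ := by
        simp only [Finset.sum_const, Finset.card_univ, Fintype.card_fin, nsmul_eq_mul]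
        push_cast
        ring

end Truncation

/-! ### The estimator as a regularized least squares solution -/

lemma real_inner_le_sq_div_add {V : Type*} [NormedAddCommGroup V]
    [InnerProductSpace ℝ V] (Z d : V) {ρ : ℝ} (hρ : 0 < ρ) :
    inner ℝ Z d ≤ ‖Z‖ ^ 2 / ρ + ρ * ‖d‖ ^ 2 / 4 := by
  refine (real_inner_le_norm _ _).trans (sub_nonneg.1 ?_)
  have hsq : ‖Z‖ ^ 2 / ρ + ρ * ‖d‖ ^ 2 / 4 - ‖Z‖ * ‖d‖ = (‖Z‖ - ρ * ‖d‖ / 2) ^ 2 / ρ := by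
    field_simp
    ring
  rw [hsq]
  positivity

section Ridge

variable {ι V : Type*} [Fintype ι] [DecidableEq ι] [NormedAddCommGroup V] [InnerProductSpace ℝ V]

/-- The weights `(σ² ⟨φ_q, φ_r⟩ + L I)⁻¹ y` of the regularized least squares problem with features
`φ` and labels `y`. -/
def ridgeWeights (σ2 L : ℝ) (φ : ι → V) (y : ι → ℝ) : ι → ℝ :=
  (σ2 • Matrix.gram ℝ φ + L • 1)⁻¹ *ᵥ y

/-- The regularized least squares solution with features `φ` and labels `y`: the minimizer of
`g ↦ ∑_q (⟨φ_q, g⟩ - y_q)² + (L / σ²) ‖g‖²`. -/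
def ridgeSolution (σ2 L : ℝ) (φ : ι → V) (y : ι → ℝ) : V :=
  σ2 • ∑ q, ridgeWeights σ2 L φ y q • φ q

variable {σ2 L : ℝ} {φ : ι → V} {y : ι → ℝ}

lemma inner_ridgeSolution_add (hσ2 : 0 ≤ σ2) (hL : 0 < L) (q : ι) :
    inner ℝ (φ q) (ridgeSolution σ2 L φ y) + L * ridgeWeights σ2 L φ y q = y q := by
  have hpd : (σ2 • Matrix.gram ℝ φ + L • (1 : Matrix ι ι ℝ)).PosDef :=
    .posSemidef_add ((Matrix.posSemidef_gram ℝ φ).smul hσ2) (Matrix.PosDef.one.smul hL)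
  have hsolve : (σ2 • Matrix.gram ℝ φ + L • (1 : Matrix ι ι ℝ)) *ᵥ ridgeWeights σ2 L φ y = y := by
    rw [ridgeWeights, Matrix.mulVec_mulVec, Matrix.mul_nonsing_inv _
      ((Matrix.isUnit_iff_isUnit_det _).1 hpd.isUnit), Matrix.one_mulVec]
  nth_rewrite 3 [← hsolve]
  rw [Matrix.add_mulVec, Matrix.smul_mulVec, Matrix.smul_mulVec, Matrix.one_mulVec]
  simp only [ridgeSolution, Pi.add_apply, Pi.smul_apply, smul_eq_mul, Matrix.mulVec, dotProduct,
    Matrix.gram_apply, real_inner_smul_right, inner_sum, mul_comm]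

lemma sum_inner_sq_add_eq (hσ2 : 0 < σ2) (hL : 0 < L) {g₀ : V} {τ ξ : ι → ℝ}
    (hy : ∀ q, y q = inner ℝ (φ q) g₀ + τ q + ξ q) {d : V}
    (hd : d = ridgeSolution σ2 L φ y - g₀) :
    ∑ q, inner ℝ (φ q) d ^ 2 + L / σ2 * (‖d‖ ^ 2 + inner ℝ g₀ d)
      = ∑ q, τ q * inner ℝ (φ q) d + inner ℝ (∑ q, ξ q • φ q) d := by
  set α := ridgeWeights σ2 L φ y
  have hpoint : ∀ q, inner ℝ (φ q) d ^ 2 + L * (α q * inner ℝ (φ q) d)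
      = τ q * inner ℝ (φ q) d + ξ q * inner ℝ (φ q) d := fun q => by
    have hres : inner ℝ (φ q) d + L * α q = τ q + ξ q := by
      rw [hd, inner_sub_right]
      linarith [inner_ridgeSolution_add (φ := φ) (y := y) hσ2.le hL q, hy q]
    linear_combination inner ℝ (φ q) d * hres
  have hsol : ‖d‖ ^ 2 + inner ℝ g₀ d = σ2 * ∑ q, α q * inner ℝ (φ q) d := by
    rw [← real_inner_self_eq_norm_sq, ← inner_add_left]
    nth_rewrite 1 [hd]
    simp only [sub_add_cancel, ridgeSolution, real_inner_smul_left, sum_inner, α]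
  rw [hsol, ← mul_assoc, div_mul_cancel₀ _ hσ2.ne', Finset.mul_sum, ← Finset.sum_add_distrib,
    sum_inner]
  simp only [hpoint, real_inner_smul_left, Finset.sum_add_distrib]

/-- The noise `ξ` enters only through the vector `∑ ξ_q φ_q`, whereas the deterministic error `τ`
enters through its Euclidean norm. -/
lemma ridge_error_bound (hσ2 : 0 < σ2) (hL : 0 < L) {g₀ : V} {τ ξ : ι → ℝ}
    (hy : ∀ q, y q = inner ℝ (φ q) g₀ + τ q + ξ q) {d : V}
    (hd : d = ridgeSolution σ2 L φ y - g₀) :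
    ∑ q, inner ℝ (φ q) d ^ 2 + L / σ2 * ‖d‖ ^ 2 ≤
      2 * (L / σ2) * ‖g₀‖ ^ 2 + 2 * ‖∑ q, ξ q • φ q‖ ^ 2 / (L / σ2) + ∑ q, τ q ^ 2 := by
  have hρ : 0 < L / σ2 := by positivity
  have henergy := sum_inner_sq_add_eq hσ2 hL hy hd
  have htrunc : ∑ q, τ q * inner ℝ (φ q) d
      ≤ (∑ q, τ q ^ 2) / 2 + (∑ q, inner ℝ (φ q) d ^ 2) / 2 := by
    rw [Finset.sum_div, Finset.sum_div, ← Finset.sum_add_distrib]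
    exact Finset.sum_le_sum fun q _ => by linarith [two_mul_le_add_sq (τ q) (inner ℝ (φ q) d)]
  have hnoise := real_inner_le_sq_div_add (∑ q, ξ q • φ q) d hρ
  have hprior : L / σ2 * -inner ℝ g₀ d ≤ L / σ2 * (‖g₀‖ ^ 2 + ‖d‖ ^ 2 / 4) := by
    refine mul_le_mul_of_nonneg_left ?_ hρ.le
    simpa [inner_neg_left] using real_inner_le_sq_div_add (-g₀) d one_pos
  rw [mul_div_assoc 2 (‖∑ q, ξ q • φ q‖ ^ 2)]
  linarith

end Ridge

section Representers

variable {n m : ℕ} (𝓗 : Type*) [NormedAddCommGroup 𝓗] [InnerProductSpace ℝ 𝓗] [CompleteSpace 𝓗]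
  [RKHS ℝ 𝓗 (State n) ℝ]

/-- The canonical feature map `z ↦ k(·, z)` of the base kernel. -/
def feature (z : State n) : 𝓗 := RKHS.kerFun 𝓗 z 1

lemma innerKernel_feature :
    innerKernel (feature 𝓗) = fun p : State n × State n => baseKernel 𝓗 p.1 p.2 := by
  funext p
  rw [innerKernel, real_inner_comm, feature, feature, ← RKHS.kernel_inner, baseKernel]
  simp

lemma inner_feature_left (z : State n) (g : 𝓗) : inner ℝ (feature 𝓗 z) g = g z := by
  rw [feature, RKHS.kerFun_inner]
  simp

lemma contDiff_feature
    (hk : ContDiff ℝ 2 fun z : State n × State n => baseKernel 𝓗 z.1 z.2) :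
    ContDiff ℝ 1 (feature 𝓗 : State n → 𝓗) :=
  contDiff_of_contDiff_innerKernel (by rwa [innerKernel_feature])

/-- The representer of `g ↦ (J_R(z) ∇g(z))_c`. -/
def fieldRep (S : PortHamiltonian n m) (z : State n) (c : Fin n) : 𝓗 :=
  ∑ i, S.JR z c i • fderiv ℝ (feature 𝓗) z (EuclideanSpace.single i 1)

variable {𝓗}

lemma continuous_fieldRep (hΦ : ContDiff ℝ 1 (feature 𝓗 : State n → 𝓗)) (S : PortHamiltonian n m)
    (c : Fin n) : Continuous fun z => fieldRep 𝓗 S z c := by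
  have hJR : Continuous S.JR := S.J_cont.sub S.R_cont
  exact continuous_finsetSum _ fun i _ => (hJR.matrix_elem c i).smul
    ((hΦ.continuous_fderiv one_ne_zero).clm_apply continuous_const)

variable (hΦ : Differentiable ℝ (feature 𝓗 : State n → 𝓗)) (S : PortHamiltonian n m)

include hΦ

lemma gradient_apply_eq_inner (g : 𝓗) (z : State n) (i : Fin n) :
    (∇ (g : State n → ℝ) z) i
      = inner ℝ (fderiv ℝ (feature 𝓗) z (EuclideanSpace.single i 1)) g := by
  have hrep : (g : State n → ℝ) = fun z' => inner ℝ g (feature 𝓗 z') := funext fun z' => by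
    rw [real_inner_comm, inner_feature_left]
  have hgrad : inner ℝ (∇ (g : State n → ℝ) z) (EuclideanSpace.single i 1)
      = fderiv ℝ (g : State n → ℝ) z (EuclideanSpace.single i 1) := by
    rw [gradient, InnerProductSpace.toDual_symm_apply]
  rw [hrep, (hasFDerivAt_inner_right g (hΦ z)).fderiv, ← hrep, ContinuousLinearMap.comp_apply,
    innerSL_apply_apply, real_inner_comm] at hgrad
  rw [real_inner_comm, ← hgrad, EuclideanSpace.inner_single_left, conj_trivial, one_mul]

lemma field_apply (g : 𝓗) (z : State n) (c : Fin n) :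
    S.field (g : State n → ℝ) z c = inner ℝ (fieldRep 𝓗 S z c) g := by
  simp only [PortHamiltonian.field, Matrix.mulVec, dotProduct, fieldRep, sum_inner,
    real_inner_smul_left, ← gradient_apply_eq_inner hΦ]

lemma field_sub (g g' : 𝓗) :
    S.field (⇑(g - g') : State n → ℝ) = S.field (g : State n → ℝ) - S.field (g' : State n → ℝ) := by
  funext z
  ext c
  simp only [Pi.sub_apply, PiLp.sub_apply, field_apply hΦ, inner_sub_right]

lemma mixedHessian_baseKernel (x y : State n) (i j : Fin n) :
    mixedHessian (baseKernel 𝓗) x y i j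
      = inner ℝ (fderiv ℝ (feature 𝓗) x (EuclideanSpace.single i 1))
          (fderiv ℝ (feature 𝓗) y (EuclideanSpace.single j 1)) := by
  have hker : ∀ x' y', baseKernel 𝓗 x' y' = inner ℝ (feature 𝓗 x') (feature 𝓗 y') :=
    fun x' y' => congrFun (innerKernel_feature 𝓗).symm (x', y')
  have hsnd : ∀ x', fderiv ℝ (fun y' => baseKernel 𝓗 x' y') y (EuclideanSpace.single j 1)
      = inner ℝ (fderiv ℝ (feature 𝓗) y (EuclideanSpace.single j 1)) (feature 𝓗 x') := fun x' => by
    simp only [hker]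
    rw [(hasFDerivAt_inner_right (feature 𝓗 x') (hΦ y)).fderiv, ContinuousLinearMap.comp_apply,
      innerSL_apply_apply, real_inner_comm]
  simp only [mixedHessian, Matrix.of_apply, hsnd]
  rw [(hasFDerivAt_inner_right _ (hΦ x)).fderiv, ContinuousLinearMap.comp_apply,
    innerSL_apply_apply, real_inner_comm]

lemma phsKernel_apply (σf : ℝ) (x y : State n) (c c' : Fin n) :
    phsKernel S (baseKernel 𝓗) σf x y c c'
      = σf ^ 2 * inner ℝ (fieldRep 𝓗 S x c) (fieldRep 𝓗 S y c') := by
  simp only [phsKernel, Matrix.smul_apply, smul_eq_mul, Matrix.mul_apply, Matrix.transpose_apply,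
    mixedHessian_baseKernel hΦ, fieldRep, sum_inner, inner_sum, real_inner_smul_left,
    real_inner_smul_right, Finset.sum_mul, Finset.mul_sum]
  exact Finset.sum_congr rfl fun i _ => Finset.sum_congr rfl fun j _ => by ring

lemma trace_phsKernel (σf : ℝ) (z : State n) :
    (phsKernel S (baseKernel 𝓗) σf z z).trace = σf ^ 2 * ∑ c, ‖fieldRep 𝓗 S z c‖ ^ 2 := by
  simp only [Matrix.trace, Matrix.diag_apply, phsKernel_apply hΦ, real_inner_self_eq_norm_sq,
    Finset.mul_sum]

lemma norm_field_sq_le {σf : ℝ} (hσf : 0 < σf) (g : 𝓗) (z : State n) :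
    ‖S.field (g : State n → ℝ) z‖ ^ 2
      ≤ ‖g‖ ^ 2 / σf ^ 2 * (phsKernel S (baseKernel 𝓗) σf z z).trace := by
  rw [trace_phsKernel hΦ, EuclideanSpace.norm_sq_eq, ← mul_assoc,
    div_mul_cancel₀ _ (by positivity), Finset.mul_sum]
  refine Finset.sum_le_sum fun c _ => ?_
  rw [field_apply hΦ, Real.norm_eq_abs, ← mul_pow, mul_comm]
  exact pow_le_pow_left₀ (abs_nonneg _) (abs_real_inner_le_norm _ _) 2

end Representers

section Coefficients

variable {K M n : ℕ} {V : Type*} [AddCommGroup V] [Module ℝ V]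

lemma sum_ite_winNode_smul (k : Fin (K - M)) (a : Fin (M + 1) → ℝ) (v : Fin K → V) :
    ∑ i, (∑ j, if winNode k j = i then a j else 0) • v i = ∑ j, a j • v (winNode k j) := by
  simp only [Finset.sum_smul, ite_smul, zero_smul]
  rw [Finset.sum_comm]
  simp only [Finset.sum_ite_eq, Finset.mem_univ, if_true]

lemma sum_matA_smul (meth : VLMM M) (t : Fin K → ℝ) (k : Fin (K - M)) (v : Fin K → V) :
    ∑ i, matA meth t k i • v i = ∑ j, meth.a (nodeSteps (gridWindow t k)) j • v (winNode k j) :=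
  sum_ite_winNode_smul k _ v

lemma sum_matB_smul (meth : VLMM M) (t : Fin K → ℝ) (k : Fin (K - M)) (v : Fin K → V) :
    ∑ i, matB meth t k i • v i = ∑ j, meth.b (nodeSteps (gridWindow t k)) j • v (winNode k j) :=
  sum_ite_winNode_smul k _ v

lemma sum_kronecker_one_mul {ι κ : Type*} [Fintype κ] (A : Matrix ι κ ℝ) (q : ι × Fin n)
    (f : κ × Fin n → ℝ) :
    ∑ r, (A ⊗ₖ (1 : Matrix (Fin n) (Fin n) ℝ)) q r * f r = ∑ i, A q.1 i * f (i, q.2) := by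
  simp [Fintype.sum_prod_type, Matrix.kroneckerMap_apply, Matrix.one_apply]

end Coefficients

section Estimator

variable {n m K M : ℕ} (𝓗 : Type*) [NormedAddCommGroup 𝓗] [InnerProductSpace ℝ 𝓗]
  [CompleteSpace 𝓗] [RKHS ℝ 𝓗 (State n) ℝ] (S : PortHamiltonian n m) (meth : VLMM M)
  (x : ℝ → State n) (t : Fin K → ℝ)

/-- The representer of component `c` of the multistep combination of the values of a field
`J_R ∇g` on the window `s`. -/
def windowRep (c : Fin n) (s : Fin (M + 1) → ℝ) : 𝓗 :=
  ∑ j, meth.b (nodeSteps s) j • fieldRep 𝓗 S (x (s j)) c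

/-- The representer of row `q` of `g ↦ B_I (J_R ∇g)(X)`. -/
def gridRep (q : Fin (K - M) × Fin n) : 𝓗 := windowRep 𝓗 S meth x q.2 (gridWindow t q.1)

/-- The vector multiplying the measurement error `q` in the normal equations. -/
def noiseRep (q : Fin K × Fin n) : 𝓗 := ∑ k, matA meth t k q.1 • gridRep 𝓗 S meth x t (k, q.2)

variable {𝓗}

lemma gridRep_eq (q : Fin (K - M) × Fin n) :
    gridRep 𝓗 S meth x t q = ∑ i, matB meth t q.1 i • fieldRep 𝓗 S (x (t i)) q.2 :=
  (sum_matB_smul meth t q.1 fun i => fieldRep 𝓗 S (x (t i)) q.2).symm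

lemma sum_noise_smul_gridRep (ε : Fin K × Fin n → ℝ) :
    ∑ q : Fin (K - M) × Fin n, (∑ i, matA meth t q.1 i * ε (i, q.2)) • gridRep 𝓗 S meth x t q
      = ∑ q, ε q • noiseRep 𝓗 S meth x t q := by
  simp only [noiseRep, Fintype.sum_prod_type, Finset.sum_smul, Finset.smul_sum, smul_smul]
  rw [Finset.sum_comm, Finset.sum_comm (γ := Fin K)]
  refine Finset.sum_congr rfl fun c _ => ?_
  rw [Finset.sum_comm]
  simp only [mul_comm]

variable (hΦ : Differentiable ℝ (feature 𝓗 : State n → 𝓗))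

include hΦ

lemma inner_gridRep (q : Fin (K - M) × Fin n) (g : 𝓗) :
    inner ℝ (gridRep 𝓗 S meth x t q) g
      = (∑ i, matB meth t q.1 i • S.field (g : State n → ℝ) (x (t i))) q.2 := by
  simp only [gridRep_eq, sum_inner, real_inner_smul_left, WithLp.ofLp_sum, Finset.sum_apply,
    PiLp.smul_apply, smul_eq_mul, field_apply hΦ]

lemma norm_sum_matB_field_sq (k : Fin (K - M)) (g : 𝓗) :
    ‖∑ i, matB meth t k i • S.field (g : State n → ℝ) (x (t i))‖ ^ 2
      = ∑ c, inner ℝ (gridRep 𝓗 S meth x t (k, c)) g ^ 2 := by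
  simp only [EuclideanSpace.norm_sq_eq, inner_gridRep S meth x t hΦ, Real.norm_eq_abs, sq_abs]

lemma gramY_eq_smul_gram (σf : ℝ) :
    gramY (phsKernel S (baseKernel 𝓗) σf) meth x t
      = σf ^ 2 • Matrix.gram ℝ (gridRep 𝓗 S meth x t) := by
  ext q r
  simp only [gramY, Matrix.mul_apply, Matrix.transpose_apply, matBI, sum_kronecker_one_mul,
    Matrix.of_apply, phsKernel_apply hΦ]
  simp only [mul_comm _ ((matB meth t ⊗ₖ (1 : Matrix (Fin n) (Fin n) ℝ)) r _)]
  rw [sum_kronecker_one_mul (matB meth t) r (fun y => ∑ i, matB meth t q.1 i *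
    (σf ^ 2 * inner ℝ (fieldRep 𝓗 S (x (t i)) q.2) (fieldRep 𝓗 S (x (t y.1)) y.2)))]
  simp only [Matrix.smul_apply, Matrix.gram_apply, gridRep_eq, sum_inner, inner_sum,
    real_inner_smul_left, real_inner_smul_right, Finset.mul_sum, smul_eq_mul]
  exact Finset.sum_congr rfl fun i _ => Finset.sum_congr rfl fun j _ => by ring

lemma crossY_apply (σf : ℝ) (z : State n) (q : Fin (K - M) × Fin n) (c : Fin n) :
    crossY (phsKernel S (baseKernel 𝓗) σf) meth x t z q c
      = σf ^ 2 * inner ℝ (gridRep 𝓗 S meth x t q) (fieldRep 𝓗 S z c) := by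
  simp only [crossY, Matrix.mul_apply, matBI, sum_kronecker_one_mul, Matrix.of_apply,
    phsKernel_apply hΦ, gridRep_eq, sum_inner, real_inner_smul_left, Finset.mul_sum]
  exact Finset.sum_congr rfl fun i _ => by ring

variable (u : ℝ → Fin m → ℝ) (ε : Fin K × Fin n → ℝ)

lemma estimator_eq_field (σf reg : ℝ) :
    estimator S (phsKernel S (baseKernel 𝓗) σf) meth u x reg t ε
      = S.field ⇑(ridgeSolution (σf ^ 2) (((K - M : ℕ) : ℝ) * reg) (gridRep 𝓗 S meth x t)
          (labels S meth u x t ε)) := by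
  funext z
  ext c
  have hweights : (gramY (phsKernel S (baseKernel 𝓗) σf) meth x t
      + (((K - M : ℕ) : ℝ) * reg) • 1)⁻¹ *ᵥ labels S meth u x t ε
      = ridgeWeights (σf ^ 2) (((K - M : ℕ) : ℝ) * reg) (gridRep 𝓗 S meth x t)
          (labels S meth u x t ε) := by
    rw [gramY_eq_smul_gram S meth x t hΦ, ridgeWeights]
  rw [field_apply hΦ, estimator, hweights]
  simp only [ridgeSolution, Matrix.mulVec, dotProduct, Matrix.transpose_apply,
    crossY_apply S meth x t hΦ, real_inner_smul_right, inner_sum, Finset.mul_sum]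
  exact Finset.sum_congr rfl fun q _ => by rw [real_inner_comm]; ring

variable {S t x u} in
lemma labels_eq {g₀ : 𝓗} (hg₀ : (g₀ : State n → ℝ) = S.H) (hx : S.IsTrajectory u x)
    (ht : ∀ i, 0 ≤ t i) (q : Fin (K - M) × Fin n) :
    labels S meth u x t ε q = inner ℝ (gridRep 𝓗 S meth x t q) g₀
      + meth.truncationError x (derivWithin x (Set.Ici 0)) (gridWindow t q.1) q.2
      + ∑ i, matA meth t q.1 i * ε (i, q.2) := by
  have hder : ∀ s, 0 ≤ s → derivWithin x (Set.Ici 0) s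
      = S.field (g₀ : State n → ℝ) (x s) + S.port (x s) (u s) := fun s hs => by
    rw [(hx s hs).derivWithin (uniqueDiffOn_Ici 0 s hs), hg₀]; rfl
  have htrunc : meth.truncationError x (derivWithin x (Set.Ici 0)) (gridWindow t q.1)
      = ∑ i, matA meth t q.1 i • x (t i)
        - ∑ i, matB meth t q.1 i • derivWithin x (Set.Ici 0) (t i) := by
    rw [sum_matA_smul, sum_matB_smul]; rfl
  rw [htrunc, inner_gridRep S meth x t hΦ]
  simp only [hder _ (ht _), labels, Pi.sub_apply, Matrix.mulVec, dotProduct, matAI, matBI,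
    sum_kronecker_one_mul, PiLp.sub_apply, WithLp.ofLp_sum, Finset.sum_apply, PiLp.smul_apply,
    PiLp.add_apply, smul_eq_mul, mul_add, Finset.sum_add_distrib]
  ring

end Estimator

/-! ### Empirical averages over the windows of a grid -/

section WindowAverages

variable {K M : ℕ} {Ω : Type*} [MeasurableSpace Ω] {P : Measure Ω} {t : Fin K → Ω → ℝ}
  {F : Type*} [NormedAddCommGroup F] {G : (Fin (M + 1) → ℝ) → F} {b : ℝ}

lemma integrable_comp_gridWindow [IsFiniteMeasure P] (htm : ∀ i, Measurable (t i))
    (hGm : StronglyMeasurable G) (hG : ∀ s, ‖G s‖ ≤ b) (k : Fin (K - M)) :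
    Integrable (fun w => G (gridWindow (fun i => t i w) k)) P :=
  .of_bound (hGm.comp_measurable (measurable_pi_lambda _ fun _ => htm _)).aestronglyMeasurable b
    (.of_forall fun _ => hG _)

variable [NormedSpace ℝ F]

/-- The average over the windows of the grid `t` of a function `G` of the nodes of a window. -/
def windowAvg (G : (Fin (M + 1) → ℝ) → F) (t : Fin K → ℝ) : F :=
  ((K - M : ℕ) : ℝ)⁻¹ • ∑ k : Fin (K - M), G (gridWindow t k)

lemma norm_windowAvg_le (hG : ∀ s, ‖G s‖ ≤ b) (t : Fin K → ℝ) : ‖windowAvg G t‖ ≤ b := by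
  have hb : 0 ≤ b := (norm_nonneg _).trans (hG 0)
  have hsum : ‖∑ k : Fin (K - M), G (gridWindow t k)‖ ≤ (K - M : ℕ) * b :=
    (norm_sum_le_of_le _ fun k _ => hG (gridWindow t k)).trans_eq (by simp)
  rw [windowAvg, norm_smul, norm_inv, Real.norm_natCast]
  calc ((K - M : ℕ) : ℝ)⁻¹ * ‖∑ k : Fin (K - M), G (gridWindow t k)‖
      ≤ ((K - M : ℕ) : ℝ)⁻¹ * ((K - M : ℕ) * b) := by gcongr
    _ ≤ b := by
        rw [← mul_assoc]
        exact mul_le_of_le_one_left hb inv_mul_le_one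

lemma integral_windowAvg [IsFiniteMeasure P] (htm : ∀ i, Measurable (t i))
    (hGm : StronglyMeasurable G) (hG : ∀ s, ‖G s‖ ≤ b) :
    ∫ w, windowAvg G (fun i => t i w) ∂P
      = ((K - M : ℕ) : ℝ)⁻¹ • ∑ k : Fin (K - M), ∫ w, G (gridWindow (fun i => t i w) k) ∂P := by
  simp only [windowAvg]
  rw [integral_smul, integral_finsetSum _ fun k _ => integrable_comp_gridWindow htm hGm hG k]

/-- The deviation of a window average over random sampling times from its mean. -/
def windowDeviation (P : Measure Ω) (t : Fin K → Ω → ℝ) (G : (Fin (M + 1) → ℝ) → F) (w : Ω) : F :=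
  windowAvg G (fun i => t i w) - ∫ w', windowAvg G (fun i => t i w') ∂P

lemma norm_windowDeviation_le [IsProbabilityMeasure P] (hG : ∀ s, ‖G s‖ ≤ b) (w : Ω) :
    ‖windowDeviation P t G w‖ ≤ 2 * b := by
  have hmean : ‖∫ w', windowAvg G (fun i => t i w') ∂P‖ ≤ b := by
    simpa using norm_integral_le_of_norm_le_const (μ := P)
      (.of_forall fun w' => norm_windowAvg_le hG fun i => t i w')
  calc ‖windowDeviation P t G w‖ ≤ b + b :=
        (norm_sub_le _ _).trans (add_le_add (norm_windowAvg_le hG _) hmean)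
    _ = 2 * b := (two_mul b).symm

end WindowAverages

section SquareTensor

open scoped TensorProduct

variable {V : Type*} [NormedAddCommGroup V] [InnerProductSpace ℝ V]

/-- The rank one element `v ⊗ v` of the Hilbert space tensor square, through which the quadratic
form `g ↦ ⟪v, g⟫ ^ 2` becomes the inner product with a vector. -/
def squareTensor (v : V) : UniformSpace.Completion (V ⊗[ℝ] V) := ((v ⊗ₜ[ℝ] v : V ⊗[ℝ] V) :)

lemma inner_squareTensor (v w : V) :
    inner ℝ (squareTensor v) (squareTensor w) = inner ℝ v w ^ 2 := by
  rw [squareTensor, squareTensor, UniformSpace.Completion.inner_coe, TensorProduct.inner_tmul, sq]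

lemma norm_squareTensor (v : V) : ‖squareTensor v‖ = ‖v‖ ^ 2 := by
  rw [squareTensor, UniformSpace.Completion.norm_coe, TensorProduct.norm_tmul, sq]

lemma continuous_squareTensor : Continuous (squareTensor : V → _) :=
  (UniformSpace.Completion.continuous_coe _).comp
    (TensorProduct.continuous_tmul.comp (continuous_id.prodMk continuous_id))

end SquareTensor

section WindowFunctionals

lemma stronglyMeasurable_indicator_of_continuousOn {α β : Type*} [MeasurableSpace α]
    [TopologicalSpace α] [OpensMeasurableSpace α] [SecondCountableTopology α] [TopologicalSpace β]
    [TopologicalSpace.PseudoMetrizableSpace β] [Zero β] {f : α → β} {s : Set α}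
    (hf : ContinuousOn f s) (hs : MeasurableSet s) : StronglyMeasurable (s.indicator f) := by
  refine stronglyMeasurable_of_stronglyMeasurable_union_cover s sᶜ hs hs.compl
    (Set.union_compl_self s).ge ?_ ?_
  · have hrestrict : (fun a : s => s.indicator f a) = s.domRestrict f :=
      funext fun a => Set.indicator_of_mem a.2 f
    rw [hrestrict]
    exact (continuousOn_iff_continuous_domRestrict.1 hf).stronglyMeasurable
  · have hzero : (fun a : (sᶜ : Set α) => s.indicator f a) = fun _ => 0 :=
      funext fun a => Set.indicator_of_notMem a.2 f
    rw [hzero]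
    exact stronglyMeasurable_const

variable {n m K M : ℕ} {𝓗 : Type*} [NormedAddCommGroup 𝓗] [InnerProductSpace ℝ 𝓗]
  [CompleteSpace 𝓗] [RKHS ℝ 𝓗 (State n) ℝ] {S : PortHamiltonian n m} {meth : VLMM M}
  {x : ℝ → State n} {hmax ω : ℝ}

lemma continuousOn_windowRep (hΦ : ContDiff ℝ 1 (feature 𝓗)) (hx : ContinuousOn x (Set.Ici 0))
    (c : Fin n) :
    ContinuousOn (windowRep 𝓗 S meth x c) (admissibleSet (M + 1) hmax ω) :=
  continuousOn_finsetSum _ fun j _ => (meth.continuousOn_b j).smul <|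
    (continuous_fieldRep hΦ S c).comp_continuousOn <|
      hx.comp (continuous_apply j).continuousOn fun _ hs => AdmissibleGrid.nonneg hs j

lemma continuous_gridWindow (k : Fin (K - M)) :
    Continuous fun t : Fin K → ℝ => gridWindow t k :=
  continuous_pi fun _ => continuous_apply _

lemma mapsTo_gridWindow (k : Fin (K - M)) :
    Set.MapsTo (fun t : Fin K → ℝ => gridWindow t k) (admissibleSet K hmax ω)
      (admissibleSet (M + 1) hmax ω) :=
  fun _ ht => AdmissibleGrid.gridWindow ht k

lemma continuousOn_noiseRep (hΦ : ContDiff ℝ 1 (feature 𝓗)) (hx : ContinuousOn x (Set.Ici 0))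
    (q : Fin K × Fin n) :
    ContinuousOn (fun t => noiseRep 𝓗 S meth x t q) (admissibleSet K hmax ω) := by
  refine continuousOn_finsetSum _ fun k _ => ContinuousOn.smul ?_ ?_
  · simp only [matA, Matrix.of_apply]
    refine continuousOn_finsetSum _ fun j _ => ?_
    split_ifs
    · exact (meth.continuousOn_a j).comp (continuous_gridWindow k).continuousOn
        (mapsTo_gridWindow k)
    · exact continuousOn_const
  · exact (continuousOn_windowRep hΦ hx q.2).comp (continuous_gridWindow k).continuousOn
      (mapsTo_gridWindow k)

lemma winNode_left_injective (j : Fin (M + 1)) :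
    Function.Injective fun k : Fin (K - M) => winNode k j := fun _ _ h =>
  Fin.ext (Nat.add_right_cancel (congrArg Fin.val h))

lemma sum_abs_matA_le {t : Fin K → ℝ} {C : ℝ} (hC : 0 ≤ C)
    (ha : ∀ (k : Fin (K - M)) j, |meth.a (winSteps t k) j| ≤ C) (i : Fin K) :
    ∑ k, |matA meth t k i| ≤ (M + 1) * C := by
  have hentry (k : Fin (K - M)) :
      |matA meth t k i| ≤ ∑ j : Fin (M + 1), if winNode k j = i then C else 0 := by
    rw [matA, Matrix.of_apply]
    refine (Finset.abs_sum_le_sum_abs _ _).trans (Finset.sum_le_sum fun j _ => ?_)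
    split_ifs
    · exact ha k j
    · exact abs_zero.le
  have hcount (j : Fin (M + 1)) :
      ∑ k : Fin (K - M), (if winNode k j = i then C else 0) ≤ C := by
    rw [← Finset.sum_filter, Finset.sum_const, nsmul_eq_mul]
    refine mul_le_of_le_one_left hC (mod_cast Finset.card_le_one.2 fun k hk l hl => ?_)
    exact winNode_left_injective j
      ((Finset.mem_filter.1 hk).2.trans (Finset.mem_filter.1 hl).2.symm)
  calc ∑ k, |matA meth t k i|
      ≤ ∑ j : Fin (M + 1), ∑ k : Fin (K - M), (if winNode k j = i then C else 0) :=
        (Finset.sum_le_sum fun k _ => hentry k).trans_eq Finset.sum_comm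
    _ ≤ ∑ _j : Fin (M + 1), C := Finset.sum_le_sum fun j _ => hcount j
    _ = (M + 1) * C := by simp

/-- The sum over components of the squares of the representers of a window, set to `0` on windows
that are not admissible. Its averages represent the empirical sampling norm. -/
def windowCov (𝓗 : Type*) [NormedAddCommGroup 𝓗] [InnerProductSpace ℝ 𝓗] [CompleteSpace 𝓗]
    [RKHS ℝ 𝓗 (State n) ℝ] (S : PortHamiltonian n m) (meth : VLMM M) (x : ℝ → State n)
    (hmax ω : ℝ) : (Fin (M + 1) → ℝ) → UniformSpace.Completion (TensorProduct ℝ 𝓗 𝓗) :=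
  (admissibleSet (M + 1) hmax ω).indicator fun s => ∑ c, squareTensor (windowRep 𝓗 S meth x c s)

lemma stronglyMeasurable_windowCov (hΦ : ContDiff ℝ 1 (feature 𝓗))
    (hx : ContinuousOn x (Set.Ici 0)) :
    StronglyMeasurable (windowCov 𝓗 S meth x hmax ω) :=
  stronglyMeasurable_indicator_of_continuousOn
    (continuousOn_finsetSum _ fun c _ =>
      continuous_squareTensor.comp_continuousOn (continuousOn_windowRep hΦ hx c))
    (measurableSet_admissibleSet _ _ _)

lemma inner_windowCov {s : Fin (M + 1) → ℝ} (hs : AdmissibleGrid hmax ω s) (g : 𝓗) :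
    inner ℝ (windowCov 𝓗 S meth x hmax ω s) (squareTensor g)
      = ∑ c, inner ℝ (windowRep 𝓗 S meth x c s) g ^ 2 := by
  rw [windowCov, Set.indicator_of_mem (show s ∈ admissibleSet (M + 1) hmax ω from hs), sum_inner]
  simp only [inner_squareTensor]

/-- The power `h ^ r` of the first step of a window, set to `0` on windows that are not
admissible. -/
def windowStepPow (M : ℕ) [NeZero M] (hmax ω : ℝ) (r : ℕ) : (Fin (M + 1) → ℝ) → ℝ :=
  (admissibleSet (M + 1) hmax ω).indicator fun s => nodeSteps s 0 ^ r

lemma stronglyMeasurable_windowStepPow [NeZero M] (r : ℕ) :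
    StronglyMeasurable (windowStepPow M hmax ω r) :=
  stronglyMeasurable_indicator_of_continuousOn
    (((continuous_apply 0).comp continuous_nodeSteps).pow r).continuousOn
    (measurableSet_admissibleSet _ _ _)

lemma windowStepPow_of_admissible [NeZero M] {s : Fin (M + 1) → ℝ}
    (hs : AdmissibleGrid hmax ω s) (r : ℕ) : windowStepPow M hmax ω r s = nodeSteps s 0 ^ r :=
  Set.indicator_of_mem (show s ∈ admissibleSet (M + 1) hmax ω from hs) _

end WindowFunctionals

section UniformBounds

variable {n m K M p : ℕ} {𝓗 : Type*} [NormedAddCommGroup 𝓗] [InnerProductSpace ℝ 𝓗]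
  [CompleteSpace 𝓗] [RKHS ℝ 𝓗 (State n) ℝ] {S : PortHamiltonian n m} {meth : VLMM M}
  {x : ℝ → State n} {hmax ω : ℝ}

lemma norm_indicator_admissibleSet_le {F : Type*} [NormedAddCommGroup F] {f : (Fin K → ℝ) → F}
    {b : ℝ} (hb : 0 ≤ b) (hf : ∀ t, AdmissibleGrid hmax ω t → ‖f t‖ ≤ b) (t : Fin K → ℝ) :
    ‖(admissibleSet K hmax ω).indicator f t‖ ≤ b := by
  by_cases ht : t ∈ admissibleSet K hmax ω
  · exact (Set.indicator_of_mem ht f).symm ▸ hf t ht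
  · exact (Set.indicator_of_notMem ht f).symm ▸ norm_zero.trans_le hb

lemma norm_windowCov_le {B : ℝ} (hB : ∀ s, AdmissibleGrid hmax ω s → ∀ c,
      ‖windowRep 𝓗 S meth x c s‖ ≤ B) (s : Fin (M + 1) → ℝ) :
    ‖windowCov 𝓗 S meth x hmax ω s‖ ≤ n * B ^ 2 := by
  refine norm_indicator_admissibleSet_le (by positivity) (fun s hs => ?_) s
  refine (norm_sum_le_of_le _ (n := fun _ => B ^ 2) fun c _ => ?_).trans (by simp)
  rw [norm_squareTensor]
  exact pow_le_pow_left₀ (norm_nonneg _) (hB s hs c) 2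

lemma norm_windowStepPow_le [NeZero M] (r : ℕ) (s : Fin (M + 1) → ℝ) :
    ‖windowStepPow M hmax ω r s‖ ≤ |hmax| ^ r := by
  refine norm_indicator_admissibleSet_le (by positivity) (fun s hs => ?_) s
  rw [norm_pow, Real.norm_of_nonneg (hs.nodeSteps_pos 0).le]
  exact pow_le_pow_left₀ (hs.nodeSteps_pos 0).le ((hs.nodeSteps_le 0).trans (le_abs_self _)) r

lemma norm_fieldRep_le (hΦ : Differentiable ℝ (feature 𝓗)) {σf κ : ℝ} (hσf : 0 < σf)
    {z : State n} (hκ : (phsKernel S (baseKernel 𝓗) σf z z).trace ≤ κ ^ 2) (c : Fin n) :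
    ‖fieldRep 𝓗 S z c‖ ≤ |κ| / σf := by
  rw [trace_phsKernel hΦ] at hκ
  have hc : ‖fieldRep 𝓗 S z c‖ ^ 2 ≤ ∑ c, ‖fieldRep 𝓗 S z c‖ ^ 2 :=
    Finset.single_le_sum (f := fun c => ‖fieldRep 𝓗 S z c‖ ^ 2)
      (fun _ _ => sq_nonneg _) (Finset.mem_univ c)
  refine le_of_sq_le_sq ?_ (by positivity)
  rw [div_pow, sq_abs, le_div_iff₀ (by positivity), mul_comm]
  exact (mul_le_mul_of_nonneg_left hc (sq_nonneg σf)).trans hκ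

lemma norm_noiseRep_le {C B : ℝ} (hC : 0 ≤ C) (hB : 0 ≤ B) {t : Fin K → ℝ}
    (ha : ∀ (k : Fin (K - M)) j, |meth.a (winSteps t k) j| ≤ C)
    (hφ : ∀ (k : Fin (K - M)) c, ‖windowRep 𝓗 S meth x c (gridWindow t k)‖ ≤ B)
    (q : Fin K × Fin n) : ‖noiseRep 𝓗 S meth x t q‖ ≤ (M + 1) * C * B := by
  have hterm (k : Fin (K - M)) (_ : k ∈ Finset.univ) :
      ‖matA meth t k q.1 • gridRep 𝓗 S meth x t (k, q.2)‖ ≤ |matA meth t k q.1| * B := by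
    rw [norm_smul, Real.norm_eq_abs]
    exact mul_le_mul_of_nonneg_left (hφ k q.2) (abs_nonneg _)
  refine (norm_sum_le_of_le _ hterm).trans ?_
  rw [← Finset.sum_mul]
  exact mul_le_mul_of_nonneg_right (sum_abs_matA_le hC ha q.1) hB

variable [NeZero M]

lemma norm_windowRep_le {C κ : ℝ} (hC : 0 ≤ C) {s : Fin (M + 1) → ℝ}
    (hs : AdmissibleGrid hmax ω s) (hb : ∀ j, |meth.b (nodeSteps s) j| ≤ C * nodeSteps s 0)
    (hκ : ∀ t, 0 ≤ t → ∀ c, ‖fieldRep 𝓗 S (x t) c‖ ≤ κ) (c : Fin n) :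
    ‖windowRep 𝓗 S meth x c s‖ ≤ (M + 1) * (C * |hmax| * κ) := by
  refine (norm_sum_le_of_le _ (n := fun _ => C * |hmax| * κ) fun j _ => ?_).trans (by simp)
  rw [norm_smul, Real.norm_eq_abs]
  refine mul_le_mul ((hb j).trans ?_) (hκ _ (hs.nonneg j) c) (norm_nonneg _) (by positivity)
  exact mul_le_mul_of_nonneg_left ((hs.nodeSteps_le 0).trans (le_abs_self _)) hC

/-- The constant `b` bounds, uniformly over all admissible grids, the quantities that govern the
error of the estimator: the fluctuating terms, and the truncation error relative to its order. -/
structure IsUniformBound (𝓗 : Type*) [NormedAddCommGroup 𝓗] [InnerProductSpace ℝ 𝓗]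
    [CompleteSpace 𝓗] [RKHS ℝ 𝓗 (State n) ℝ] (S : PortHamiltonian n m) (meth : VLMM M)
    (x : ℝ → State n) (p : ℕ) (hmax ω b : ℝ) : Prop where
  pos : 0 < b
  noiseRep_le : ∀ {K : ℕ} {t : Fin K → ℝ}, AdmissibleGrid hmax ω t → ∀ q,
    ‖noiseRep 𝓗 S meth x t q‖ ≤ b
  windowCov_le : ∀ s, ‖windowCov 𝓗 S meth x hmax ω s‖ ≤ b
  windowStepPow_le : ∀ s, ‖windowStepPow M hmax ω (2 * p + 2) s‖ ≤ b
  truncationError_le : ∀ {s}, AdmissibleGrid hmax ω s →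
    ‖meth.truncationError x (derivWithin x (Set.Ici 0)) s‖ ^ 2
      ≤ b * windowStepPow M hmax ω (2 * p + 2) s

lemma exists_isUniformBound (hΦ : Differentiable ℝ (feature 𝓗))
    (hx : ContDiffOn ℝ ((p + 1 : ℕ) : WithTop ℕ∞) x (Set.Ici 0)) {D : ℝ}
    (hD : ∀ t, 0 ≤ t → ‖iteratedDerivWithin (p + 1) x (Set.Ici 0) t‖ ≤ D) {σf κ : ℝ}
    (hσf : 0 < σf)
    (hκ : ∀ t, 0 ≤ t → (phsKernel S (baseKernel 𝓗) σf (x t) (x t)).trace ≤ κ ^ 2)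
    (hp : meth.HasOrder p) (hmax ω : ℝ) :
    ∃ b, IsUniformBound 𝓗 S meth x p hmax ω b := by
  obtain ⟨C, hC0, hC⟩ := meth.exists_coeff_bound hmax ω
  obtain ⟨Cτ, hCτ⟩ := VLMM.exists_truncationError_le hp hmax ω hx hD
  obtain ⟨B, hB⟩ : ∃ B : ℝ, B = (M + 1) * (C * |hmax| * (|κ| / σf)) := ⟨_, rfl⟩
  have hB0 : 0 ≤ B := by rw [hB]; positivity
  have hrep : ∀ s, AdmissibleGrid hmax ω s → ∀ c, ‖windowRep 𝓗 S meth x c s‖ ≤ B :=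
    fun s hs c => hB ▸ norm_windowRep_le hC0.le hs (fun j => (hC s hs j).2)
      (fun t ht => norm_fieldRep_le hΦ hσf (hκ t ht)) c
  have hnoise : 0 ≤ (M + 1) * C * B := by positivity
  have hcov : 0 ≤ n * B ^ 2 := by positivity
  have hstep : 0 ≤ |hmax| ^ (2 * p + 2) := by positivity
  refine ⟨(M + 1) * C * B + n * B ^ 2 + |hmax| ^ (2 * p + 2) + Cτ ^ 2 + 1, by positivity,
    fun ht q => ?_, fun s => ?_, fun s => ?_, fun {s} hs => ?_⟩
  · have := norm_noiseRep_le hC0.le hB0 (fun k j => (hC _ (ht.gridWindow k) j).1)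
      (fun k c => hrep _ (ht.gridWindow k) c) q
    linarith [sq_nonneg Cτ]
  · linarith [norm_windowCov_le hrep s, sq_nonneg Cτ]
  · linarith [norm_windowStepPow_le (hmax := hmax) (ω := ω) (2 * p + 2) s, sq_nonneg Cτ]
  · rw [windowStepPow_of_admissible hs]
    calc ‖meth.truncationError x (derivWithin x (Set.Ici 0)) s‖ ^ 2
        ≤ (Cτ * nodeSteps s 0 ^ (p + 1)) ^ 2 := pow_le_pow_left₀ (norm_nonneg _) (hCτ s hs) 2
      _ = Cτ ^ 2 * nodeSteps s 0 ^ (2 * p + 2) := by ring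
      _ ≤ _ := mul_le_mul_of_nonneg_right (by linarith)
          (pow_nonneg (hs.nodeSteps_pos 0).le _)

end UniformBounds

/-! ### Concentration of the noise and of the window averages -/

section Tails

variable {Ω : Type*} [MeasurableSpace Ω] {P : Measure Ω} {η : ℝ}

lemma lintegral_comp_le_of_indepFun [IsProbabilityMeasure P] {α β : Type*} [MeasurableSpace α]
    [MeasurableSpace β] {X : Ω → α} {Y : Ω → β} (hX : AEMeasurable X P) (hY : AEMeasurable Y P)
    (hXY : IndepFun X Y P) {F : α × β → ℝ≥0∞} (hF : Measurable F) {C : ℝ≥0∞}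
    (h : ∀ a, ∫⁻ w, F (a, Y w) ∂P ≤ C) : ∫⁻ w, F (X w, Y w) ∂P ≤ C := by
  have : IsProbabilityMeasure (P.map X) := Measure.isProbabilityMeasure_map hX
  have : IsProbabilityMeasure (P.map Y) := Measure.isProbabilityMeasure_map hY
  calc ∫⁻ w, F (X w, Y w) ∂P
      = ∫⁻ z, F z ∂(P.map fun w => (X w, Y w)) :=
        (lintegral_map' hF.aemeasurable (hX.prodMk hY)).symm
    _ = ∫⁻ a, ∫⁻ y, F (a, y) ∂(P.map Y) ∂(P.map X) := by
        rw [(indepFun_iff_map_prod_eq_prod_map_map hX hY).1 hXY, lintegral_prod _ hF.aemeasurable]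
    _ ≤ ∫⁻ _, C ∂(P.map X) := lintegral_mono fun a => by
        rw [lintegral_map' (f := fun y => F (a, y)) (by fun_prop) hY]
        exact h a
    _ = C := by simp

lemma one_le_log_four_div (hη : 0 < η) (hη1 : η ≤ 1) : 1 ≤ Real.log (4 / η) := by
  rw [Real.le_log_iff_exp_le (by positivity), le_div_iff₀ hη]
  nlinarith [Real.exp_one_lt_d9]

lemma log_div_third_le {C : ℝ} (hC : 1 ≤ C) (hη : 0 < η) (hη1 : η ≤ 1) :
    Real.log (C / (η / 3)) ≤ (1 + Real.log C) * Real.log (4 / η) := by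
  calc Real.log (C / (η / 3)) ≤ Real.log (C * (4 / η)) := by
        refine Real.log_le_log (by positivity) ?_
        rw [div_div_eq_mul_div, ← mul_div_assoc]
        gcongr
        norm_num
    _ = Real.log C + Real.log (4 / η) := Real.log_mul (by positivity) (by positivity)
    _ ≤ _ := by nlinarith [Real.log_nonneg hC, one_le_log_four_div hη hη1]

lemma measure_lt_norm_inv_smul_sq_le {F : Type*} [NormedAddCommGroup F] [NormedSpace ℝ F]
    {Y : Ω → F} (hY : AEStronglyMeasurable Y P) {C V c ℓ : ℝ} (hC : 1 ≤ C) (hV : 0 < V)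
    (hℓ : 0 < ℓ) (hc : (1 + Real.log C) * V ≤ c * ℓ)
    (h : ∫⁻ w, ENNReal.ofReal (Real.exp (‖Y w‖ ^ 2 / V)) ∂P ≤ ENNReal.ofReal C)
    (hη : 0 < η) (hη1 : η ≤ 1) :
    P {w | c * Real.log (4 / η) / ℓ < ‖ℓ⁻¹ • Y w‖ ^ 2} ≤ ENNReal.ofReal (η / 3) := by
  refine (measure_mono fun w hw => ?_).trans (measure_log_div_lt_le
    ((hY.norm.aemeasurable.pow_const 2).div_const V) (by positivity) (by positivity) h)
  have hΛ := one_le_log_four_div hη hη1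
  have hw' : c * Real.log (4 / η) / ℓ < ‖Y w‖ ^ 2 / ℓ ^ 2 := by
    simpa [norm_smul, inv_mul_eq_div, div_pow] using hw
  refine (log_div_third_le hC hη hη1).trans_lt ((lt_div_iff₀ hV).2 ?_)
  calc (1 + Real.log C) * Real.log (4 / η) * V
      = (1 + Real.log C) * V * Real.log (4 / η) := by ring
    _ ≤ c * ℓ * Real.log (4 / η) := by gcongr
    _ = c * Real.log (4 / η) / ℓ * ℓ ^ 2 := by field_simp
    _ < ‖Y w‖ ^ 2 := (lt_div_iff₀ (by positivity)).1 hw'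

end Tails

section Noise

variable {n K : ℕ} {Ω : Type*} [MeasurableSpace Ω] {P : Measure Ω}
  {hmax ω : ℝ} {σx2 : ℝ≥0} {t : Fin K → Ω → ℝ} {ε : Fin K × Fin n → Ω → ℝ}

lemma IsSample.aemeasurable (h : IsSample P hmax ω σx2 t ε) (a : Fin K ⊕ (Fin K × Fin n)) :
    AEMeasurable (Sum.elim t ε a) P := by
  cases a with
  | inl i => exact (h.measurable_t i).aemeasurable
  | inr q => exact (h.gaussian q).aemeasurable

lemma IsSample.iIndepFun_times (h : IsSample P hmax ω σx2 t ε) : iIndepFun t P :=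
  h.indep.precomp (g := Sum.inl) Sum.inl_injective

lemma IsSample.iIndepFun_noise (h : IsSample P hmax ω σx2 t ε) : iIndepFun ε P :=
  h.indep.precomp (g := Sum.inr) Sum.inr_injective

lemma IsSample.indepFun_times_noise (h : IsSample P hmax ω σx2 t ε) :
    IndepFun (fun w i => t i w) (fun w q => ε q w) P := by
  classical
  let times : Finset (Fin K ⊕ (Fin K × Fin n)) := Finset.univ.map .inl
  let noise : Finset (Fin K ⊕ (Fin K × Fin n)) := Finset.univ.map .inr
  have hdisj : Disjoint times noise := by
    simp [times, noise, Finset.disjoint_left]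
  exact (h.indep.indepFun_finset₀ times noise hdisj h.aemeasurable).comp
    (φ := fun y i => y ⟨Sum.inl i, by simp [times]⟩)
    (ψ := fun y q => y ⟨Sum.inr q, by simp [noise]⟩)
    (measurable_pi_lambda _ fun i => measurable_pi_apply _)
    (measurable_pi_lambda _ fun q => measurable_pi_apply _)

lemma IsSample.lintegral_exp_norm_noise_sum_sq_le [IsProbabilityMeasure P] {F : Type*}
    [NormedAddCommGroup F] [InnerProductSpace ℝ F] (h : IsSample P hmax ω σx2 t ε)
    {U : Fin K × Fin n → (Fin K → ℝ) → F} (hU : ∀ q, StronglyMeasurable (U q)) {b v N : ℝ}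
    (hUb : ∀ q τ, ‖U q τ‖ ≤ b) (hv : 0 < v) (hbv : 2 * σx2 * b ^ 2 ≤ v) (hN : 1 ≤ N)
    (hKN : (K : ℝ) * n ≤ N) :
    ∫⁻ w, ENNReal.ofReal (Real.exp (‖∑ q, ε q w • U q (fun i => t i w)‖ ^ 2 / (2 * v * N))) ∂P
      ≤ ENNReal.ofReal (Real.exp 1) := by
  have hsum : StronglyMeasurable fun z : (Fin K → ℝ) × (Fin K × Fin n → ℝ) =>
      ∑ q, z.2 q • U q z.1 :=
    Finset.stronglyMeasurable_fun_sum _ fun q _ =>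
      ((measurable_pi_apply q).comp measurable_snd).stronglyMeasurable.smul
        ((hU q).comp_measurable measurable_fst)
  have hfixed (τ : Fin K → ℝ) :
      ∫⁻ w, ENNReal.ofReal (Real.exp (‖∑ q, ε q w • U q τ‖ ^ 2 / (2 * v * N))) ∂P
        ≤ ENNReal.ofReal (Real.exp 1) := by
    refine lintegral_exp_norm_sum_sq_le (β := fun _ => ℝ) (Z := ε) (f := fun q e => e • U q τ)
      (fun q => (h.gaussian q).aemeasurable) h.iIndepFun_noise
      (fun q => stronglyMeasurable_id.smul_const _) hv hN (by simpa using hKN) fun q _ =>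
      hasSquareExpBound_gaussian_smul (h.gaussian q) hv (le_trans ?_ hbv)
    have := pow_le_pow_left₀ (norm_nonneg _) (hUb q τ) 2
    gcongr
  exact lintegral_comp_le_of_indepFun
    (F := fun z => ENNReal.ofReal (Real.exp (‖∑ q, z.2 q • U q z.1‖ ^ 2 / (2 * v * N))))
    (aemeasurable_pi_lambda _ fun i => (h.measurable_t i).aemeasurable)
    (aemeasurable_pi_lambda _ fun q => (h.gaussian q).aemeasurable) h.indepFun_times_noise
    ((hsum.norm.measurable.pow_const 2).div_const _).exp.ennreal_ofReal hfixed

end Noise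

lemma natCast_sub_pos {K M : ℕ} (hKM : M < K) : (0 : ℝ) < (K - M : ℕ) :=
  Nat.cast_pos.2 (Nat.sub_pos_of_lt hKM)

lemma natCast_le_succ_mul_sub {K M : ℕ} (hKM : M < K) :
    (K : ℝ) ≤ (M + 1) * ((K - M : ℕ) : ℝ) := by
  have h1 : (1 : ℝ) ≤ (K - M : ℕ) := Nat.one_le_cast.2 (Nat.sub_pos_of_lt hKM)
  have h2 : (K : ℝ) = (K - M : ℕ) + M := mod_cast (Nat.sub_add_cancel hKM.le).symm
  nlinarith [Nat.cast_nonneg (α := ℝ) M]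

/-- The constant in the concentration of the noise and of the window averages around their means,
for terms bounded by `b`. -/
def tailConst (M n : ℕ) (σx2 : ℝ≥0) (b : ℝ) : ℝ :=
  (1 + Real.log ((M + 1) * Real.exp 1)) *
    (16 * b ^ 2 * (M + 1) ^ 2 + 2 * (2 * σx2 * b ^ 2 + 1) * ((M + 1) * (n + 1)))

section Concentration

variable {n m K M : ℕ} {Ω : Type*} [MeasurableSpace Ω] {P : Measure Ω} [IsProbabilityMeasure P]
  {hmax ω b η : ℝ} {σx2 : ℝ≥0} {t : Fin K → Ω → ℝ}

lemma exp_one_le_succ_mul_exp_one (M : ℕ) : Real.exp 1 ≤ (M + 1) * Real.exp 1 :=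
  le_mul_of_one_le_left (Real.exp_pos 1).le (by simp)

lemma one_le_succ_mul_exp_one (M : ℕ) : 1 ≤ (M + 1) * Real.exp 1 :=
  (Real.one_le_exp zero_le_one).trans (exp_one_le_succ_mul_exp_one M)

lemma tailConst_pos (M n : ℕ) (σx2 : ℝ≥0) (b : ℝ) : 0 < tailConst M n σx2 b := by
  have := Real.log_nonneg (one_le_succ_mul_exp_one M)
  unfold tailConst
  positivity

lemma measure_windowDeviation_le {F : Type*} [NormedAddCommGroup F] [InnerProductSpace ℝ F]
    [CompleteSpace F] {G : (Fin (M + 1) → ℝ) → F} (hKM : M < K) (htm : ∀ i, Measurable (t i))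
    (ht : iIndepFun t P) (hGm : StronglyMeasurable G) (hb : 0 < b) (hG : ∀ s, ‖G s‖ ≤ b)
    (n : ℕ) (σx2 : ℝ≥0) (hη : 0 < η) (hη1 : η ≤ 1) :
    P {w | tailConst M n σx2 b * Real.log (4 / η) / (K - M : ℕ) < ‖windowDeviation P t G w‖ ^ 2}
      ≤ ENNReal.ofReal (η / 3) := by
  have hℓ := natCast_sub_pos hKM
  have hdev (w : Ω) : windowDeviation P t G w = ((K - M : ℕ) : ℝ)⁻¹ • ∑ k : Fin (K - M),
      (G (fun j => t (winNode k j) w) - ∫ w', G (fun j => t (winNode k j) w') ∂P) := by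
    rw [windowDeviation, integral_windowAvg htm hGm hG, windowAvg, ← smul_sub,
      ← Finset.sum_sub_distrib]
    rfl
  have hwindow (k : Fin (K - M)) : Measurable fun w j => t (winNode k j) w :=
    measurable_pi_lambda _ fun j => htm _
  have hsum : StronglyMeasurable fun w => ∑ k : Fin (K - M),
      (G (fun j => t (winNode k j) w) - ∫ w', G (fun j => t (winNode k j) w') ∂P) :=
    Finset.stronglyMeasurable_fun_sum _ fun k _ =>
      (hGm.comp_measurable (hwindow k)).sub stronglyMeasurable_const
  simp only [hdev]
  refine measure_lt_norm_inv_smul_sq_le hsum.aestronglyMeasurable (one_le_succ_mul_exp_one M)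
    (V := (M + 1) ^ 2 * (2 * (8 * b ^ 2) * (K - M : ℕ))) (by positivity) hℓ ?_ ?_ hη hη1
  · have hlog := Real.log_nonneg (one_le_succ_mul_exp_one M)
    rw [tailConst, mul_assoc (1 + _)]
    refine mul_le_mul_of_nonneg_left ?_ (by positivity)
    have hnoise : 0 ≤ 2 * (2 * σx2 * b ^ 2 + 1) * ((M + 1) * (n + 1)) * ((K - M : ℕ) : ℝ) := by
      positivity
    linarith
  · rw [ENNReal.ofReal_mul (by positivity)]
    exact (lintegral_exp_norm_window_sum_sq_le hKM htm ht hGm hb hG).trans_eq (by norm_cast)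

variable {ε : Fin K × Fin n → Ω → ℝ}

lemma IsSample.measure_norm_noise_sum_le {F : Type*} [NormedAddCommGroup F]
    [InnerProductSpace ℝ F] (h : IsSample P hmax ω σx2 t ε)
    {U : Fin K × Fin n → (Fin K → ℝ) → F} (hU : ∀ q, StronglyMeasurable (U q))
    (hUb : ∀ q τ, ‖U q τ‖ ≤ b) (hb : 0 < b) (hKM : M < K) (hη : 0 < η) (hη1 : η ≤ 1) :
    P {w | tailConst M n σx2 b * Real.log (4 / η) / (K - M : ℕ)
        < ‖((K - M : ℕ) : ℝ)⁻¹ • ∑ q, ε q w • U q fun i => t i w‖ ^ 2}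
      ≤ ENNReal.ofReal (η / 3) := by
  have hℓ := natCast_sub_pos hKM
  have hℓ1 : (1 : ℝ) ≤ (K - M : ℕ) := Nat.one_le_cast.2 (Nat.sub_pos_of_lt hKM)
  have hmeas : AEStronglyMeasurable (fun w => ∑ q, ε q w • U q fun i => t i w) P :=
    Finset.aestronglyMeasurable_fun_sum _ fun q _ =>
      (h.gaussian q).aemeasurable.aestronglyMeasurable.smul
        ((hU q).comp_measurable (measurable_pi_lambda _ h.measurable_t)).aestronglyMeasurable
  have hKn : (K : ℝ) * n ≤ (M + 1) * (n + 1) * (K - M : ℕ) := by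
    nlinarith [natCast_le_succ_mul_sub hKM, Nat.cast_nonneg (α := ℝ) n, Nat.cast_nonneg (α := ℝ) K]
  have hN : (1 : ℝ) ≤ (M + 1) * (n + 1) * (K - M : ℕ) :=
    one_le_mul_of_one_le_of_one_le (one_le_mul_of_one_le_of_one_le (by simp) (by simp)) hℓ1
  have hexp := (h.lintegral_exp_norm_noise_sum_sq_le hU hUb (v := 2 * σx2 * b ^ 2 + 1)
    (by positivity) (by linarith) hN hKn).trans
      (ENNReal.ofReal_le_ofReal (exp_one_le_succ_mul_exp_one M))
  refine measure_lt_norm_inv_smul_sq_le hmeas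
    (one_le_succ_mul_exp_one M) (by positivity) hℓ ?_ hexp hη hη1
  have hlog := Real.log_nonneg (one_le_succ_mul_exp_one M)
  rw [tailConst, mul_assoc (1 + _)]
  refine mul_le_mul_of_nonneg_left ?_ (by positivity)
  have hwindow : 0 ≤ 16 * b ^ 2 * (M + 1) ^ 2 * ((K - M : ℕ) : ℝ) := by positivity
  linarith

variable {p : ℕ} [NeZero M] {𝓗 : Type*} [NormedAddCommGroup 𝓗] [InnerProductSpace ℝ 𝓗]
  [CompleteSpace 𝓗] [RKHS ℝ 𝓗 (State n) ℝ] {S : PortHamiltonian n m} {meth : VLMM M}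
  {x : ℝ → State n}

/-- The contribution of the measurement errors to the normal equations of the estimator, divided by
the number of windows. -/
def noiseAvg (𝓗 : Type*) [NormedAddCommGroup 𝓗] [InnerProductSpace ℝ 𝓗] [CompleteSpace 𝓗]
    [RKHS ℝ 𝓗 (State n) ℝ] (S : PortHamiltonian n m) (meth : VLMM M) (x : ℝ → State n)
    (t : Fin K → ℝ) (ε : Fin K × Fin n → ℝ) : 𝓗 :=
  ((K - M : ℕ) : ℝ)⁻¹ • ∑ q, ε q • noiseRep 𝓗 S meth x t q

lemma IsSample.measure_noiseAvg_le (h : IsSample P hmax ω σx2 t ε)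
    (hb : IsUniformBound 𝓗 S meth x p hmax ω b) (hΦ : ContDiff ℝ 1 (feature 𝓗))
    (hx : ContinuousOn x (Set.Ici 0)) (hKM : M < K) (hη : 0 < η) (hη1 : η ≤ 1) :
    P {w | tailConst M n σx2 b * Real.log (4 / η) / (K - M : ℕ)
        < ‖noiseAvg 𝓗 S meth x (fun i => t i w) (fun q => ε q w)‖ ^ 2}
      ≤ ENNReal.ofReal (η / 3) := by
  let U (q : Fin K × Fin n) : (Fin K → ℝ) → 𝓗 :=
    (admissibleSet K hmax ω).indicator fun τ => noiseRep 𝓗 S meth x τ q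
  have hU (q : Fin K × Fin n) : StronglyMeasurable (U q) :=
    stronglyMeasurable_indicator_of_continuousOn (continuousOn_noiseRep hΦ hx q)
      (measurableSet_admissibleSet _ _ _)
  have hUb (q : Fin K × Fin n) : ∀ τ, ‖U q τ‖ ≤ b :=
    norm_indicator_admissibleSet_le hb.pos.le fun τ hτ => hb.noiseRep_le hτ q
  refine (measure_mono_ae ?_).trans (h.measure_norm_noise_sum_le hU hUb hb.pos hKM hη hη1)
  filter_upwards [h.admissible] with w hw hlt
  have hnoise : noiseAvg 𝓗 S meth x (fun i => t i w) (fun q => ε q w)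
      = ((K - M : ℕ) : ℝ)⁻¹ • ∑ q, ε q w • U q fun i => t i w := by
    simp only [noiseAvg, U, Set.indicator_of_mem (s := admissibleSet K hmax ω) hw]
  exact hlt.trans_eq (by rw [hnoise])

/-- The sampling times at `w` form an admissible grid, and the noise and the deviations of the two
relevant window averages from their means have squared norm at most `r`. -/
structure IsConcentratedAt (𝓗 : Type*) [NormedAddCommGroup 𝓗] [InnerProductSpace ℝ 𝓗]
    [CompleteSpace 𝓗] [RKHS ℝ 𝓗 (State n) ℝ] (S : PortHamiltonian n m) (meth : VLMM M)
    (x : ℝ → State n) (p : ℕ) (hmax ω : ℝ) (P : Measure Ω) (t : Fin K → Ω → ℝ)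
    (ε : Fin K × Fin n → Ω → ℝ) (r : ℝ) (w : Ω) : Prop where
  admissible : AdmissibleGrid hmax ω fun i => t i w
  noise_le : ‖noiseAvg 𝓗 S meth x (fun i => t i w) (fun q => ε q w)‖ ^ 2 ≤ r
  cov_le : ‖windowDeviation P t (windowCov 𝓗 S meth x hmax ω) w‖ ^ 2 ≤ r
  stepPow_le : ‖windowDeviation P t (windowStepPow M hmax ω (2 * p + 2)) w‖ ^ 2 ≤ r

lemma ofReal_one_sub_le_measure_of_compl {R : Set Ω} (hη : 0 ≤ η)
    (h : P Rᶜ ≤ ENNReal.ofReal η) : ENNReal.ofReal (1 - η) ≤ P R := by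
  have huniv : 1 ≤ P R + P Rᶜ := by
    rw [← measure_univ (μ := P), ← Set.union_compl_self R]
    exact measure_union_le _ _
  rw [ENNReal.ofReal_sub _ hη, ENNReal.ofReal_one]
  exact tsub_le_iff_right.2 (huniv.trans (by gcongr))

lemma IsSample.ofReal_one_sub_le_measure_isConcentratedAt (h : IsSample P hmax ω σx2 t ε)
    (hb : IsUniformBound 𝓗 S meth x p hmax ω b) (hΦ : ContDiff ℝ 1 (feature 𝓗))
    (hx : ContinuousOn x (Set.Ici 0)) (hKM : M < K) (hη : 0 < η) (hη1 : η ≤ 1) :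
    ENNReal.ofReal (1 - η) ≤ P {w | IsConcentratedAt 𝓗 S meth x p hmax ω P t ε
      (tailConst M n σx2 b * Real.log (4 / η) / (K - M : ℕ)) w} := by
  set r : ℝ := tailConst M n σx2 b * Real.log (4 / η) / (K - M : ℕ)
  have hnoise := h.measure_noiseAvg_le hb hΦ hx hKM hη hη1
  have hcov := measure_windowDeviation_le hKM h.measurable_t h.iIndepFun_times
    (stronglyMeasurable_windowCov hΦ hx) hb.pos hb.windowCov_le n σx2 hη hη1
  have hstep := measure_windowDeviation_le hKM h.measurable_t h.iIndepFun_times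
    (stronglyMeasurable_windowStepPow _) hb.pos hb.windowStepPow_le n σx2 hη hη1
  refine ofReal_one_sub_le_measure_of_compl hη.le ?_
  have hsub : {w | IsConcentratedAt 𝓗 S meth x p hmax ω P t ε r w}ᶜ ⊆
      {w | ¬ AdmissibleGrid hmax ω fun i => t i w} ∪
      ({w | r < ‖noiseAvg 𝓗 S meth x (fun i => t i w) (fun q => ε q w)‖ ^ 2} ∪
      ({w | r < ‖windowDeviation P t (windowCov 𝓗 S meth x hmax ω) w‖ ^ 2} ∪
      {w | r < ‖windowDeviation P t (windowStepPow M hmax ω (2 * p + 2)) w‖ ^ 2})) := by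
    intro w hw
    by_contra hcon
    simp only [Set.mem_union, Set.mem_ofPred_eq, not_or, not_lt, not_not] at hcon
    exact hw ⟨hcon.1, hcon.2.1, hcon.2.2.1, hcon.2.2.2⟩
  refine (measure_mono hsub).trans ?_
  calc _ ≤ 0 + (ENNReal.ofReal (η / 3) + (ENNReal.ofReal (η / 3) + ENNReal.ofReal (η / 3))) :=
        (measure_union_le _ _).trans <| add_le_add (ae_iff.1 h.admissible).le <|
          (measure_union_le _ _).trans <| add_le_add hnoise <|
            (measure_union_le _ _).trans <| add_le_add hcov hstep
    _ = ENNReal.ofReal η := by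
        rw [zero_add, ← ENNReal.ofReal_add (by positivity) (by positivity),
          ← ENNReal.ofReal_add (by positivity) (by positivity)]
        congr 1
        ring

end Concentration

/-! ### The error bound -/

section Rate

/-- The constant in the bound for the squared RKHS norm of the error: `ρ` is the normalized
regularization parameter, `G₀` the squared norm of the true energy, `c` the concentration constant
and `b` the uniform bound. -/
def normConst (ρ G₀ c b : ℝ) : ℝ := 2 * G₀ + 2 * c / ρ ^ 2 + b ^ 2 / ρ

/-- The constant in the stochastic part of the bound for the sampling norm of the error, in terms of
the same quantities as `normConst`. -/
def fitConst (ρ G₀ c b : ℝ) : ℝ :=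
  2 * ρ * G₀ + 2 * c / ρ + b * √c + (2 * √c * G₀ + 4 * b * c / ρ ^ 2 + √c * b ^ 2 / ρ)

lemma rpow_neg_one_div_five_pow_five {y : ℝ} (hy : 0 ≤ y) :
    (y ^ (-(1 / 5 : ℝ))) ^ 5 = y⁻¹ := by
  rw [← Real.rpow_natCast, ← Real.rpow_mul hy, ← Real.rpow_neg_one]
  norm_num

variable {ρ G₀ c b : ℝ}

lemma normConst_pos (hρ : 0 < ρ) (hG₀ : 0 ≤ G₀) (hc : 0 < c) : 0 < normConst ρ G₀ c b := by
  unfold normConst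
  positivity

lemma fitConst_pos (hρ : 0 < ρ) (hG₀ : 0 ≤ G₀) (hc : 0 < c) (hb : 0 < b) :
    0 < fitConst ρ G₀ c b := by
  unfold fitConst
  positivity

variable {θ Λ A D z T : ℝ}

lemma le_sqrt_mul_of_sq_le {y : ℝ} (hc : 0 ≤ c) (hθ : 0 ≤ θ) (hθ1 : θ ≤ 1) (hΛ : 1 ≤ Λ)
    (h : y ^ 2 ≤ c * Λ * θ ^ 5) : y ≤ √c * Λ * θ ^ 2 := by
  refine le_of_sq_le_sq (h.trans ?_) (by positivity)
  calc c * Λ * θ ^ 5 = c * (Λ * θ ^ 5) := mul_assoc _ _ _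
    _ ≤ c * (Λ ^ 2 * θ ^ 4) := by
        have := le_self_pow₀ hΛ two_ne_zero
        have := pow_le_pow_of_le_one hθ hθ1 (show 4 ≤ 5 by norm_num)
        gcongr
    _ = (√c * Λ * θ ^ 2) ^ 2 := by rw [mul_pow, mul_pow, Real.sq_sqrt hc]; ring

lemma norm_sq_le_of_ridge (hρ : 0 < ρ) (hθ : 0 < θ) (hA : 0 ≤ A) (hz : z ≤ c * Λ * θ ^ 5)
    (hT : T ≤ b ^ 2)
    (hridge : A + ρ * θ * D ≤ 2 * (ρ * θ) * G₀ + 2 * z / (ρ * θ) + T) :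
    D ≤ 2 * G₀ + 2 * c / ρ ^ 2 * (Λ * θ ^ 3) + b ^ 2 / ρ / θ := by
  have hnoise : 2 * z / (ρ * θ) ≤ 2 * (c * Λ * θ ^ 5) / (ρ * θ) := by gcongr
  refine le_of_mul_le_mul_left ?_ (mul_pos hρ hθ)
  calc ρ * θ * D ≤ 2 * (ρ * θ) * G₀ + 2 * (c * Λ * θ ^ 5) / (ρ * θ) + b ^ 2 := by linarith
    _ = _ := by field_simp

lemma norm_sq_le_normConst (hρ : 0 < ρ) (hG₀ : 0 ≤ G₀) (hc : 0 ≤ c) (hθ : 0 < θ) (hθ1 : θ ≤ 1)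
    (hΛ : 1 ≤ Λ) (hD : D ≤ 2 * G₀ + 2 * c / ρ ^ 2 * (Λ * θ ^ 3) + b ^ 2 / ρ / θ) :
    D ≤ normConst ρ G₀ c b * Λ / θ := by
  have hone : 1 ≤ Λ / θ := (one_le_div hθ).2 (hθ1.trans hΛ)
  have hcube : Λ * θ ^ 3 ≤ Λ / θ :=
    (mul_le_of_le_one_right (by linarith) (pow_le_one₀ hθ.le hθ1)).trans
      (le_div_self (by linarith) hθ hθ1)
  have hinv : θ⁻¹ ≤ Λ / θ := by
    rw [div_eq_mul_inv]
    exact le_mul_of_one_le_left (by positivity) hΛ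
  calc D ≤ 2 * G₀ * 1 + 2 * c / ρ ^ 2 * (Λ * θ ^ 3) + b ^ 2 / ρ * θ⁻¹ := by
        rwa [mul_one, ← div_eq_mul_inv]
    _ ≤ 2 * G₀ * (Λ / θ) + 2 * c / ρ ^ 2 * (Λ / θ) + b ^ 2 / ρ * (Λ / θ) := by gcongr
    _ = normConst ρ G₀ c b * Λ / θ := by rw [normConst]; ring

lemma mul_norm_sq_le {Δ : ℝ} (hρ : 0 < ρ) (hG₀ : 0 ≤ G₀) (hc : 0 ≤ c) (hb : 0 ≤ b) (hθ : 0 < θ)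
    (hθ1 : θ ≤ 1) (hΛ : 1 ≤ Λ) (hΔ : 0 ≤ Δ) (hΔb : Δ ≤ 2 * b) (hΔc : Δ ≤ √c * Λ * θ ^ 2)
    (hD : D ≤ 2 * G₀ + 2 * c / ρ ^ 2 * (Λ * θ ^ 3) + b ^ 2 / ρ / θ) :
    Δ * D ≤ (2 * √c * G₀ + 4 * b * c / ρ ^ 2 + √c * b ^ 2 / ρ) * Λ * θ := by
  have hsq : θ ^ 2 ≤ θ := pow_le_of_le_one hθ.le hθ1 two_ne_zero
  have hcube : θ ^ 3 ≤ θ := pow_le_of_le_one hθ.le hθ1 three_ne_zero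
  calc Δ * D ≤ Δ * (2 * G₀ + 2 * c / ρ ^ 2 * (Λ * θ ^ 3) + b ^ 2 / ρ / θ) := by gcongr
    _ = Δ * (2 * G₀) + Δ * (2 * c / ρ ^ 2 * (Λ * θ ^ 3)) + Δ * (b ^ 2 / ρ / θ) := by ring
    _ ≤ √c * Λ * θ ^ 2 * (2 * G₀) + 2 * b * (2 * c / ρ ^ 2 * (Λ * θ ^ 3))
          + √c * Λ * θ ^ 2 * (b ^ 2 / ρ / θ) := by gcongr
    _ = 2 * √c * Λ * G₀ * θ ^ 2 + 4 * b * c / ρ ^ 2 * Λ * θ ^ 3 + √c * b ^ 2 / ρ * Λ * θ := by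
        field_simp
        ring
    _ ≤ 2 * √c * Λ * G₀ * θ + 4 * b * c / ρ ^ 2 * Λ * θ + √c * b ^ 2 / ρ * Λ * θ := by gcongr
    _ = _ := by ring

lemma le_fitConst {W Δ δ μ : ℝ} (hρ : 0 < ρ) (hG₀ : 0 ≤ G₀) (hc : 0 ≤ c) (hb : 0 ≤ b) (hθ : 0 < θ)
    (hθ1 : θ ≤ 1) (hΛ : 1 ≤ Λ) (hz : z ≤ c * Λ * θ ^ 5) (hD0 : 0 ≤ D)
    (hridge : A + ρ * θ * D ≤ 2 * (ρ * θ) * G₀ + 2 * z / (ρ * θ) + T)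
    (hT : T ≤ b * (μ + δ)) (hδ : δ ≤ √c * Λ * θ ^ 2)
    (hΔD : Δ * D ≤ (2 * √c * G₀ + 4 * b * c / ρ ^ 2 + √c * b ^ 2 / ρ) * Λ * θ)
    (hW : W ≤ A + Δ * D) : W ≤ fitConst ρ G₀ c b * Λ * θ + b * μ := by
  have hθΛ : θ ≤ Λ * θ := le_mul_of_one_le_left hθ.le hΛ
  have hsq : θ ^ 2 ≤ θ := pow_le_of_le_one hθ.le hθ1 two_ne_zero
  have hfour : θ ^ 4 ≤ θ := pow_le_of_le_one hθ.le hθ1 four_ne_zero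
  have hρθD : 0 ≤ ρ * θ * D := by positivity
  have hprior : 2 * ρ * G₀ * θ ≤ 2 * ρ * G₀ * (Λ * θ) := by gcongr
  have hnoise : 2 * z / (ρ * θ) ≤ 2 * c / ρ * (Λ * θ) := by
    calc 2 * z / (ρ * θ) ≤ 2 * (c * Λ * θ ^ 5) / (ρ * θ) := by gcongr
      _ = 2 * c / ρ * (Λ * θ ^ 4) := by field_simp
      _ ≤ _ := by gcongr
  have htrunc : b * δ ≤ b * √c * (Λ * θ) := by
    calc b * δ ≤ b * (√c * Λ * θ ^ 2) := by gcongr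
      _ = b * √c * (Λ * θ ^ 2) := by ring
      _ ≤ _ := by gcongr
  unfold fitConst
  linarith

end Rate

section Norms

variable {n m K M : ℕ} {𝓗 : Type*} [NormedAddCommGroup 𝓗] [InnerProductSpace ℝ 𝓗]
  [CompleteSpace 𝓗] [RKHS ℝ 𝓗 (State n) ℝ] {S : PortHamiltonian n m} {meth : VLMM M}
  {x : ℝ → State n} {hmax ω : ℝ}

lemma inner_windowAvg_windowCov {τ : Fin K → ℝ} (hτ : AdmissibleGrid hmax ω τ) (g : 𝓗) :
    inner ℝ (windowAvg (windowCov 𝓗 S meth x hmax ω) τ) (squareTensor g)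
      = (∑ q, inner ℝ (gridRep 𝓗 S meth x τ q) g ^ 2) / (K - M : ℕ) := by
  rw [windowAvg, real_inner_smul_left, sum_inner, Fintype.sum_prod_type, inv_mul_eq_div]
  congr 1
  exact Finset.sum_congr rfl fun k _ => inner_windowCov (hτ.gridWindow k) g

variable [NeZero M] {p : ℕ} {b : ℝ} {Ω : Type*} [MeasurableSpace Ω] {P : Measure Ω} {σx2 : ℝ≥0}
  {t : Fin K → Ω → ℝ} {ε : Fin K × Fin n → Ω → ℝ}

lemma wNormSq_field_eq [IsProbabilityMeasure P] (h : IsSample P hmax ω σx2 t ε)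
    (hb : IsUniformBound 𝓗 S meth x p hmax ω b) (hΦ : ContDiff ℝ 1 (feature 𝓗))
    (hx : ContinuousOn x (Set.Ici 0)) (g : 𝓗) :
    wNormSq P meth x t (S.field (g : State n → ℝ))
      = inner ℝ (∫ w, windowAvg (windowCov 𝓗 S meth x hmax ω) (fun i => t i w) ∂P)
          (squareTensor g) := by
  have hcov := stronglyMeasurable_windowCov (S := S) (meth := meth) (hmax := hmax) (ω := ω) hΦ hx
  rw [integral_windowAvg h.measurable_t hcov hb.windowCov_le, real_inner_smul_left, sum_inner,
    inv_mul_eq_div, wNormSq]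
  congr 1
  refine Finset.sum_congr rfl fun k _ => ?_
  rw [real_inner_comm,
    ← integral_inner (integrable_comp_gridWindow h.measurable_t hcov hb.windowCov_le k)]
  refine integral_congr_ae ?_
  filter_upwards [h.admissible] with w hw
  rw [norm_sum_matB_field_sq S meth x _ (hΦ.differentiable one_ne_zero), real_inner_comm,
    inner_windowCov (hw.gridWindow k)]
  rfl

lemma meanStepPow_eq [IsProbabilityMeasure P] (h : IsSample P hmax ω σx2 t ε)
    (hb : IsUniformBound 𝓗 S meth x p hmax ω b) :
    meanStepPow (M := M) P t (2 * p + 2)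
      = ∫ w, windowAvg (windowStepPow M hmax ω (2 * p + 2)) (fun i => t i w) ∂P := by
  rw [integral_windowAvg h.measurable_t (stronglyMeasurable_windowStepPow _) hb.windowStepPow_le,
    smul_eq_mul, inv_mul_eq_div, meanStepPow]
  congr 1
  refine Finset.sum_congr rfl fun k _ => integral_congr_ae ?_
  filter_upwards [h.admissible] with w hw
  rw [windowStepPow_of_admissible (hw.gridWindow k)]
  rfl

lemma wNormSq_field_le [IsProbabilityMeasure P] (h : IsSample P hmax ω σx2 t ε)
    (hb : IsUniformBound 𝓗 S meth x p hmax ω b) (hΦ : ContDiff ℝ 1 (feature 𝓗))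
    (hx : ContinuousOn x (Set.Ici 0)) {w : Ω} (hw : AdmissibleGrid hmax ω fun i => t i w) (g : 𝓗) :
    wNormSq P meth x t (S.field (g : State n → ℝ))
      ≤ (∑ q, inner ℝ (gridRep 𝓗 S meth x (fun i => t i w) q) g ^ 2) / (K - M : ℕ)
        + ‖windowDeviation P t (windowCov 𝓗 S meth x hmax ω) w‖ * ‖g‖ ^ 2 := by
  have hdev : -(‖windowDeviation P t (windowCov 𝓗 S meth x hmax ω) w‖ * ‖squareTensor g‖)
      ≤ inner ℝ (windowDeviation P t (windowCov 𝓗 S meth x hmax ω) w) (squareTensor g) :=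
    neg_le_of_abs_le (abs_real_inner_le_norm _ _)
  rw [windowDeviation, inner_sub_left, inner_windowAvg_windowCov hw,
    ← wNormSq_field_eq h hb hΦ hx, norm_squareTensor] at hdev
  rw [windowDeviation]
  linarith

lemma IsUniformBound.sum_truncationError_sq_le (hb : IsUniformBound 𝓗 S meth x p hmax ω b)
    {τ : Fin K → ℝ} (hτ : AdmissibleGrid hmax ω τ) :
    (∑ q : Fin (K - M) × Fin n,
        meth.truncationError x (derivWithin x (Set.Ici 0)) (gridWindow τ q.1) q.2 ^ 2)
          / (K - M : ℕ)
      ≤ b * windowAvg (windowStepPow M hmax ω (2 * p + 2)) τ := by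
  rw [windowAvg, smul_eq_mul, inv_mul_eq_div, ← mul_div_assoc, Finset.mul_sum,
    Fintype.sum_prod_type]
  refine div_le_div_of_nonneg_right (Finset.sum_le_sum fun k _ => ?_) (Nat.cast_nonneg _)
  refine le_of_eq_of_le ?_ (hb.truncationError_le (hτ.gridWindow k))
  simp only [EuclideanSpace.norm_sq_eq, Real.norm_eq_abs, sq_abs]

end Norms

section ErrorBound

variable {n m K M : ℕ} {𝓗 : Type*} [NormedAddCommGroup 𝓗] [InnerProductSpace ℝ 𝓗]
  [CompleteSpace 𝓗] [RKHS ℝ 𝓗 (State n) ℝ] {S : PortHamiltonian n m} {meth : VLMM M}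
  {u : ℝ → Fin m → ℝ} {x : ℝ → State n} {σf reg : ℝ} {g₀ : 𝓗}

/-- The difference of the estimated and the true energy, as an element of the RKHS. -/
def energyError (S : PortHamiltonian n m) (meth : VLMM M) (u : ℝ → Fin m → ℝ) (x : ℝ → State n)
    (σf reg : ℝ) (g₀ : 𝓗) (t : Fin K → ℝ) (ε : Fin K × Fin n → ℝ) : 𝓗 :=
  ridgeSolution (σf ^ 2) (((K - M : ℕ) : ℝ) * reg) (gridRep 𝓗 S meth x t)
    (labels S meth u x t ε) - g₀

lemma estimator_sub_drift (hΦ : Differentiable ℝ (feature 𝓗))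
    (hg₀ : (g₀ : State n → ℝ) = S.H) (t : Fin K → ℝ) (ε : Fin K × Fin n → ℝ) :
    estimator S (phsKernel S (baseKernel 𝓗) σf) meth u x reg t ε - S.drift
      = S.field ⇑(energyError S meth u x σf reg g₀ t ε : 𝓗) := by
  rw [estimator_eq_field S meth x t hΦ, energyError, field_sub hΦ, PortHamiltonian.drift, hg₀]

lemma energyError_bound (hΦ : Differentiable ℝ (feature 𝓗)) (hg₀ : (g₀ : State n → ℝ) = S.H)
    (hx : S.IsTrajectory u x) (hKM : M < K) (hσf : 0 < σf) (hreg : 0 < reg) {t : Fin K → ℝ}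
    (ht : ∀ i, 0 ≤ t i) (ε : Fin K × Fin n → ℝ) :
    (∑ q, inner ℝ (gridRep 𝓗 S meth x t q) (energyError S meth u x σf reg g₀ t ε) ^ 2)
          / (K - M : ℕ) + reg / σf ^ 2 * ‖energyError S meth u x σf reg g₀ t ε‖ ^ 2
      ≤ 2 * (reg / σf ^ 2) * ‖g₀‖ ^ 2
        + 2 * ‖noiseAvg 𝓗 S meth x t ε‖ ^ 2 / (reg / σf ^ 2)
        + (∑ q : Fin (K - M) × Fin n,
            meth.truncationError x (derivWithin x (Set.Ici 0)) (gridWindow t q.1) q.2 ^ 2)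
              / (K - M : ℕ) := by
  have hℓ := natCast_sub_pos hKM
  have hridge := ridge_error_bound (sq_pos_of_pos hσf) (mul_pos hℓ hreg)
    (fun q => labels_eq meth hΦ ε hg₀ hx ht q)
    (d := energyError S meth u x σf reg g₀ t ε) rfl
  rw [sum_noise_smul_gridRep] at hridge
  have hnoise : ‖∑ q, ε q • noiseRep 𝓗 S meth x t q‖ ^ 2
      = ((K - M : ℕ) : ℝ) ^ 2 * ‖noiseAvg 𝓗 S meth x t ε‖ ^ 2 := by
    rw [noiseAvg, norm_smul, norm_inv, Real.norm_natCast]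
    field_simp
  rw [hnoise] at hridge
  refine le_of_mul_le_mul_left ?_ hℓ
  rw [mul_add, mul_add, mul_div_cancel₀ _ hℓ.ne', mul_div_cancel₀ _ hℓ.ne']
  refine (le_of_eq_of_le ?_ hridge).trans_eq ?_
  · ring
  · congr 1
    field_simp

variable [NeZero M] {p : ℕ} {hmax ω b : ℝ} {Ω : Type*} [MeasurableSpace Ω] {P : Measure Ω}
  [IsProbabilityMeasure P] {σx2 : ℝ≥0} {t : Fin K → Ω → ℝ} {ε : Fin K × Fin n → Ω → ℝ}

lemma IsConcentratedAt.energyError_le (h : IsSample P hmax ω σx2 t ε)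
    (hb : IsUniformBound 𝓗 S meth x p hmax ω b) (hΦ : ContDiff ℝ 1 (feature 𝓗))
    (hg₀ : (g₀ : State n → ℝ) = S.H) (hx : S.IsTrajectory u x) (hxc : ContinuousOn x (Set.Ici 0))
    (hKM : M < K) (hσf : 0 < σf) {reg₀ θ c Λ : ℝ} (hreg₀ : 0 < reg₀) (hθ : 0 < θ) (hθ1 : θ ≤ 1)
    (hc : 0 ≤ c) (hΛ : 1 ≤ Λ) {w : Ω}
    (hw : IsConcentratedAt 𝓗 S meth x p hmax ω P t ε (c * Λ * θ ^ 5) w) {d : 𝓗}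
    (hd : d = energyError S meth u x σf (reg₀ * θ) g₀ (fun i => t i w) (fun q => ε q w)) :
    wNormSq P meth x t (S.field (d : State n → ℝ))
        ≤ fitConst (reg₀ / σf ^ 2) (‖g₀‖ ^ 2) c b * Λ * θ
          + b * meanStepPow (M := M) P t (2 * p + 2) ∧
      ‖d‖ ^ 2 ≤ normConst (reg₀ / σf ^ 2) (‖g₀‖ ^ 2) c b * Λ / θ := by
  have hρ : 0 < reg₀ / σf ^ 2 := by positivity
  have hridge := energyError_bound (meth := meth) (hΦ.differentiable one_ne_zero) hg₀ hx hKM hσf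
    (mul_pos hreg₀ hθ) hw.admissible.nonneg (fun q => ε q w)
  rw [← hd, mul_div_right_comm reg₀ θ] at hridge
  have htrunc := hb.sum_truncationError_sq_le hw.admissible
  have hμ : windowAvg (windowStepPow M hmax ω (2 * p + 2)) (fun i => t i w)
      = meanStepPow (M := M) P t (2 * p + 2)
        + windowDeviation P t (windowStepPow M hmax ω (2 * p + 2)) w := by
    rw [windowDeviation, ← meanStepPow_eq h hb, add_sub_cancel]
  have htrunc_le := htrunc.trans (mul_le_mul_of_nonneg_left
    ((le_abs_self _).trans (norm_windowAvg_le hb.windowStepPow_le _)) hb.pos.le)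
  rw [← sq] at htrunc_le
  rw [hμ] at htrunc
  have hD := norm_sq_le_of_ridge hρ hθ (div_nonneg (Finset.sum_nonneg fun q _ => sq_nonneg _)
    (Nat.cast_nonneg _)) hw.noise_le htrunc_le hridge
  have hΔD := mul_norm_sq_le hρ (sq_nonneg ‖g₀‖) hc hb.pos.le hθ hθ1 hΛ (norm_nonneg _)
    (norm_windowDeviation_le hb.windowCov_le w) (le_sqrt_mul_of_sq_le hc hθ.le hθ1 hΛ hw.cov_le) hD
  have hδ := (le_abs_self _).trans (le_sqrt_mul_of_sq_le hc hθ.le hθ1 hΛ hw.stepPow_le)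
  exact ⟨le_fitConst hρ (sq_nonneg _) hc hb.pos.le hθ hθ1 hΛ hw.noise_le (sq_nonneg _) hridge
      htrunc hδ hΔD (wNormSq_field_le h hb hΦ hxc hw.admissible d),
    norm_sq_le_normConst hρ (sq_nonneg _) hc hθ hθ1 hΛ hD⟩

end ErrorBound

section Probability

variable {n m K M p : ℕ} {𝓗 : Type*} [NormedAddCommGroup 𝓗] [InnerProductSpace ℝ 𝓗]
  [CompleteSpace 𝓗] [RKHS ℝ 𝓗 (State n) ℝ]

theorem exists_estimator_error_bound [NeZero M]
    (hk : ContDiff ℝ 2 fun z : State n × State n => baseKernel 𝓗 z.1 z.2)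
    {S : PortHamiltonian n m} {g₀ : 𝓗} (hg₀ : (g₀ : State n → ℝ) = S.H)
    {u : ℝ → Fin m → ℝ} {x : ℝ → State n} (hx : S.IsTrajectory u x)
    (hxsmooth : ContDiffOn ℝ ((p + 1 : ℕ) : WithTop ℕ∞) x (Set.Ici 0))
    (hxbound : ∃ D : ℝ, ∀ t, 0 ≤ t → ‖iteratedDerivWithin (p + 1) x (Set.Ici 0) t‖ ≤ D)
    {σf : ℝ} (hσf : 0 < σf)
    (hκ : ∃ κ : ℝ, ∀ t, 0 ≤ t → (phsKernel S (baseKernel 𝓗) σf (x t) (x t)).trace ≤ κ ^ 2)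
    {meth : VLMM M} (hp : meth.HasOrder p) (hmax ω : ℝ) (σx2 : ℝ≥0) {reg₀ : ℝ}
    (hreg₀ : 0 < reg₀) :
    ∃ Cfit : ℝ, 0 < Cfit ∧ ∃ Cbias : ℝ, 0 < Cbias ∧ ∃ Cnorm : ℝ, 0 < Cnorm ∧
      ∀ K : ℕ, M < K →
      ∀ {Ω : Type*} [MeasurableSpace Ω] (P : Measure Ω) [IsProbabilityMeasure P]
        (t : Fin K → Ω → ℝ) (ε : Fin K × Fin n → Ω → ℝ), IsSample P hmax ω σx2 t ε →
      ∀ η : ℝ, 0 < η → η ≤ 1 →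
        ENNReal.ofReal (1 - η) ≤ P {w | ∃ d : 𝓗,
          estimator S (phsKernel S (baseKernel 𝓗) σf) meth u x
              (reg₀ * ((K - M : ℕ) : ℝ) ^ (-(1 / 5 : ℝ))) (fun i => t i w) (fun q => ε q w)
            - S.drift = S.field (d : State n → ℝ) ∧
          wNormSq P meth x t (S.field (d : State n → ℝ))
            ≤ Cfit * Real.log (4 / η) * ((K - M : ℕ) : ℝ) ^ (-(1 / 5 : ℝ))
              + Cbias * meanStepPow (M := M) P t (2 * p + 2) ∧
          ‖d‖ ^ 2 ≤ Cnorm * Real.log (4 / η) / ((K - M : ℕ) : ℝ) ^ (-(1 / 5 : ℝ))} := by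
  have hΦ := contDiff_feature 𝓗 hk
  have hxc := hxsmooth.continuousOn
  obtain ⟨D, hD⟩ := hxbound
  obtain ⟨κ, hκ⟩ := hκ
  obtain ⟨b, hb⟩ :=
    exists_isUniformBound (hΦ.differentiable one_ne_zero) hxsmooth hD hσf hκ hp hmax ω
  have hc := tailConst_pos M n σx2 b
  have hρ : 0 < reg₀ / σf ^ 2 := by positivity
  refine ⟨fitConst (reg₀ / σf ^ 2) (‖g₀‖ ^ 2) (tailConst M n σx2 b) b,
    fitConst_pos hρ (sq_nonneg _) hc hb.pos, b, hb.pos,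
    normConst (reg₀ / σf ^ 2) (‖g₀‖ ^ 2) (tailConst M n σx2 b) b,
    normConst_pos hρ (sq_nonneg _) hc, fun K hKM Ω _ P _ t ε h η hη hη1 => ?_⟩
  refine (h.ofReal_one_sub_le_measure_isConcentratedAt hb hΦ hxc hKM hη hη1).trans
    (measure_mono fun w hw => ⟨_, estimator_sub_drift (hΦ.differentiable one_ne_zero) hg₀ _ _, ?_⟩)
  have hℓ := natCast_sub_pos hKM
  have hℓ1 : 1 ≤ ((K - M : ℕ) : ℝ) := Nat.one_le_cast.2 (Nat.cast_pos.1 hℓ)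
  rw [Set.mem_ofPred_eq, div_eq_mul_inv, ← rpow_neg_one_div_five_pow_five hℓ.le] at hw
  exact hw.energyError_le h hb hΦ hg₀ hx hxc hKM hσf hreg₀ (Real.rpow_pos_of_pos hℓ _)
    (Real.rpow_le_one_of_one_le_of_nonpos hℓ1 (by norm_num)) hc.le
    (one_le_log_four_div hη hη1) rfl

end Probability

section Observability

variable {n m K M : ℕ} {Ω : Type*} [MeasurableSpace Ω] {𝓗 : Type*} [NormedAddCommGroup 𝓗]
  [InnerProductSpace ℝ 𝓗] [RKHS ℝ 𝓗 (State n) ℝ] {S : PortHamiltonian n m} {P : Measure Ω}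
  {meth : VLMM M} {x : ℝ → State n} {t : Fin K → Ω → ℝ} {ν : Measure (State n)}

lemma obsConst_sq_mul_vNormSq_le (h : 0 < obsConst 𝓗 S P meth x t ν) (g : 𝓗) :
    obsConst 𝓗 S P meth x t ν ^ 2 * vNormSq ν (S.field (g : State n → ℝ))
      ≤ wNormSq P meth x t (S.field (g : State n → ℝ)) := by
  rw [obsConst] at h ⊢
  set A : Set ℝ := {c : ℝ | 0 ≤ c ∧ ∀ g : 𝓗, c ^ 2 * vNormSq ν (S.field (g : State n → ℝ)) ≤
      wNormSq P meth x t (S.field (g : State n → ℝ))} with hA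
  have hbdd : BddAbove A := by
    by_contra hn
    exact h.ne' (Real.sSup_of_not_bddAbove hn)
  have hne : A.Nonempty := by
    by_contra hn
    exact h.ne' (by rw [Set.not_nonempty_iff_eq_empty.1 hn, Real.sSup_empty])
  have hclosed : IsClosed A := by
    rw [hA, Set.ofPred_and, Set.ofPred_forall]
    exact isClosed_Ici.inter
      (isClosed_iInter fun g => isClosed_le (by fun_prop) continuous_const)
  exact (hclosed.csSup_mem hne hbdd).2 g

lemma meanStepPow_two_mul_add_two_nonneg [NeZero M] (p : ℕ) :
    0 ≤ meanStepPow (M := M) P t (2 * p + 2) :=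
  div_nonneg (Finset.sum_nonneg fun _ _ => integral_nonneg fun _ =>
    Even.pow_nonneg ⟨p + 1, by ring⟩ _) (Nat.cast_nonneg _)

variable [CompleteSpace 𝓗] {σf : ℝ}

lemma vNormSq_field_le (hΦ : Differentiable ℝ (feature 𝓗)) (hσf : 0 < σf)
    (hν : Integrable (fun z => (phsKernel S (baseKernel 𝓗) σf z z).trace) ν) (g : 𝓗) :
    vNormSq ν (S.field (g : State n → ℝ))
      ≤ ‖g‖ ^ 2 / σf ^ 2 * ∫ z, (phsKernel S (baseKernel 𝓗) σf z z).trace ∂ν := by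
  rw [vNormSq, ← integral_const_mul]
  exact integral_mono_of_nonneg (.of_forall fun z => sq_nonneg _) (hν.const_mul _)
    (.of_forall fun z => norm_field_sq_le hΦ S hσf g z)

lemma exists_observability_bound [NeZero M] (hΦ : Differentiable ℝ (feature 𝓗)) (hσf : 0 < σf)
    (hν : Integrable (fun z => (phsKernel S (baseKernel 𝓗) σf z z).trace) ν)
    {Cfit Cbias Cnorm θ : ℝ} (hfit : 0 < Cfit) (hbias : 0 < Cbias) (hnorm : 0 < Cnorm)
    (hθ : 0 < θ) (p : ℕ) :
    ∃ cobs : ℝ, 0 < cobs ∧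
      (0 < obsConst 𝓗 S P meth x t ν → cobs = obsConst 𝓗 S P meth x t ν) ∧
      ∀ Λ : ℝ, 0 ≤ Λ → ∀ d : 𝓗,
        wNormSq P meth x t (S.field (d : State n → ℝ))
          ≤ Cfit * Λ * θ + Cbias * meanStepPow (M := M) P t (2 * p + 2) →
        ‖d‖ ^ 2 ≤ Cnorm * Λ / θ →
        vNormSq ν (S.field (d : State n → ℝ)) ≤ Cfit / cobs ^ 2 * Λ * θ
          + Cbias / cobs ^ 2 * meanStepPow (M := M) P t (2 * p + 2) := by
  by_cases hobs : 0 < obsConst 𝓗 S P meth x t ν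
  · refine ⟨_, hobs, fun _ => rfl, fun Λ _ d hW _ => ?_⟩
    rw [div_mul_eq_mul_div, div_mul_eq_mul_div, div_mul_eq_mul_div, ← add_div,
      le_div_iff₀' (by positivity)]
    exact (obsConst_sq_mul_vNormSq_le hobs d).trans hW
  · set I : ℝ := ∫ z, (phsKernel S (baseKernel 𝓗) σf z z).trace ∂ν
    have hI : 0 ≤ I := integral_nonneg fun z => by
      rw [trace_phsKernel hΦ]
      positivity
    obtain ⟨X, hX, hIX⟩ : ∃ X : ℝ, 0 < X ∧ Cnorm * I / σf ^ 2 ≤ X :=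
      ⟨Cnorm * I / σf ^ 2 + 1, by positivity, by linarith⟩
    refine ⟨θ * √(Cfit / X), by positivity, fun h => absurd h hobs, fun Λ hΛ d _ hd => ?_⟩
    have hsq : (θ * √(Cfit / X)) ^ 2 = θ ^ 2 * (Cfit / X) := by
      rw [mul_pow, Real.sq_sqrt (by positivity)]
    calc vNormSq ν (S.field (d : State n → ℝ)) ≤ ‖d‖ ^ 2 / σf ^ 2 * I :=
          vNormSq_field_le hΦ hσf hν d
      _ ≤ Cnorm * Λ / θ / σf ^ 2 * I := by gcongr
      _ = Cnorm * I / σf ^ 2 * (Λ / θ) := by ring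
      _ ≤ X * (Λ / θ) := by gcongr
      _ = Cfit / (θ * √(Cfit / X)) ^ 2 * Λ * θ := by rw [hsq]; field_simp
      _ ≤ _ := le_add_of_nonneg_right
          (mul_nonneg (by positivity) (meanStepPow_two_mul_add_two_nonneg p))

end Observability

end MSPHS

end

theorem proposition1 {n m M p : ℕ} [NeZero M]
    (𝓗 : Type*) [NormedAddCommGroup 𝓗] [InnerProductSpace ℝ 𝓗] [CompleteSpace 𝓗]
    [RKHS ℝ 𝓗 (MSPHS.State n) ℝ]
    (hk : ContDiff ℝ 2
      (fun z : MSPHS.State n × MSPHS.State n => MSPHS.baseKernel 𝓗 z.1 z.2))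
    (S : MSPHS.PortHamiltonian n m)
    (hH : ∃ g : 𝓗, (g : MSPHS.State n → ℝ) = S.H)
    (u : ℝ → Fin m → ℝ) (x : ℝ → MSPHS.State n) (hx : S.IsTrajectory u x)
    (hxsmooth : ContDiffOn ℝ ((p + 1 : ℕ) : WithTop ℕ∞) x (Set.Ici 0))
    (hxbound : ∃ D : ℝ, ∀ t, 0 ≤ t → ‖iteratedDerivWithin (p + 1) x (Set.Ici 0) t‖ ≤ D)
    (σf : ℝ) (hσf : 0 < σf)
    (hκ : ∃ κ : ℝ, ∀ t, 0 ≤ t →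
      (MSPHS.phsKernel S (MSPHS.baseKernel 𝓗) σf (x t) (x t)).trace ≤ κ ^ 2)
    (meth : MSPHS.VLMM M) (hp : meth.HasOrder p)
    (hmax ω : ℝ) (σx2 : ℝ≥0) (reg₀ : ℝ) (hreg₀ : 0 < reg₀) :
    ∃ Cfit : ℝ, 0 < Cfit ∧ ∃ Cbias : ℝ, 0 < Cbias ∧
      ∀ (K : ℕ), M < K →
      ∀ {Ω : Type*} [MeasurableSpace Ω] (P : Measure Ω) [IsProbabilityMeasure P]
        (t : Fin K → Ω → ℝ) (ε : Fin K × Fin n → Ω → ℝ),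
        MSPHS.IsSample P hmax ω σx2 t ε →
      ∀ ν : Measure (MSPHS.State n),
        Integrable (fun z => (MSPHS.phsKernel S (MSPHS.baseKernel 𝓗) σf z z).trace) ν →
      ∃ cobs : ℝ, 0 < cobs ∧
        (0 < MSPHS.obsConst 𝓗 S P meth x t ν → cobs = MSPHS.obsConst 𝓗 S P meth x t ν) ∧
        ∀ η : ℝ, 0 < η → η ≤ 1 →
          ENNReal.ofReal (1 - η) ≤
            P {w | MSPHS.vNormSq ν
                (MSPHS.estimator S (MSPHS.phsKernel S (MSPHS.baseKernel 𝓗) σf) meth u x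
                  (reg₀ * ((K - M : ℕ) : ℝ) ^ (-(1 / 5 : ℝ)))
                  (fun i => t i w) (fun q => ε q w) - S.drift) ≤
              Cfit / cobs ^ 2 * Real.log (4 / η) * ((K - M : ℕ) : ℝ) ^ (-(1 / 5 : ℝ)) +
                Cbias / cobs ^ 2 * MSPHS.meanStepPow (M := M) P t (2 * p + 2)} := by
  obtain ⟨g₀, hg₀⟩ := hH
  obtain ⟨Cfit, hfit, Cbias, hbias, Cnorm, hnorm, hbound⟩ :=
    MSPHS.exists_estimator_error_bound hk hg₀ hx hxsmooth hxbound hσf hκ hp hmax ω σx2 hreg₀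
  refine ⟨Cfit, hfit, Cbias, hbias, fun K hKM Ω _ P _ t ε h ν hν => ?_⟩
  have hΦ := (MSPHS.contDiff_feature 𝓗 hk).differentiable one_ne_zero
  have hθ := Real.rpow_pos_of_pos (MSPHS.natCast_sub_pos hKM) (-(1 / 5))
  obtain ⟨cobs, hpos, hobs, hV⟩ := MSPHS.exists_observability_bound (P := P) (meth := meth) (x := x)
    (t := t) hΦ hσf hν hfit hbias hnorm hθ p
  refine ⟨cobs, hpos, hobs, fun η hη hη1 => (hbound K hKM P t ε h η hη hη1).trans ?_⟩
  refine measure_mono fun w ⟨d, hd, hW, hn⟩ => ?_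
  rw [Set.mem_ofPred_eq, hd]
  exact hV _ (zero_le_one.trans (MSPHS.one_le_log_four_div hη hη1)) d hW hn
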